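/- **Model.** Let $0\le\eta<1/2$ and $\gamma\in(0,1]$. An $\eta$-Massart halfspace model with margin $\gamma$ on $\mathbb R^d$ is a law $\mathcal D$ of $(x,Y)\in\mathbb R^d\times\{\pm1\}$ of the following form: $x\sim\mathcal D_x$ for an arbitrary probability measure $\mathcal D_x$, and, given $x$, $Y=\operatorname{sgn}\langle w^*,x\rangle$ with probability $1-\eta(x)$ and $Y=-\operatorname{sgn}\langle w^*,x\rangle$ otherwise, where $\eta(\cdot)$ is measurable with $0\le\eta(x)\le\eta$, $\|w^*\|=1$, and almost surely $\|x\|\le1$ and $|\langle w^*,x\rangle|\ge\gamma$. Here $\operatorname{sgn}$ takes values in $\{\pm1\}$, with $\operatorname{sgn}(0)=1$. Write $\operatorname{err}(w)=\Pr_{\mathcal D}[\operatorname{sgn}\langle w,x\rangle\ne Y]$. **Oracle.** Let $\mathrm{LeakyRelu}_\lambda(z)=\frac12z+(\frac12-\lambda)|z|$. Given $w$ and a sample of size $m$, let $R$ be the set of all $r>0$ such that at least an $\epsilon'$ fraction of the sample lies in the slab $\mathcal S(w,r)=\{x:|\langle w,x\rangle|<r\}$. For $r\in R$ let $\hat L^{\mathcal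 S(w,r)}_\lambda(v)$ be the average of $\mathrm{LeakyRelu}_\lambda(-Y\langle v,x\rangle)$ over the sample points in $\mathcal S(w,r)$. FindDescentDirection with parameters $\epsilon',\lambda$ picks some $r^*\in\arg\max_{r\in R}\hat L^{\mathcal S(w,r)}_\lambda(w)$ and returns some subgradient at $w$ of $v\mapsto\hat L_\lambda^{\mathcal S(w,r^*)}(v)$. Any choice of $r^*$ and of the subgradient that makes the result a measurable function of the sample and $w$ is allowed; such a function is called an implementation. **FilterTron.** Start at an arbitrary (fixed) $w_1$ in the unit ball and draw a test set of $m_0$ samples. For $t=1,\dots,T$: if the fraction of the test set misclassified by $w_t$ is less than $\eta+\epsilon/2$, return $w_t$; otherwise call FindDescentDirection with parameters $\epsilon/6,\lambda$ at $w_t$ on $m$ fresh samples to get $g_t$, and set $w_{t+1}=u_t/\max(1,\|u_t\|)$ with $u_t=w_t-g_t/\sqrt t$. If the loop ends without a return, nothing is returned. All samples are i.i.d. from $\mathcal D$. **Theorem.** There are absolute constants $c_0,c_1,C>0$ and one real-RAM program $P$ such that the following holds for all $0<\epsilon\le1$, $\eta\ge0$ with $\eta+\epsilon/6\le1/2$,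 $0<\delta<1$ and $0<\gamma\le1$. Put $\lambda=\eta+\epsilon/6$, $T=\lceil145/(\gamma^2\epsilon^2)\rceil$, $m_0=\lceil c_0\log(T/\delta)/\epsilon^2\rceil$, $m=\lceil c_1\log(2/\delta')/(\epsilon'^3\gamma^2)\rceil$ with $\epsilon'=\epsilon/6$, $\delta'=\delta/(2T)$, and let $n=m_0+Tm$ be the total number of samples. Then: 1. $n\le C\,\dfrac{\log(2/(\delta\gamma\epsilon))}{\gamma^4\epsilon^5}$. 2. For every $d$, every $\eta$-Massart halfspace model on $\mathbb R^d$ with margin $\gamma$, every $w_1$ in the unit ball, and every implementation of FindDescentDirection, with probability at least $1-\delta$ FilterTron returns a vector $w$ with $\operatorname{err}(w)\le\eta+\epsilon$. 3. For every $d\ge1$ there is an implementation of FindDescentDirection such that, for all $w_1$ in the unit ball and all samples, $P$ computes the result of FilterTron in at most $C(nd+n\log n)$ steps, on a real RAM with unit-cost arithmetic operations, square roots and comparisons on reals, and additions, subtractions, comparisons and indirect addressing on natural numbers. -/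

import Mathlib

open MeasureTheory

noncomputable section

namespace MassartHalfspace

/-- The ambient space `ℝ^d` with its Euclidean inner product. -/
abbrev Vec (d : ℕ) := EuclideanSpace ℝ (Fin d)

/-- A labelled example `(x, y)` with `x ∈ ℝ^d` and `y ∈ {1, -1}`. -/
abbrev Example (d : ℕ) := Vec d × ℤˣ

/-- The sign as a `{1, -1}`-valued classifier, with the convention `sgn 0 = 1`. -/
def sgn (z : ℝ) : ℤˣ := if 0 ≤ z then 1 else -1

/-- The numerical value `1` or `-1` of a label. -/
def labelVal (y : ℤˣ) : ℝ := ((y : ℤ) : ℝ)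

/-! ### The noise model -/

/-- The law of `(x, Y)` where `x ∼ Dx` and, given `x`, the label is `sgn ⟨w*, x⟩` with
probability `1 - flip x` and `-sgn ⟨w*, x⟩` with probability `flip x`. -/
def massartLaw {d : ℕ} (Dx : Measure (Vec d)) (flip : Vec d → ℝ) (wstar : Vec d) :
    Measure (Example d) :=
  (Dx.withDensity fun x => ENNReal.ofReal (1 - flip x)).map
      (fun x => (x, sgn (inner ℝ wstar x))) +
    (Dx.withDensity fun x => ENNReal.ofReal (flip x)).map
      (fun x => (x, -sgn (inner ℝ wstar x)))

/-- The data `Dx`, `flip`, `wstar` form an `η`-Massart halfspace model with margin `γ`. -/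
structure IsMassartHalfspace {d : ℕ} (η γ : ℝ) (Dx : Measure (Vec d)) (flip : Vec d → ℝ)
    (wstar : Vec d) : Prop where
  isProbabilityMeasure : IsProbabilityMeasure Dx
  measurable_flip : Measurable flip
  flip_nonneg : ∀ x, 0 ≤ flip x
  flip_le : ∀ x, flip x ≤ η
  norm_wstar : ‖wstar‖ = 1
  norm_le_one : ∀ᵐ x ∂Dx, ‖x‖ ≤ 1
  margin : ∀ᵐ x ∂Dx, γ ≤ |inner ℝ wstar x|

/-- The zero-one error `Pr (sgn ⟨w, x⟩ ≠ Y)` under the law `D` of `(x, Y)`. -/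
def err {d : ℕ} (D : Measure (Example d)) (w : Vec d) : ℝ :=
  D.real {p | sgn (inner ℝ w p.1) ≠ p.2}

/-- The zero-one error of `w` on a finite sample. -/
def empErr {d m : ℕ} (S : Fin m → Example d) (w : Vec d) : ℝ :=
  ((Finset.univ.filter fun i => sgn (inner ℝ w (S i).1) ≠ (S i).2).card : ℝ) / m

/-! ### The descent-direction oracle -/

/-- The LeakyRelu function with leakage parameter `lam`. -/
def leakyRelu (lam z : ℝ) : ℝ := (1 / 2) * z + (1 / 2 - lam) * |z|

/-- The indices of the sample points in the slab `{x : |⟨w, x⟩| < r}`. -/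
def slab {d m : ℕ} (S : Fin m → Example d) (w : Vec d) (r : ℝ) : Finset (Fin m) :=
  Finset.univ.filter fun i => |inner ℝ w (S i).1| < r

/-- The LeakyRelu loss of `v` under the empirical distribution of `S` conditioned on the slab
`{x : |⟨w, x⟩| < r}`. -/
def slabLoss {d m : ℕ} (lam : ℝ) (S : Fin m → Example d) (w : Vec d) (r : ℝ) (v : Vec d) : ℝ :=
  (∑ i ∈ slab S w r, leakyRelu lam (-labelVal (S i).2 * inner ℝ v (S i).1)) / (slab S w r).card

/-- The radii `r > 0` whose slab has empirical mass at least `ε`. -/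
def heavyRadii {d m : ℕ} (ε : ℝ) (S : Fin m → Example d) (w : Vec d) : Set ℝ :=
  {r | 0 < r ∧ ε ≤ ((slab S w r).card : ℝ) / m}

/-- `g` is a subgradient of `f` at `w`. -/
def IsSubgradientAt {d : ℕ} (f : Vec d → ℝ) (w g : Vec d) : Prop :=
  ∀ v, f w + inner ℝ g (v - w) ≤ f v

/-- `F` is an implementation of the descent-direction oracle with parameters `ε`, `lam` on samples
of size `m`: on a sample `S` and a vector `w` it chooses a radius `r` that maximizes the empirical
slab loss of `w` among all heavy radii, and returns a subgradient at `w` of the loss conditioned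
on this slab. Ties for the maximum and the choice of subgradient are resolved in
an arbitrary measurable way. -/
structure IsFindDescentDirection {d m : ℕ} (ε lam : ℝ)
    (F : (Fin m → Example d) → Vec d → Vec d) : Prop where
  measurable : Measurable fun p : (Fin m → Example d) × Vec d => F p.1 p.2
  spec : ∀ S w, ∃ r ∈ heavyRadii ε S w,
    (∀ r' ∈ heavyRadii ε S w, slabLoss lam S w r' w ≤ slabLoss lam S w r w) ∧
    IsSubgradientAt (slabLoss lam S w r) w (F S w)

/-! ### The learner -/

/-- Euclidean projection onto the unit ball. -/
def projBall {d : ℕ} (u : Vec d) : Vec d := (max 1 ‖u‖)⁻¹ • u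

/-- The main loop, started in round `t` at `w`; the list holds the fresh samples for the remaining
rounds. The value `none` means that the loop ended without returning a vector. -/
def filterTronLoop {d m₀ m : ℕ} (ε η : ℝ) (F : (Fin m → Example d) → Vec d → Vec d)
    (test : Fin m₀ → Example d) : ℕ → List (Fin m → Example d) → Vec d → Option (Vec d)
  | _, [], _ => none
  | t, S :: rest, w =>
    if empErr test w < η + ε / 2 then some w
    else filterTronLoop ε η F test (t + 1) rest (projBall (w - (1 / Real.sqrt t) • F S w))

/-- FilterTron with `T` rounds, started at `w₁`, with test set `test` and with the fresh
sample `train t` for the oracle call of each round. -/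
def filterTron {d m₀ m T : ℕ} (ε η : ℝ) (F : (Fin m → Example d) → Vec d → Vec d) (w₁ : Vec d)
    (test : Fin m₀ → Example d) (train : Fin T → Fin m → Example d) : Option (Vec d) :=
  filterTronLoop ε η F test 1 (List.ofFn train) w₁

/-- The joint law of a test set and `T` training samples, all examples being i.i.d. from `D`. -/
def sampleLaw {d : ℕ} (D : Measure (Example d)) (m₀ m T : ℕ) :
    Measure ((Fin m₀ → Example d) × (Fin T → Fin m → Example d)) :=
  (Measure.pi fun _ => D).prod (Measure.pi fun _ => Measure.pi fun _ => D)

/-- The number of rounds, `145 / (γ² ε²)` rounded up. -/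
def rounds (ε γ : ℝ) : ℕ := ⌈145 / (γ ^ 2 * ε ^ 2)⌉₊

/-- The size `c log (T / δ) / ε²` of the test set, rounded up. -/
def testSize (c ε δ : ℝ) (T : ℕ) : ℕ := ⌈c * Real.log (T / δ) / ε ^ 2⌉₊

/-- The size `c log (2 / δ) / (ε³ γ²)` of the sample of one oracle call, rounded up. -/
def oracleSize (c ε δ γ : ℝ) : ℕ := ⌈c * Real.log (2 / δ) / (ε ^ 3 * γ ^ 2)⌉₊

end MassartHalfspace

/-! ### A real RAM with unit costs -/

namespace RealRAM

/-- A memory configuration: registers holding natural numbers, registers holding real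
numbers, and a heap of each kind, which is addressed indirectly through registers. -/
structure State where
  natReg : ℕ → ℕ
  realReg : ℕ → ℝ
  natHeap : ℕ → ℕ
  realHeap : ℕ → ℝ

/-- The elementary instructions. The first argument names the destination. -/
inductive Instr
  | natConst (a k : ℕ)
  | natAdd (a b c : ℕ)
  | natSub (a b c : ℕ)
  | natLoad (a b : ℕ)
  | natStore (a b : ℕ)
  | realConst (a : ℕ) (k : ℤ)
  | realOfNat (a b : ℕ)
  | realAdd (a b c : ℕ)
  | realSub (a b c : ℕ)
  | realMul (a b c : ℕ)
  | realDiv (a b c : ℕ)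
  | realSqrt (a b : ℕ)
  | realLoad (a b : ℕ)
  | realStore (a b : ℕ)

/-- The effect of an elementary instruction. -/
def Instr.apply (σ : State) : Instr → State
  | natConst a k => { σ with natReg := Function.update σ.natReg a k }
  | natAdd a b c => { σ with natReg := Function.update σ.natReg a (σ.natReg b + σ.natReg c) }
  | natSub a b c => { σ with natReg := Function.update σ.natReg a (σ.natReg b - σ.natReg c) }
  | natLoad a b => { σ with natReg := Function.update σ.natReg a (σ.natHeap (σ.natReg b)) }
  | natStore a b => { σ with natHeap := Function.update σ.natHeap (σ.natReg a) (σ.natReg b) }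
  | realConst a k => { σ with realReg := Function.update σ.realReg a (k : ℝ) }
  | realOfNat a b => { σ with realReg := Function.update σ.realReg a (σ.natReg b : ℝ) }
  | realAdd a b c => { σ with realReg := Function.update σ.realReg a (σ.realReg b + σ.realReg c) }
  | realSub a b c => { σ with realReg := Function.update σ.realReg a (σ.realReg b - σ.realReg c) }
  | realMul a b c => { σ with realReg := Function.update σ.realReg a (σ.realReg b * σ.realReg c) }
  | realDiv a b c => { σ with realReg := Function.update σ.realReg a (σ.realReg b / σ.realReg c) }
  | realSqrt a b => { σ with realReg := Function.update σ.realReg a (Real.sqrt (σ.realReg b)) }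
  | realLoad a b => { σ with realReg := Function.update σ.realReg a (σ.realHeap (σ.natReg b)) }
  | realStore a b => { σ with realHeap := Function.update σ.realHeap (σ.natReg a) (σ.realReg b) }

/-- The tests on which a program can branch: comparisons of two registers. -/
inductive Test
  | natLt (a b : ℕ)
  | realLt (a b : ℕ)

/-- The truth value of a test. -/
def Test.holds (σ : State) : Test → Prop
  | natLt a b => σ.natReg a < σ.natReg b
  | realLt a b => σ.realReg a < σ.realReg b

/-- Structured programs. -/
inductive Prog
  | instr (i : Instr)
  | seq (p q : Prog)
  | branch (b : Test) (p q : Prog)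
  | loop (b : Test) (p : Prog)

/-- `Exec p σ k σ'`: the program `p`, started in `σ`, halts in `σ'` after exactly `k` steps. Every
elementary instruction and every evaluation of a test costs one step. -/
inductive Exec : Prog → State → ℕ → State → Prop
  | instr (i : Instr) (σ : State) : Exec (.instr i) σ 1 (i.apply σ)
  | seq {p q : Prog} {σ σ' σ'' : State} {k l : ℕ} :
      Exec p σ k σ' → Exec q σ' l σ'' → Exec (.seq p q) σ (k + l) σ''
  | branchTrue {b : Test} {p q : Prog} {σ σ' : State} {k : ℕ} :
      b.holds σ → Exec p σ k σ' → Exec (.branch b p q) σ (k + 1) σ'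
  | branchFalse {b : Test} {p q : Prog} {σ σ' : State} {k : ℕ} :
      ¬ b.holds σ → Exec q σ k σ' → Exec (.branch b p q) σ (k + 1) σ'
  | loopTrue {b : Test} {p : Prog} {σ σ' σ'' : State} {k l : ℕ} :
      b.holds σ → Exec p σ k σ' → Exec (.loop b p) σ' l σ'' → Exec (.loop b p) σ (k + l + 1) σ''
  | loopFalse {b : Test} {p : Prog} {σ : State} :
      ¬ b.holds σ → Exec (.loop b p) σ 1 σ

open MassartHalfspace

/-- An example is stored as its `d` coordinates followed by its label. -/
def encodeExample {d : ℕ} (p : Example d) : List ℝ :=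
  List.ofFn (fun j => p.1 j) ++ [labelVal p.2]

/-- A sample is stored example by example. -/
def encodeSample {d m : ℕ} (S : Fin m → Example d) : List ℝ :=
  (List.ofFn S).flatMap encodeExample

/-- The initial memory: the registers hold `d, m₀, m, T` and `ε, η, lam`; the real heap holds the
starting vector, the test set and the training samples; everything else is `0`. -/
def inputState {d m₀ m T : ℕ} (ε η lam : ℝ) (w₁ : Vec d) (test : Fin m₀ → Example d)
    (train : Fin T → Fin m → Example d) : State where
  natReg := fun i => [d, m₀, m, T].getD i 0
  realReg := fun i => [ε, η, lam].getD i 0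
  natHeap := fun _ => 0
  realHeap := fun i => (List.ofFn (fun j => w₁ j) ++ encodeSample test ++
    (List.ofFn train).flatMap encodeSample).getD i 0

/-- The memory `σ` represents the given result: natural-number register `0` tells whether a vector
is returned, and if so its coordinates are the first `d` cells of the real heap. -/
def Represents {d : ℕ} (σ : State) : Option (Vec d) → Prop
  | none => σ.natReg 0 = 0
  | some w => σ.natReg 0 = 1 ∧ ∀ j : Fin d, σ.realHeap j = w j

end RealRAM

end

open MassartHalfspace RealRAM

/-!
The proof has a learning part and a programming part.

**Learning.** Let `w` be an iterate that is not returned. The test set then shows that the error of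
`w` is well above `η`, hence the error of `w` on the fresh sample is at least `lam + ε / 6`. On an
example `(x, y)` the loss of `v` is `(1[v errs] - lam) * |⟨v, x⟩|` (`leakyRelu_neg_labelVal_mul`).
If all heavy slabs around the boundary of `w` had negative loss, then summation by parts against
the weight `1 / |⟨w, x⟩|`, capped on the smallest heavy slab, would bound the error by
`lam + ε / 6`; so the best heavy slab has nonnegative loss for `w`
(`exists_heavyRadii_slabLoss_nonneg`). On the other hand the loss of `wstar` on every heavy slab is
at most `-γ * ε / 8`: under the law of an example a suitable multiple of this loss, shifted, has
exponential moment at most one even when restricted to an arbitrary set of `x`, and the exponential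
Markov inequality applies to the slabs, of which a sample of size `m` has at most `m + 1`
(`pi_isBadSample_le`). The open slab with the `j`-th example on its boundary depends on this example
only and does not contain it, so that the other examples are still independent of the slab
(`pi_le_of_forall_value`). Since the loss is positively homogeneous, a subgradient `g` at `w`
satisfies `⟨g, w⟩ ≥ 0` and `⟨g, wstar⟩ ≤ -γ * ε / 8`. A step along `-g` therefore increases
`⟨w, wstar⟩` by `γ * ε / (8 * √t)`, while the norm before the projection is at most `√(1 + 1 / t)`,
and this cannot go on for `145 / (γ * ε) ^ 2` rounds (`projBall_iteration_bound`).

The failure events of a round concern a sample that is independent of the iterate: the test set is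
independent of all training samples, and the iterate of a round depends on earlier samples only
(`sampleLaw_test_le`, `sampleLaw_train_le`).

**Programming.** The radii between two consecutive values of `|⟨w, x⟩|` cut out the same slab, so
only finitely many candidates matter; `oracle` takes the largest best one, which is a measurable
choice. The program puts the indices of a sample into a binary heap ordered by `|⟨w, x⟩|`, removes
the largest again and again, and keeps the running sum of the losses, which gives the mean loss of
every slab in `O(log m)` steps each. The slab of the best radius then gives the subgradient in
`O(m * d)` steps. Correctness and step counts are proved together, with Hoare triples
`Runs p σ k Q` and a syntactic frame rule for the untouched registers
(`runs_filterTronProg`).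
-/

/-! ### The loss and its subgradients -/

namespace MassartHalfspace

lemma leakyRelu_eq (lam u : ℝ) : leakyRelu lam u = (if u < 0 then lam else 1 - lam) * u := by
  unfold leakyRelu
  split_ifs with h
  · rw [abs_of_neg h]; ring
  · rw [abs_of_nonneg (not_lt.1 h)]; ring

/-- The factor in front of `x` in the subgradient of `v ↦ leakyRelu lam (-y * ⟨v, x⟩)` at a point
`w` with `⟨w, x⟩ = p`. -/
noncomputable def slope (lam : ℝ) (y : ℤˣ) (p : ℝ) : ℝ :=
  -labelVal y * if -labelVal y * p < 0 then lam else 1 - lam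

lemma slope_mul (lam : ℝ) (y : ℤˣ) (p : ℝ) :
    slope lam y p * p = leakyRelu lam (-labelVal y * p) := by
  rw [leakyRelu_eq, slope]; ring

lemma slope_mul_le {lam : ℝ} (hlam : lam ≤ 1 / 2) (y : ℤˣ) (p q : ℝ) :
    slope lam y p * q ≤ leakyRelu lam (-labelVal y * q) := by
  rw [leakyRelu_eq, slope]
  split_ifs <;> nlinarith

lemma labelVal_eq (y : ℤˣ) : labelVal y = 1 ∨ labelVal y = -1 := by
  rcases Int.units_eq_one_or y with rfl | rfl <;> simp [labelVal]

lemma isSubgradientAt_slabLoss {d m : ℕ} {lam : ℝ} (hlam : lam ≤ 1 / 2) (S : Fin m → Example d)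
    (w : Vec d) (r : ℝ) :
    IsSubgradientAt (slabLoss lam S w r) w (((slab S w r).card : ℝ)⁻¹ •
      ∑ i ∈ slab S w r, slope lam (S i).2 (inner ℝ w (S i).1) • (S i).1) := by
  intro v
  simp only [slabLoss, inner_smul_left, sum_inner, div_eq_inv_mul, conj_trivial, ← mul_add]
  refine mul_le_mul_of_nonneg_left ?_ (by positivity)
  rw [← Finset.sum_add_distrib]
  refine Finset.sum_le_sum fun i _ => ?_
  rw [← slope_mul, ← mul_add, inner_sub_right, real_inner_comm w, real_inner_comm v]
  rw [add_sub_cancel]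
  exact slope_mul_le hlam _ _ _

/-! ### Selecting the radius -/

section Radius

variable {ι : Type*} [Fintype ι]

/-- The mean of `l` over the indices `i` with `z i < r`. -/
noncomputable def meanBelow (z l : ι → ℝ) (r : ℝ) : ℝ :=
  (∑ i with z i < r, l i) / (Finset.univ.filter fun i => z i < r).card

/-- The fraction of indices `i` with `z i < r` is at least `ε`. -/
def HeavyBelow (ε : ℝ) (z : ι → ℝ) (r : ℝ) : Prop :=
  ε ≤ ((Finset.univ.filter fun i => z i < r).card : ℝ) / Fintype.card ι

/-- Finitely many radii that realize all sets `{i | z i < r}`: the values of `z`, and one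
number larger than all of these. -/
noncomputable def radius (z : ι → ℝ) : Option ι → ℝ
  | none => ∑ i, z i + 1
  | some i => z i

/-- Among the candidate radii with a heavy set, `r` maximizes the mean of `l`, and it is the
largest maximizer. -/
structure IsBestRadius (ε : ℝ) (z l : ι → ℝ) (r : ℝ) : Prop where
  candidate : ∃ o, radius z o = r
  heavy : HeavyBelow ε z r
  le : ∀ o, HeavyBelow ε z (radius z o) → meanBelow z l (radius z o) ≤ meanBelow z l r
  largest : ∀ o, HeavyBelow ε z (radius z o) → meanBelow z l (radius z o) = meanBelow z l r →
    radius z o ≤ r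

open Classical in
/-- The radius of `IsBestRadius`, as an explicit maximum of finitely many measurable functions. -/
noncomputable def bestRadius (ε : ℝ) (z l : ι → ℝ) : ℝ :=
  Finset.univ.sup' Finset.univ_nonempty fun o =>
    if HeavyBelow ε z (radius z o) ∧ ∀ o', HeavyBelow ε z (radius z o') →
      meanBelow z l (radius z o') ≤ meanBelow z l (radius z o) then radius z o else 0

lemma lt_radius_none {z : ι → ℝ} (hz : ∀ i, 0 ≤ z i) (i : ι) : z i < radius z none :=
  (Finset.single_le_sum (fun i _ => hz i) (Finset.mem_univ i)).trans_lt (lt_add_one _)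

lemma radius_nonneg {z : ι → ℝ} (hz : ∀ i, 0 ≤ z i) : ∀ o, 0 ≤ radius z o
  | none => add_nonneg (Finset.sum_nonneg fun i _ => hz i) zero_le_one
  | some i => hz i

lemma heavyBelow_radius_none [Nonempty ι] {ε : ℝ} (hε : ε ≤ 1) {z : ι → ℝ} (hz : ∀ i, 0 ≤ z i) :
    HeavyBelow ε z (radius z none) := by
  have : (Finset.univ.filter fun i => z i < radius z none) = Finset.univ :=
    Finset.filter_true_of_mem fun i _ => lt_radius_none hz i
  rw [HeavyBelow, this, Finset.card_univ, div_self (by simp [Fintype.card_ne_zero])]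
  exact hε

lemma IsBestRadius.eq_bestRadius {ε : ℝ} {z l : ι → ℝ} {r : ℝ} (hz : ∀ i, 0 ≤ z i)
    (h : IsBestRadius ε z l r) : r = bestRadius ε z l := by
  classical
  obtain ⟨⟨o, rfl⟩, hh, hle, hla⟩ := h
  refine le_antisymm ?_ ?_
  · refine le_trans ?_ (Finset.le_sup' _ (Finset.mem_univ o))
    rw [if_pos ⟨hh, hle⟩]
  · refine Finset.sup'_le _ _ fun o' _ => ?_
    split_ifs with h'
    · exact hla _ h'.1 (le_antisymm (hle _ h'.1) (h'.2 _ hh))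
    · exact radius_nonneg hz o

lemma isBestRadius_bestRadius [Nonempty ι] {ε : ℝ} (hε : ε ≤ 1) {z : ι → ℝ} (hz : ∀ i, 0 ≤ z i)
    (l : ι → ℝ) : IsBestRadius ε z l (bestRadius ε z l) := by
  classical
  suffices ∃ r, IsBestRadius ε z l r by
    obtain ⟨r, hr⟩ := this
    exact hr.eq_bestRadius hz ▸ hr
  obtain ⟨o, ho, hmax⟩ := Finset.exists_max_image
    (Finset.univ.filter fun o => HeavyBelow ε z (radius z o))
    (fun o => meanBelow z l (radius z o)) ⟨none, by simp [heavyBelow_radius_none hε hz]⟩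
  obtain ⟨o', ho', hmax'⟩ := Finset.exists_max_image
    (Finset.univ.filter fun o' => HeavyBelow ε z (radius z o') ∧
      meanBelow z l (radius z o') = meanBelow z l (radius z o))
    (fun o => radius z o) ⟨o, by simpa using ho⟩
  simp only [Finset.mem_filter, Finset.mem_univ, true_and] at ho hmax ho' hmax'
  refine ⟨radius z o', ⟨o', rfl⟩, ho'.1, fun o₁ h₁ => ?_, fun o₁ h₁ h₂ => ?_⟩
  · rw [ho'.2]; exact hmax _ h₁
  · exact hmax' _ ⟨h₁, h₂.trans ho'.2⟩

/-- Every radius has the same set as one of the candidates: the least value that is not below it, or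
the extra candidate if the radius exceeds all values. -/
lemma exists_radius_filter_eq {z : ι → ℝ} (hz : ∀ i, 0 ≤ z i) (r : ℝ) :
    ∃ o, (Finset.univ.filter fun i => z i < radius z o) = Finset.univ.filter fun i => z i < r := by
  by_cases h : ∃ i, r ≤ z i
  · obtain ⟨i₀, h₀⟩ := h
    obtain ⟨i, hi, hmin⟩ := Finset.exists_min_image (Finset.univ.filter fun i => r ≤ z i) z
      ⟨i₀, by simpa using h₀⟩
    simp only [Finset.mem_filter, Finset.mem_univ, true_and] at hi hmin
    refine ⟨some i, Finset.filter_congr fun j _ => ⟨fun hj => ?_, fun hj => hj.trans_le hi⟩⟩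
    by_contra hjr
    exact (hmin j (not_lt.1 hjr)).not_gt hj
  · push Not at h
    exact ⟨none, Finset.filter_congr fun j _ => by simp [h j, lt_radius_none hz j]⟩

lemma IsBestRadius.meanBelow_le {ε : ℝ} {z l : ι → ℝ} {r : ℝ} (hz : ∀ i, 0 ≤ z i)
    (h : IsBestRadius ε z l r) {r' : ℝ} (hr' : HeavyBelow ε z r') :
    meanBelow z l r' ≤ meanBelow z l r := by
  obtain ⟨o, ho⟩ := exists_radius_filter_eq hz r'
  simpa only [meanBelow, ho] using h.le o (by rwa [HeavyBelow, ho])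

end Radius

/-! ### An implementation of the oracle -/

/-- The distance of `w` from each hyperplane, up to the norm of the example. -/
noncomputable def absMargin {d m : ℕ} (S : Fin m → Example d) (w : Vec d) (i : Fin m) : ℝ :=
  |inner ℝ w (S i).1|

/-- The loss of `w` on each example. -/
noncomputable def lossAt {d m : ℕ} (lam : ℝ) (S : Fin m → Example d) (w : Vec d) (i : Fin m) : ℝ :=
  leakyRelu lam (-labelVal (S i).2 * inner ℝ w (S i).1)

/-- The radius chosen by the implementation `oracle`. -/
noncomputable def oracleRadius {d m : ℕ} (ε lam : ℝ) (S : Fin m → Example d) (w : Vec d) : ℝ :=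
  bestRadius ε (absMargin S w) (lossAt lam S w)

/-- The implementation of the descent-direction oracle that prefers the largest optimal radius
and uses the right derivative of the loss at zero. -/
noncomputable def oracle {d m : ℕ} (ε lam : ℝ) (S : Fin m → Example d) (w : Vec d) : Vec d :=
  ((slab S w (oracleRadius ε lam S w)).card : ℝ)⁻¹ •
    ∑ i ∈ slab S w (oracleRadius ε lam S w),
      slope lam (S i).2 (inner ℝ w (S i).1) • (S i).1

lemma absMargin_nonneg {d m : ℕ} (S : Fin m → Example d) (w : Vec d) (i : Fin m) :
    0 ≤ absMargin S w i := abs_nonneg _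

lemma measurable_labelVal : Measurable labelVal :=
  measurable_from_top (f := fun k : ℤ => (k : ℝ)) |>.comp (comap_measurable Units.val)

lemma measurable_bestRadius {ι α : Type*} [Fintype ι] [MeasurableSpace α] (ε : ℝ)
    {z l : α → ι → ℝ} (hz : ∀ i, Measurable fun a => z a i) (hl : ∀ i, Measurable fun a => l a i) :
    Measurable fun a => bestRadius ε (z a) (l a) := by
  classical
  have hr : ∀ o, Measurable fun a => radius (z a) o := by
    rintro (_ | i)
    · exact (Finset.measurable_sum _ fun i _ => hz i).add_const 1
    · exact hz i
  have hc : ∀ o, Measurable fun a =>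
      ((Finset.univ.filter fun i => z a i < radius (z a) o).card : ℝ) := by
    intro o
    simp_rw [Finset.card_filter, Nat.cast_sum]
    refine Finset.measurable_sum _ fun i _ => ?_
    simp_rw [Nat.cast_ite]
    exact Measurable.ite (measurableSet_lt (hz i) (hr o)) measurable_const measurable_const
  have hh : ∀ o, MeasurableSet {a | HeavyBelow ε (z a) (radius (z a) o)} := fun o =>
    measurableSet_le measurable_const ((hc o).div_const _)
  have hm : ∀ o, Measurable fun a => meanBelow (z a) (l a) (radius (z a) o) := by
    intro o
    refine Measurable.div ?_ (hc o)
    simp_rw [Finset.sum_filter]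
    exact Finset.measurable_sum _ fun i _ =>
      Measurable.ite (measurableSet_lt (hz i) (hr o)) (hl i) measurable_const
  have : (fun a => bestRadius ε (z a) (l a)) = Finset.univ.sup' Finset.univ_nonempty
      fun o a => if HeavyBelow ε (z a) (radius (z a) o) ∧ ∀ o', HeavyBelow ε (z a)
        (radius (z a) o') → meanBelow (z a) (l a) (radius (z a) o') ≤
          meanBelow (z a) (l a) (radius (z a) o) then radius (z a) o else 0 := by
    funext a
    rw [Finset.sup'_apply]
    rfl
  rw [this]
  refine Finset.measurable_sup' _ fun o _ => Measurable.ite ?_ (hr o) measurable_const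
  have : MeasurableSet {a | ∀ o', HeavyBelow ε (z a) (radius (z a) o') →
      meanBelow (z a) (l a) (radius (z a) o') ≤ meanBelow (z a) (l a) (radius (z a) o)} := by
    rw [Set.ofPred_forall]
    refine MeasurableSet.iInter fun o' => ?_
    simp_rw [imp_iff_not_or]
    exact (hh o').compl.union (measurableSet_le (hm o') (hm o))
  exact (hh o).inter this

theorem measurable_oracle {d m : ℕ} (ε lam : ℝ) :
    Measurable fun p : (Fin m → Example d) × Vec d => oracle ε lam p.1 p.2 := by
  have hx : ∀ i, Measurable fun p : (Fin m → Example d) × Vec d => (p.1 i).1 := fun i => by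
    fun_prop
  have hy : ∀ i, Measurable fun p : (Fin m → Example d) × Vec d => labelVal (p.1 i).2 := fun i =>
    measurable_labelVal.comp (by fun_prop)
  have hi : ∀ i, Measurable fun p : (Fin m → Example d) × Vec d => inner ℝ p.2 (p.1 i).1 :=
    fun i => measurable_snd.inner (hx i)
  have hz : ∀ i, Measurable fun p : (Fin m → Example d) × Vec d => absMargin p.1 p.2 i := fun i =>
    (hi i).abs
  have hl : ∀ i, Measurable fun p : (Fin m → Example d) × Vec d => lossAt lam p.1 p.2 i := by
    intro i
    unfold lossAt leakyRelu
    have := (hy i).neg.mul (hi i)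
    exact (this.const_mul _).add (this.abs.const_mul _)
  have hr := measurable_bestRadius ε hz hl
  have hs : ∀ i, MeasurableSet {p : (Fin m → Example d) × Vec d |
      |inner ℝ p.2 (p.1 i).1| < oracleRadius ε lam p.1 p.2} := fun i => measurableSet_lt (hz i) hr
  have hc : Measurable fun p : (Fin m → Example d) × Vec d =>
      ((slab p.1 p.2 (oracleRadius ε lam p.1 p.2)).card : ℝ) := by
    unfold slab
    simp_rw [Finset.card_filter, Nat.cast_sum]
    refine Finset.measurable_sum _ fun i _ => ?_
    simp_rw [Nat.cast_ite]
    exact Measurable.ite (hs i) measurable_const measurable_const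
  have hsl : ∀ i, Measurable fun p : (Fin m → Example d) × Vec d =>
      slope lam (p.1 i).2 (inner ℝ p.2 (p.1 i).1) := fun i =>
    (hy i).neg.mul (Measurable.ite (measurableSet_lt ((hy i).neg.mul (hi i)) measurable_const)
      measurable_const measurable_const)
  have hg : Measurable fun p : (Fin m → Example d) × Vec d =>
      ∑ i ∈ slab p.1 p.2 (oracleRadius ε lam p.1 p.2),
        slope lam (p.1 i).2 (inner ℝ p.2 (p.1 i).1) • (p.1 i).1 := by
    unfold slab
    simp_rw [Finset.sum_filter]
    exact Finset.measurable_sum _ fun i _ => Measurable.ite (hs i) ((hsl i).smul (hx i))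
      measurable_const
  exact hc.inv.smul hg

theorem isFindDescentDirection_oracle {d m : ℕ} (hm : 0 < m) {ε lam : ℝ} (hε : 0 < ε)
    (hε1 : ε ≤ 1) (hlam : lam ≤ 1 / 2) :
    IsFindDescentDirection ε lam (oracle (d := d) (m := m) ε lam) := by
  refine ⟨measurable_oracle ε lam, fun S w => ⟨oracleRadius ε lam S w, ?_, ?_, ?_⟩⟩
  all_goals
    have : Nonempty (Fin m) := ⟨⟨0, hm⟩⟩
    have hbest : IsBestRadius ε _ _ (oracleRadius ε lam S w) :=
      isBestRadius_bestRadius hε1 (absMargin_nonneg S w) (lossAt lam S w)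
  · have hh : ε ≤ ((slab S w (oracleRadius ε lam S w)).card : ℝ) / m := by
      have := hbest.heavy
      rwa [HeavyBelow, Fintype.card_fin] at this
    refine ⟨?_, hh⟩
    have hc : (slab S w (oracleRadius ε lam S w)).Nonempty := by
      rw [Finset.nonempty_iff_ne_empty]
      intro h0
      rw [h0] at hh
      simp at hh
      linarith
    obtain ⟨i, hi⟩ := hc
    simp only [slab, Finset.mem_filter] at hi
    exact (abs_nonneg _).trans_lt hi.2
  · intro r' hr'
    exact hbest.meanBelow_le (absMargin_nonneg S w) (by
      rw [HeavyBelow, Fintype.card_fin]; exact hr'.2)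
  · exact isSubgradientAt_slabLoss hlam S w _

end MassartHalfspace

namespace MassartHalfspace

section Radius

variable {ι : Type*} [Fintype ι]

/-- The state of the search for the best radius after some indices have been removed in the order
of decreasing `z`: `R` holds the remaining indices, `last` is the value of the index removed last,
and `r` is the best candidate above `last`. -/
structure IsSelection (ε : ℝ) (z l : ι → ℝ) (R : Finset ι) (last r : ℝ) : Prop where
  le_last : ∀ i ∈ R, z i ≤ last
  last_le : ∀ i ∉ R, last ≤ z i
  lastCandidate : ∃ o, radius z o = last
  last_le_radius : last ≤ r
  candidate : ∃ o, radius z o = r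
  heavy : HeavyBelow ε z r
  best : ∀ o, last < radius z o ∨ o = none → HeavyBelow ε z (radius z o) →
    meanBelow z l (radius z o) ≤ meanBelow z l r ∧
    (meanBelow z l (radius z o) = meanBelow z l r → radius z o ≤ r)

lemma IsSelection.init [Nonempty ι] {ε : ℝ} (hε : ε ≤ 1) {z : ι → ℝ} (hz : ∀ i, 0 ≤ z i)
    (l : ι → ℝ) : IsSelection ε z l Finset.univ (radius z none) (radius z none) where
  le_last i _ := (lt_radius_none hz i).le
  last_le i hi := absurd (Finset.mem_univ i) hi
  lastCandidate := ⟨none, rfl⟩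
  last_le_radius := le_rfl
  candidate := ⟨none, rfl⟩
  heavy := heavyBelow_radius_none hε hz
  best := by
    rintro (_ | i) ho -
    · exact ⟨le_rfl, fun _ => le_rfl⟩
    · rcases ho with ho | ho
      · exact absurd ho (lt_radius_none hz i).not_gt
      · cases ho

lemma IsSelection.filter_eq {ε : ℝ} {z l : ι → ℝ} {R : Finset ι} {last r : ℝ}
    (h : IsSelection ε z l R last r) (hlt : ∀ i ∈ R, z i < last) :
    (Finset.univ.filter fun i => z i < last) = R := by
  ext i
  simp only [Finset.mem_filter, Finset.mem_univ, true_and]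
  refine ⟨fun hi => ?_, hlt i⟩
  by_contra hR
  exact (h.last_le i hR).not_gt hi

/-- Removing an index of maximal value without changing the best candidate: either no new
candidate has appeared, or the new one is not better. -/
lemma IsSelection.step_keep [DecidableEq ι] {ε : ℝ} {z l : ι → ℝ} {R : Finset ι} {last r : ℝ}
    {i : ι}
    (h : IsSelection ε z l R last r) (hi : i ∈ R) (hmax : ∀ k ∈ R, z k ≤ z i)
    (hkeep : z i < last → ε ≤ (R.card : ℝ) / Fintype.card ι →
      (∑ k ∈ R, l k) / R.card ≤ meanBelow z l r) :
    IsSelection ε z l (R.erase i) (z i) r where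
  le_last k hk := hmax k (Finset.mem_of_mem_erase hk)
  last_le k hk := by
    by_cases hki : k = i
    · rw [hki]
    · exact (h.le_last i hi).trans (h.last_le k fun hR => hk (Finset.mem_erase.2 ⟨hki, hR⟩))
  lastCandidate := ⟨some i, rfl⟩
  last_le_radius := (h.le_last i hi).trans h.last_le_radius
  candidate := h.candidate
  heavy := h.heavy
  best := by
    intro o ho hh
    by_cases hlo : last < radius z o ∨ o = none
    · exact h.best o hlo hh
    push Not at hlo
    have hio : z i < radius z o := ho.resolve_right hlo.2
    have heq : radius z o = last := by
      refine le_antisymm hlo.1 ?_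
      rcases o with _ | k
      · exact absurd rfl hlo.2
      · exact h.last_le k fun hk => (hmax k hk).not_gt hio
    have hset := h.filter_eq fun k hk => (hmax k hk).trans_lt (heq ▸ hio)
    rw [heq, HeavyBelow, hset] at hh
    have := hkeep (heq ▸ hio) hh
    rw [heq, meanBelow, hset]
    exact ⟨this, fun _ => h.last_le_radius⟩

/-- Removing an index of maximal value when the value removed before is a better candidate. -/
lemma IsSelection.step_change [DecidableEq ι] {ε : ℝ} {z l : ι → ℝ} {R : Finset ι} {last r : ℝ}
    {i : ι}
    (h : IsSelection ε z l R last r) (hi : i ∈ R) (hmax : ∀ k ∈ R, z k ≤ z i)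
    (hlt : z i < last) (hheavy : ε ≤ (R.card : ℝ) / Fintype.card ι)
    (hmean : meanBelow z l r < (∑ k ∈ R, l k) / R.card) :
    IsSelection ε z l (R.erase i) (z i) last ∧
      meanBelow z l last = (∑ k ∈ R, l k) / R.card := by
  have hset := h.filter_eq fun k hk => (hmax k hk).trans_lt hlt
  have hm : meanBelow z l last = (∑ k ∈ R, l k) / R.card := by rw [meanBelow, hset]
  refine ⟨⟨fun k hk => hmax k (Finset.mem_of_mem_erase hk), fun k hk => ?_, ⟨some i, rfl⟩, hlt.le,
    h.lastCandidate, by rwa [HeavyBelow, hset], fun o ho hh => ?_⟩, hm⟩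
  · by_cases hki : k = i
    · rw [hki]
    · exact (h.le_last i hi).trans (h.last_le k fun hR => hk (Finset.mem_erase.2 ⟨hki, hR⟩))
  by_cases hlo : last < radius z o ∨ o = none
  · have := (h.best o hlo hh).1.trans_lt (hm ▸ hmean)
    exact ⟨this.le, fun heq => absurd heq this.ne⟩
  push Not at hlo
  have hio : z i < radius z o := ho.resolve_right hlo.2
  have heq : radius z o = last := by
    refine le_antisymm hlo.1 ?_
    rcases o with _ | k
    · exact absurd rfl hlo.2
    · exact h.last_le k fun hk => (hmax k hk).not_gt hio
  rw [heq]
  exact ⟨le_rfl, fun _ => le_rfl⟩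

lemma IsSelection.eq_bestRadius {ε : ℝ} (hε : 0 < ε) {z l : ι → ℝ} (hz : ∀ i, 0 ≤ z i)
    {last r : ℝ} (h : IsSelection ε z l ∅ last r) : r = bestRadius ε z l := by
  have key : ∀ o, HeavyBelow ε z (radius z o) → last < radius z o ∨ o = none := by
    rintro (_ | i) hh
    · exact .inr rfl
    · refine .inl ((h.last_le i (Finset.notMem_empty i)).lt_of_ne fun heq => ?_)
      have : (Finset.univ.filter fun k => z k < radius z (some i)) = ∅ :=
        Finset.filter_false_of_mem fun k _ => by
          change ¬ z k < z i
          rw [← heq]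
          exact (h.last_le k (Finset.notMem_empty k)).not_gt
      rw [HeavyBelow, this] at hh
      simp at hh
      linarith
  exact IsBestRadius.eq_bestRadius hz ⟨h.candidate, h.heavy,
    fun o ho => (h.best o (key o ho) ho).1, fun o ho => (h.best o (key o ho) ho).2⟩

end Radius

end MassartHalfspace

/-! ### A program logic with running times -/

namespace RealRAM

/-- Whether the instruction leaves the natural-number register `a` alone. -/
def Instr.keepsNat (a : ℕ) : Instr → Bool
  | natConst b _ | natAdd b _ _ | natSub b _ _ | natLoad b _ => a != b
  | _ => true

/-- Whether the instruction leaves the real register `a` alone. -/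
def Instr.keepsReal (a : ℕ) : Instr → Bool
  | realConst b _ | realOfNat b _ | realAdd b _ _ | realSub b _ _ | realMul b _ _ | realDiv b _ _
  | realSqrt b _ | realLoad b _ => a != b
  | _ => true

/-- Whether the instruction leaves the heap of natural numbers alone. -/
def Instr.keepsNatHeap : Instr → Bool
  | natStore _ _ => false
  | _ => true

/-- Whether the instruction leaves the heap of real numbers alone. -/
def Instr.keepsRealHeap : Instr → Bool
  | realStore _ _ => false
  | _ => true

/-- Whether the instruction leaves register `7` at the value `0`, if it has this value. -/
def Instr.keepsZero : Instr → Bool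
  | natConst a k => a != 7 || k == 0
  | i => i.keepsNat 7

/-- Whether all instructions that occur in a program satisfy a Boolean condition. -/
def Prog.all (f : Instr → Bool) : Prog → Bool
  | instr i => f i
  | seq p q => p.all f && q.all f
  | branch _ p q => p.all f && q.all f
  | loop _ p => p.all f

/-- Two states agree on everything that `p` does not write, judged from the text of `p`. -/
structure Frame (p : Prog) (σ σ' : State) : Prop where
  nat : ∀ a, p.all (Instr.keepsNat a) = true → σ'.natReg a = σ.natReg a
  real : ∀ a, p.all (Instr.keepsReal a) = true → σ'.realReg a = σ.realReg a
  natHeap : p.all Instr.keepsNatHeap = true → σ'.natHeap = σ.natHeap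
  realHeap : p.all Instr.keepsRealHeap = true → σ'.realHeap = σ.realHeap
  zero : p.all Instr.keepsZero = true → σ.natReg 7 = 0 → σ'.natReg 7 = 0

lemma Frame.rfl {p : Prog} {σ : State} : Frame p σ σ :=
  ⟨fun _ _ => .refl _, fun _ _ => .refl _, fun _ => .refl _, fun _ => .refl _,
    fun _ h => h⟩

lemma Frame.trans {p : Prog} {σ σ' σ'' : State} (h : Frame p σ σ') (h' : Frame p σ' σ'') :
    Frame p σ σ'' :=
  ⟨fun a ha => (h'.nat a ha).trans (h.nat a ha), fun a ha => (h'.real a ha).trans (h.real a ha),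
    fun ha => (h'.natHeap ha).trans (h.natHeap ha),
    fun ha => (h'.realHeap ha).trans (h.realHeap ha),
    fun ha h0 => h'.zero ha (h.zero ha h0)⟩

/-- A frame for a program with fewer instructions is a frame for one with more. -/
lemma Frame.mono {p q : Prog} {σ σ' : State} (h : Frame p σ σ')
    (hpq : ∀ f, q.all f = true → p.all f = true) : Frame q σ σ' :=
  ⟨fun a ha => h.nat a (hpq _ ha), fun a ha => h.real a (hpq _ ha),
    fun ha => h.natHeap (hpq _ ha), fun ha => h.realHeap (hpq _ ha),
    fun ha => h.zero (hpq _ ha)⟩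

lemma Frame.instr (i : Instr) (σ : State) : Frame (.instr i) σ (i.apply σ) := by
  constructor
  case zero =>
    intro h h7
    cases i
    case natConst a k =>
      rcases eq_or_ne a 7 with rfl | ha
      · simpa [Prog.all, Instr.keepsZero, Instr.apply] using h
      · simp [Instr.apply, Function.update_of_ne ha.symm, h7]
    all_goals simp_all [Prog.all, Instr.keepsZero, Instr.keepsNat, Instr.apply]
  all_goals
    cases i <;> simp +contextual [Prog.all, Instr.keepsNat, Instr.keepsReal, Instr.keepsNatHeap,
      Instr.keepsRealHeap, Instr.apply]

lemma Exec.frame {p : Prog} {σ σ' : State} {k : ℕ} (h : Exec p σ k σ') : Frame p σ σ' := by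
  induction h with
  | instr i σ => exact Frame.instr i σ
  | seq _ _ ih₁ ih₂ =>
    exact (ih₁.mono fun f hf => by simp_all [Prog.all]).trans
      (ih₂.mono fun f hf => by simp_all [Prog.all])
  | branchTrue _ _ ih => exact ih.mono fun f hf => by simp_all [Prog.all]
  | branchFalse _ _ ih => exact ih.mono fun f hf => by simp_all [Prog.all]
  | loopTrue _ _ _ ih₁ ih₂ =>
    exact (ih₁.mono fun f hf => by simp_all [Prog.all]).trans ih₂
  | loopFalse _ => exact Frame.rfl

/-- Total correctness with a time bound: started in `σ`, the program `p` halts after at most `k`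
steps, in a state that satisfies `Q`. -/
def Runs (p : Prog) (σ : State) (k : ℕ) (Q : State → Prop) : Prop :=
  ∃ l ≤ k, ∃ σ', Exec p σ l σ' ∧ Q σ'

variable {p q : Prog} {σ : State} {k l : ℕ} {Q Q' : State → Prop} {b : Test}

lemma Runs.mono (h : Runs p σ k Q) (hk : k ≤ l) (hQ : ∀ σ', Frame p σ σ' → Q σ' → Q' σ') :
    Runs p σ l Q' := by
  obtain ⟨j, hj, σ', he, hq⟩ := h
  exact ⟨j, hj.trans hk, σ', he, hQ _ he.frame hq⟩

lemma Runs.instr {i : Instr} (h : Q (i.apply σ)) : Runs (.instr i) σ 1 Q :=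
  ⟨1, le_rfl, _, .instr i σ, h⟩

lemma Runs.seq (h : Runs p σ k fun σ' => Frame p σ σ' → Runs q σ' l Q) :
    Runs (.seq p q) σ (k + l) Q := by
  obtain ⟨i, hi, σ', he, hq⟩ := h
  obtain ⟨j, hj, σ'', he', hq⟩ := hq he.frame
  exact ⟨i + j, by omega, σ'', .seq he he', hq⟩

lemma Runs.seq' (R : State → Prop) (h : Runs p σ k R)
    (h' : ∀ σ', R σ' → Frame p σ σ' → Runs q σ' l Q) : Runs (.seq p q) σ (k + l) Q :=
  Runs.seq (h.mono le_rfl fun σ' _ hR hF => h' σ' hR hF)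

lemma Runs.of_le (h : Runs p σ k Q) (hk : k ≤ l) : Runs p σ l Q :=
  h.mono hk fun _ _ h => h

lemma Runs.branch (ht : b.holds σ → Runs p σ k Q) (hf : ¬ b.holds σ → Runs q σ k Q) :
    Runs (.branch b p q) σ (k + 1) Q := by
  by_cases hb : b.holds σ
  · obtain ⟨i, hi, σ', he, hq⟩ := ht hb
    exact ⟨i + 1, by omega, σ', .branchTrue hb he, hq⟩
  · obtain ⟨i, hi, σ', he, hq⟩ := hf hb
    exact ⟨i + 1, by omega, σ', .branchFalse hb he, hq⟩

/-- A loop with invariant `I`, whose first argument bounds the number of remaining rounds. -/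
lemma Runs.while {c N : ℕ} {I : ℕ → State → Prop} (h0 : I N σ)
    (step : ∀ n σ', I n σ' → Frame p σ σ' → b.holds σ' → ∃ n', n = n' + 1 ∧ Runs p σ' c (I n')) :
    Runs (.loop b p) σ (N * (c + 1) + 1)
      fun σ' => (∃ n, I n σ') ∧ ¬ b.holds σ' ∧ Frame p σ σ' := by
  suffices H : ∀ n σ', I n σ' → Frame p σ σ' → Runs (.loop b p) σ' (n * (c + 1) + 1)
      fun σ' => (∃ n, I n σ') ∧ ¬ b.holds σ' ∧ Frame p σ σ' from H N σ h0 Frame.rfl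
  intro n
  induction n with
  | zero =>
    intro σ' hI hF
    by_cases hb : b.holds σ'
    · obtain ⟨n', hn', -⟩ := step 0 σ' hI hF hb
      omega
    · exact ⟨1, by omega, σ', .loopFalse hb, ⟨0, hI⟩, hb, hF⟩
  | succ n ih =>
    intro σ' hI hF
    by_cases hb : b.holds σ'
    · obtain ⟨n', hn', i, hi, σ₁, he, hq⟩ := step _ σ' hI hF hb
      obtain rfl : n = n' := by omega
      obtain ⟨j, hj, σ₂, he', hq'⟩ := ih σ₁ hq (hF.trans he.frame)
      exact ⟨i + j + 1, by linarith [add_mul n 1 (c + 1)], σ₂, .loopTrue hb he he', hq'⟩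
    · exact ⟨1, by omega, σ', .loopFalse hb, ⟨n + 1, hI⟩, hb, hF⟩

/-- A loop that runs for exactly `N` rounds. The first argument of the invariant counts the
rounds that are finished. -/
lemma Runs.for {c N : ℕ} {I : ℕ → State → Prop} (h0 : I 0 σ)
    (hb : ∀ j σ', I j σ' → Frame p σ σ' → j ≤ N → (b.holds σ' ↔ j < N))
    (step : ∀ j σ', j < N → I j σ' → Frame p σ σ' → Runs p σ' c (I (j + 1))) :
    Runs (.loop b p) σ (N * (c + 1) + 1) fun σ' => I N σ' ∧ Frame p σ σ' := by
  refine (Runs.while (I := fun n σ' => n ≤ N ∧ I (N - n) σ' ∧ Frame p σ σ')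
    (c := c) (N := N) ⟨le_rfl, by simpa using h0, Frame.rfl⟩ ?_).mono le_rfl ?_
  · rintro n σ' ⟨hn, hI, hF⟩ - hh
    have hlt := (hb _ _ hI hF (by omega)).1 hh
    refine ⟨n - 1, by omega, (step _ _ hlt hI hF).mono le_rfl fun σ'' hF' hI' => ?_⟩
    exact ⟨by omega, by rwa [show N - (n - 1) = N - n + 1 by omega], hF.trans hF'⟩
  · rintro σ' - ⟨⟨n, hn, hI, hF⟩, hnb, -⟩
    rw [hb _ _ hI hF (by omega)] at hnb
    exact ⟨by rwa [show N - n = N by omega] at hI, hF⟩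

/-- Straight-line code. Register `7` is reserved for the constant `0`; the last instruction
resets it, so that `code []` is a program that does nothing. -/
def code : List Instr → Prog
  | [] => .instr (.natConst 7 0)
  | i :: l => .seq (.instr i) (code l)

lemma Runs.code {l : List Instr}
    (h : Q ((Instr.natConst 7 0).apply (l.foldl Instr.apply σ))) :
    Runs (code l) σ (l.length + 1) Q := by
  induction l generalizing σ with
  | nil => exact Runs.instr h
  | cons i l ih =>
    have := Runs.seq (p := .instr i) (k := 1) (Runs.instr (σ := σ) fun _ => ih h)
    exact this.mono (by simp; omega) fun _ _ h => h

end RealRAM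

/-! ### Inner products -/

namespace RealRAM
open Instr Prog Test

/-- The inner product of the vectors stored at `0` and at the address in register `14`. -/
def dotProg : Prog :=
  seq (code [realConst 5 0, natConst 15 0])
    (loop (natLt 15 4) (code [realLoad 6 15, realLoad 7 14, realMul 6 6 7, realAdd 5 5 6,
      natAdd 15 15 5, natAdd 14 14 5]))

lemma runs_dotProg {σ : State} (h5 : σ.natReg 5 = 1) :
    Runs dotProg σ (8 * σ.natReg 4 + 4) fun σ' =>
      σ'.realReg 5 = ∑ j ∈ Finset.range (σ.natReg 4),
        σ.realHeap j * σ.realHeap (σ.natReg 14 + j) ∧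
      σ'.natReg 14 = σ.natReg 14 + σ.natReg 4 := by
  refine (Runs.seq' (fun σ' => σ'.realReg 5 = 0 ∧ σ'.natReg 15 = 0) (Runs.code ?_)
    (l := 8 * σ.natReg 4 + 1) fun σ₁ h₁ F₁ => ?_).of_le (by simp; omega)
  · simp [apply]
  have e4 := F₁.nat 4 rfl
  have e5 := F₁.nat 5 rfl
  have e14 := F₁.nat 14 rfl
  have eH := F₁.realHeap rfl
  refine ((Runs.for (c := 7) (N := σ.natReg 4) (I := fun j σ' =>
    σ'.realReg 5 = ∑ j ∈ Finset.range j, σ.realHeap j * σ.realHeap (σ.natReg 14 + j) ∧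
    σ'.natReg 14 = σ.natReg 14 + j ∧ σ'.natReg 15 = j) ?_ ?_ ?_).mono (by omega) ?_)
  · simp [h₁, e14]
  · rintro j σ' ⟨-, -, hj⟩ F -
    simp [holds, hj, F.nat 4 rfl, e4]
  · rintro j σ' hj ⟨i1, i2, i3⟩ F
    refine (Runs.code ?_)
    have f5 := F.nat 5 rfl
    have fH := F.realHeap rfl
    simp [apply, i1, i2, i3, f5, e5, h5, fH, eH, Finset.sum_range_succ, add_assoc]
  · rintro σ' - ⟨⟨i1, i2, i3⟩, F⟩
    exact ⟨i1, i2⟩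

end RealRAM

/-! ### Errors, margins and losses of a sample -/

namespace RealRAM
open Instr Prog Test

/-- The vector `w` is stored at address `a`. -/
def VecAt {d : ℕ} (H : ℕ → ℝ) (a : ℕ) (w : Vec d) : Prop :=
  ∀ j : Fin d, H (a + j) = w j

/-- The sample `S` is stored at address `a`. -/
def SampleAt {d m : ℕ} (H : ℕ → ℝ) (a : ℕ) (S : Fin m → Example d) : Prop :=
  ∀ i : Fin m, VecAt H (a + i * (d + 1)) (S i).1 ∧
    H (a + i * (d + 1) + d) = labelVal (S i).2

lemma VecAt.congr {d : ℕ} {H H' : ℕ → ℝ} {a : ℕ} {w : Vec d} (h : VecAt H a w)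
    (hH : ∀ k < a + d, H' k = H k) : VecAt H' a w := fun j => by
  rw [hH _ (by omega), h j]

lemma add_mul_add_lt {a d m B i k : ℕ} (hB : a + m * (d + 1) ≤ B) (hi : i < m) (hk : k ≤ d) :
    a + i * (d + 1) + k < B := by
  have : (i + 1) * (d + 1) ≤ m * (d + 1) := Nat.mul_le_mul_right _ hi
  rw [add_mul] at this
  omega

lemma SampleAt.congr {d m : ℕ} {H H' : ℕ → ℝ} {a B : ℕ} {S : Fin m → Example d}
    (h : SampleAt H a S) (hB : a + m * (d + 1) ≤ B) (hH : ∀ k < B, H' k = H k) :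
    SampleAt H' a S := fun i => by
  refine ⟨(h i).1.congr fun k hk => hH k (hk.trans (add_mul_add_lt hB i.2 le_rfl)), ?_⟩
  rw [hH _ (add_mul_add_lt hB i.2 le_rfl), (h i).2]

lemma sum_mul_eq_inner {d : ℕ} {H : ℕ → ℝ} {a : ℕ} {w x : Vec d} (hw : VecAt H 0 w)
    (hx : VecAt H a x) : ∑ j ∈ Finset.range d, H j * H (a + j) = inner ℝ w x := by
  rw [PiLp.inner_apply, Finset.sum_range]
  refine Finset.sum_congr rfl fun j _ => ?_
  have := hw j
  rw [zero_add] at this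
  rw [this, hx j]
  simp [mul_comm]

lemma sum_val_lt_succ {M : Type*} [AddCommMonoid M] {m j : ℕ} (hj : j < m) (f : Fin m → M) :
    ∑ i : Fin m with i.val < j + 1, f i = ∑ i : Fin m with i.val < j, f i + f ⟨j, hj⟩ := by
  have : (Finset.univ.filter fun i : Fin m => i.val < j + 1) =
      insert ⟨j, hj⟩ (Finset.univ.filter fun i : Fin m => i.val < j) := by
    ext i
    simp [Fin.ext_iff]
    omega
  rw [this, Finset.sum_insert (by simp), add_comm]

lemma sum_val_lt_self {M : Type*} [AddCommMonoid M] {m : ℕ} (f : Fin m → M) :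
    ∑ i : Fin m with i.val < m, f i = ∑ i, f i := by
  rw [Finset.filter_true_of_mem fun i _ => i.2]

lemma labelVal_neg_iff (y : ℤˣ) : labelVal y < 0 ↔ y = -1 := by
  rcases Int.units_eq_one_or y with rfl | rfl <;> norm_num [labelVal]

/-- The number of test examples on which the current vector errs, computed in real register `8`.
The examples are traversed by the address in register `14` and the index in register `16`. -/
def errProg : Prog :=
  seq (code [realConst 8 0, realConst 9 1, realConst 10 0, natConst 16 0, natAdd 14 4 7])
    (loop (natLt 16 1) (seq dotProg (seq (code [realLoad 6 14, natAdd 14 14 5, natAdd 16 16 5])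
      (branch (realLt 5 10)
        (branch (realLt 6 10) (code []) (code [realAdd 8 8 9]))
        (branch (realLt 6 10) (code [realAdd 8 8 9]) (code []))))))

lemma runs_errProg {d m₀ : ℕ} {σ : State} {w : Vec d} {S : Fin m₀ → Example d}
    (h1 : σ.natReg 1 = m₀) (h4 : σ.natReg 4 = d) (h5 : σ.natReg 5 = 1) (h7 : σ.natReg 7 = 0)
    (hw : VecAt σ.realHeap 0 w) (hS : SampleAt σ.realHeap d S) :
    Runs errProg σ (m₀ * (8 * d + 13) + 7) fun σ' =>
      σ'.realReg 8 = (Finset.univ.filter fun i => sgn (inner ℝ w (S i).1) ≠ (S i).2).card := by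
  refine (Runs.seq' (fun σ' => σ'.realReg 8 = 0 ∧ σ'.realReg 9 = 1 ∧ σ'.realReg 10 = 0 ∧
    σ'.natReg 16 = 0 ∧ σ'.natReg 14 = d) (Runs.code ?_)
    (l := m₀ * (8 * d + 13) + 1) fun σ₁ h₁ F₁ => ?_).of_le (by simp; omega)
  · simp [apply, h4, h7]
  obtain ⟨a8, a9, a10, a16, a14⟩ := h₁
  have e1 := F₁.nat 1 rfl
  have e4 := F₁.nat 4 rfl
  have e5 := F₁.nat 5 rfl
  have eH := F₁.realHeap rfl
  let f : Fin m₀ → ℝ := fun i => if sgn (inner ℝ w (S i).1) ≠ (S i).2 then 1 else 0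
  refine (Runs.for (c := 8 * d + 12) (N := m₀) (I := fun j σ' =>
    σ'.realReg 8 = ∑ i : Fin m₀ with i.val < j, f i ∧
    σ'.natReg 14 = d + j * (d + 1) ∧ σ'.natReg 16 = j) ?_ ?_ ?_).mono le_rfl ?_
  · simp [a8, a14, a16]
  · rintro j σ' ⟨-, -, hj⟩ F -
    simp [holds, hj, F.nat 1 rfl, e1, h1]
  · rintro j σ' hj ⟨i1, i2, i3⟩ F
    have f4 := (F.nat 4 rfl).trans (e4.trans h4)
    have f5 := (F.nat 5 rfl).trans (e5.trans h5)
    have fH := (F.realHeap rfl).trans eH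
    have f9 := (F.real 9 rfl).trans a9
    have f10 := (F.real 10 rfl).trans a10
    obtain ⟨hx, hy⟩ := hS ⟨j, hj⟩
    have hd := runs_dotProg f5
    rw [f4, i2, fH, sum_mul_eq_inner hw hx] at hd
    refine (Runs.seq' _ hd (l := 8) fun σ₂ h₂ F₂ => ?_).of_le (by omega)
    refine (Runs.seq' (fun σ' => σ'.realReg 6 = labelVal (S ⟨j, hj⟩).2 ∧
      σ'.natReg 14 = d + (j + 1) * (d + 1) ∧ σ'.natReg 16 = j + 1) (Runs.code ?_)
      (l := 4) fun σ₃ h₃ F₃ => ?_).of_le (by simp)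
    · simp only at hy
      simp [apply, F₂.realHeap rfl, fH, h₂.2, hy, F₂.nat 5 rfl, f5, F₂.nat 16 rfl, i3]
      ring
    have g5 := (F₃.real 5 rfl).trans h₂.1
    have g10 := (F₃.real 10 rfl).trans ((F₂.real 10 rfl).trans f10)
    have g9 := (F₃.real 9 rfl).trans ((F₂.real 9 rfl).trans f9)
    have g8 := (F₃.real 8 rfl).trans ((F₂.real 8 rfl).trans i1)
    simp only [sum_val_lt_succ hj]
    have c0 : ∀ x y : ℤˣ, (if x ≠ y then (1 : ℝ) else 0) = if x = -1 then if y = -1 then 0 else 1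
        else if y = -1 then 1 else 0 := by
      intro x y
      rcases Int.units_eq_one_or x with rfl | rfl <;>
        rcases Int.units_eq_one_or y with rfl | rfl <;> simp
    have hs : sgn (inner ℝ w (S ⟨j, hj⟩).1) = -1 ↔ inner ℝ w (S ⟨j, hj⟩).1 < 0 := by
      unfold sgn
      split_ifs with h
      · simp [h]
      · simpa using h
    have hf : f ⟨j, hj⟩ = _ := c0 _ _
    refine Runs.branch (k := 3) (fun hb => ?_) fun hb => ?_ <;>
      (simp only [holds, g5, g10] at hb
       refine Runs.branch (k := 2) (fun hb' => ?_) fun hb' => ?_) <;>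
      (simp only [holds, h₃.1, g10, labelVal_neg_iff] at hb'
       refine (Runs.code ?_).of_le (by simp)
       simp [apply, h₃.2, g8, g9, hf, hs, hb, hb'])
  · rintro σ' - ⟨⟨i1, i2, i3⟩, F⟩
    rw [i1, sum_val_lt_self]
    rw [Finset.card_filter]
    push_cast
    rfl

/-- For each example of the current training block, its margin, the loss of the current vector and
the slope of the loss are written to three arrays, whose addresses are in the registers `10`, `11`,
`12`. The heap of natural numbers receives the list of all indices. The sums of the losses and
of the margins are accumulated in the real registers `14` and `15`. -/
def marginProg : Prog :=
  seq (code [realConst 9 1, realConst 10 0, realSub 13 9 2, realConst 14 0, realConst 15 0,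
      natConst 16 0, natAdd 14 9 7])
    (loop (natLt 16 2) (seq dotProg
      (seq (code [realLoad 6 14, realSub 12 10 6, realMul 11 12 5, natAdd 20 10 16,
          natAdd 21 11 16, natAdd 22 12 16])
        (seq (branch (realLt 11 10)
            (code [realSub 16 10 11, realMul 17 2 11, realMul 18 12 2])
            (code [realAdd 16 11 10, realMul 17 13 11, realMul 18 12 13]))
          (code [realStore 20 16, realStore 21 17, realStore 22 18, natStore 16 16,
            realAdd 14 14 17, realAdd 15 15 16, natAdd 14 14 5, natAdd 16 16 5])))))

/-- The contents of the three arrays written by `marginProg`, up to index `j`. -/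
structure MarginsAt {d m : ℕ} (lam : ℝ) (w : Vec d) (S : Fin m → Example d) (B j : ℕ)
    (σ : State) : Prop where
  margin : ∀ i : Fin m, i.val < j → σ.realHeap (B + i) = absMargin S w i
  loss : ∀ i : Fin m, i.val < j → σ.realHeap (B + m + i) = lossAt lam S w i
  slope : ∀ i : Fin m, i.val < j →
    σ.realHeap (B + 2 * m + i) = slope lam (S i).2 (inner ℝ w (S i).1)

lemma update_update_update_of_lt {H : ℕ → ℝ} {B m j k : ℕ} (hk : k < B) (x y z : ℝ) :
    Function.update (Function.update (Function.update H (B + j) x) (B + m + j) y)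
      (B + 2 * m + j) z k = H k := by
  simp only [Function.update_apply]
  rw [if_neg (by omega), if_neg (by omega), if_neg (by omega)]

lemma MarginsAt.succ {d m B j : ℕ} {lam : ℝ} {w : Vec d} {S : Fin m → Example d} {σ τ : State}
    (h : MarginsAt lam w S B j σ) (hj : j < m)
    (hτ : τ.realHeap = Function.update (Function.update
      (Function.update σ.realHeap (B + j) (absMargin S w ⟨j, hj⟩)) (B + m + j)
      (lossAt lam S w ⟨j, hj⟩)) (B + 2 * m + j)
      (MassartHalfspace.slope lam (S ⟨j, hj⟩).2 (inner ℝ w (S ⟨j, hj⟩).1))) :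
    MarginsAt lam w S B (j + 1) τ := by
  refine ⟨fun i hi => ?_, fun i hi => ?_, fun i hi => ?_⟩ <;> rw [hτ] <;>
    simp only [Function.update_apply] <;> rcases Nat.lt_succ_iff_lt_or_eq.1 hi with hi | hi
  · rw [if_neg (by omega), if_neg (by omega), if_neg (by omega), h.margin i hi]
  · obtain rfl : i = ⟨j, hj⟩ := Fin.ext hi
    rw [if_neg (by simp; omega), if_neg (by simp; omega), if_pos rfl]
  · rw [if_neg (by omega), if_neg (by omega), if_neg (by omega), h.loss i hi]
  · obtain rfl : i = ⟨j, hj⟩ := Fin.ext hi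
    rw [if_neg (by simp; omega), if_pos rfl]
  · rw [if_neg (by omega), if_neg (by omega), if_neg (by omega), h.slope i hi]
  · obtain rfl : i = ⟨j, hj⟩ := Fin.ext hi
    rw [if_pos rfl]

set_option maxHeartbeats 400000 in
lemma runs_marginProg {d m A B : ℕ} {lam : ℝ} {σ : State} {w : Vec d} {S : Fin m → Example d}
    (h2 : σ.natReg 2 = m) (h4 : σ.natReg 4 = d) (h5 : σ.natReg 5 = 1) (h7 : σ.natReg 7 = 0)
    (h9 : σ.natReg 9 = A) (h10 : σ.natReg 10 = B) (h11 : σ.natReg 11 = B + m)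
    (h12 : σ.natReg 12 = B + 2 * m) (hlam : σ.realReg 2 = lam) (hAB : A + m * (d + 1) ≤ B)
    (hdB : d ≤ B) (hw : VecAt σ.realHeap 0 w) (hS : SampleAt σ.realHeap A S) :
    Runs marginProg σ (m * (8 * d + 26) + 9) fun σ' =>
      MarginsAt lam w S B m σ' ∧ (∀ i < m, σ'.natHeap i = i) ∧
      σ'.realReg 14 = ∑ i, lossAt lam S w i ∧ σ'.realReg 15 = ∑ i, absMargin S w i ∧
      ∀ k < B, σ'.realHeap k = σ.realHeap k := by
  refine (Runs.seq' (fun σ' => σ'.realReg 9 = 1 ∧ σ'.realReg 10 = 0 ∧ σ'.realReg 13 = 1 - lam ∧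
    σ'.realReg 14 = 0 ∧ σ'.realReg 15 = 0 ∧ σ'.natReg 16 = 0 ∧ σ'.natReg 14 = A) (Runs.code ?_)
    (l := m * (8 * d + 26) + 1) fun σ₁ h₁ F₁ => ?_).of_le (by simp; omega)
  · simp [apply, h9, h7, hlam]
  obtain ⟨a9, a10, a13, a14, a15, a16, b14⟩ := h₁
  have e2 := (F₁.nat 2 rfl).trans h2
  have e4 := (F₁.nat 4 rfl).trans h4
  have e5 := (F₁.nat 5 rfl).trans h5
  have e10 := (F₁.nat 10 rfl).trans h10
  have e11 := (F₁.nat 11 rfl).trans h11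
  have e12 := (F₁.nat 12 rfl).trans h12
  have elam := (F₁.real 2 rfl).trans hlam
  have eH := F₁.realHeap rfl
  refine (Runs.for (c := 8 * d + 25) (N := m) (I := fun j σ' =>
    MarginsAt lam w S B j σ' ∧ (∀ i < j, σ'.natHeap i = i) ∧
    σ'.realReg 14 = ∑ i : Fin m with i.val < j, lossAt lam S w i ∧
    σ'.realReg 15 = ∑ i : Fin m with i.val < j, absMargin S w i ∧
    (∀ k < B, σ'.realHeap k = σ.realHeap k) ∧
    σ'.natReg 14 = A + j * (d + 1) ∧ σ'.natReg 16 = j) ?_ ?_ ?_).mono le_rfl ?_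
  · exact ⟨⟨by simp, by simp, by simp⟩, by simp, by simp [a14], by simp [a15], by simp [eH],
      by simp [b14], a16⟩
  · rintro j σ' ⟨-, -, -, -, -, -, hj⟩ F -
    simp [holds, hj, F.nat 2 rfl, e2]
  · rintro j σ' hj ⟨iM, iP, i14, i15, iH, i1, i2⟩ F
    have f4 := (F.nat 4 rfl).trans e4
    have f5 := (F.nat 5 rfl).trans e5
    have f10 := (F.nat 10 rfl).trans e10
    have f11 := (F.nat 11 rfl).trans e11
    have f12 := (F.nat 12 rfl).trans e12
    have r10 := (F.real 10 rfl).trans a10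
    have r13 := (F.real 13 rfl).trans a13
    have r2 := (F.real 2 rfl).trans elam
    obtain ⟨hx, hy⟩ := hS.congr hAB iH ⟨j, hj⟩
    have hw' : VecAt σ'.realHeap 0 w := hw.congr fun k hk => iH k (by omega)
    have hd := runs_dotProg f5
    rw [f4, i1, sum_mul_eq_inner hw' hx] at hd
    simp only at hy
    set y := (S ⟨j, hj⟩).2
    set p := inner ℝ w (S ⟨j, hj⟩).1 with hp
    refine (Runs.seq' _ hd (l := 21) fun σ₂ h₂ F₂ => ?_).of_le (by omega)
    refine (Runs.seq' (fun σ' => σ'.realReg 12 = -labelVal y ∧ σ'.realReg 11 = -labelVal y * p ∧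
      σ'.natReg 20 = B + j ∧ σ'.natReg 21 = B + m + j ∧ σ'.natReg 22 = B + 2 * m + j)
      (Runs.code ?_) (l := 14) fun σ₃ h₃ F₃ => ?_).of_le (by simp)
    · simp [apply, F₂.realHeap rfl, h₂.1, h₂.2, hy, F₂.real 10 rfl, r10, F₂.nat 10 rfl, f10,
        F₂.nat 11 rfl, f11, F₂.nat 12 rfl, f12, F₂.nat 16 rfl, i2]
    obtain ⟨b12, b11, b20, b21, b22⟩ := h₃
    have g10 := (F₃.real 10 rfl).trans ((F₂.real 10 rfl).trans r10)
    have g13 := (F₃.real 13 rfl).trans ((F₂.real 13 rfl).trans r13)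
    have g2 := (F₃.real 2 rfl).trans ((F₂.real 2 rfl).trans r2)
    have hz : absMargin S w ⟨j, hj⟩ = |-labelVal y * p| := by
      rcases labelVal_eq y with h | h <;> simp [absMargin, h, hp]
    have hl : lossAt lam S w ⟨j, hj⟩ = _ := leakyRelu_eq lam (-labelVal y * p)
    refine (Runs.seq' (fun σ' => σ'.realReg 16 = absMargin S w ⟨j, hj⟩ ∧
      σ'.realReg 17 = lossAt lam S w ⟨j, hj⟩ ∧ σ'.realReg 18 = MassartHalfspace.slope lam y p)
      (Runs.branch (k := 4) (fun hb => ?_) fun hb => ?_)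
      (l := 9) fun σ₄ h₄ F₄ => ?_).of_le (by simp)
    · simp only [holds, b11, g10] at hb
      refine (Runs.code ?_).of_le (by simp)
      rw [hz, hl, abs_of_neg hb, MassartHalfspace.slope, if_pos hb]
      simp [apply, b11, b12, g10, g2]
    · simp only [holds, b11, g10] at hb
      refine (Runs.code ?_).of_le (by simp)
      rw [hz, hl, abs_of_nonneg (not_lt.1 hb), MassartHalfspace.slope, if_neg hb]
      simp [apply, b11, b12, g10, g13]
    obtain ⟨c16, c17, c18⟩ := h₄
    have k20 := (F₄.nat 20 rfl).trans b20
    have k21 := (F₄.nat 21 rfl).trans b21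
    have k22 := (F₄.nat 22 rfl).trans b22
    have k16 := (F₄.nat 16 rfl).trans ((F₃.nat 16 rfl).trans ((F₂.nat 16 rfl).trans i2))
    have k5 := (F₄.nat 5 rfl).trans ((F₃.nat 5 rfl).trans ((F₂.nat 5 rfl).trans f5))
    have k14 := (F₄.nat 14 rfl).trans ((F₃.nat 14 rfl).trans h₂.2)
    have kr14 := (F₄.real 14 rfl).trans ((F₃.real 14 rfl).trans ((F₂.real 14 rfl).trans i14))
    have kr15 := (F₄.real 15 rfl).trans ((F₃.real 15 rfl).trans ((F₂.real 15 rfl).trans i15))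
    have kN := (F₄.natHeap rfl).trans ((F₃.natHeap rfl).trans (F₂.natHeap rfl))
    have kH := (F₄.realHeap rfl).trans ((F₃.realHeap rfl).trans (F₂.realHeap rfl))
    refine (Runs.code (Q := fun τ => τ.realHeap = Function.update (Function.update
        (Function.update σ'.realHeap (B + j) (absMargin S w ⟨j, hj⟩)) (B + m + j)
        (lossAt lam S w ⟨j, hj⟩)) (B + 2 * m + j) (MassartHalfspace.slope lam y p) ∧
      τ.natHeap = Function.update σ'.natHeap j j ∧
      τ.realReg 14 = ∑ i : Fin m with i.val < j + 1, lossAt lam S w i ∧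
      τ.realReg 15 = ∑ i : Fin m with i.val < j + 1, absMargin S w i ∧
      τ.natReg 14 = A + (j + 1) * (d + 1) ∧ τ.natReg 16 = j + 1) ?_).mono (by simp) ?_
    · rw [sum_val_lt_succ hj, sum_val_lt_succ hj]
      simp [apply, k20, k21, k22, c16, c17, c18, kH, kN, k16, k14, k5, kr14, kr15]
      ring
    · rintro τ - ⟨t1, t2, t3⟩
      refine ⟨iM.succ hj t1, fun i hi => ?_, t3.1, t3.2.1, fun k hk => ?_, t3.2.2⟩
      · rw [t2]
        rcases Nat.lt_succ_iff_lt_or_eq.1 hi with hi | hi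
        · rw [Function.update_of_ne hi.ne, iP i hi]
        · rw [hi, Function.update_self]
      · rw [t1, update_update_update_of_lt hk, iH k hk]
  · rintro σ' - ⟨⟨iM, iP, i14, i15, iH, -, -⟩, F⟩
    rw [sum_val_lt_self] at i14 i15
    exact ⟨iM, iP, i14, i15, iH⟩

end RealRAM

/-! ### Binary heaps -/

namespace RealRAM
open Instr Prog Test

/-- `k` is one of the two children of the node `j` of a binary heap. -/
def IsChild (j k : ℕ) : Prop := k = 2 * j + 1 ∨ k = 2 * j + 2

/-- The keys `κ j` with `j < s` satisfy the max-heap condition at all nodes from `lo` on. -/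
def HeapFrom (κ : ℕ → ℝ) (lo s : ℕ) : Prop :=
  ∀ j k, lo ≤ j → k < s → IsChild j k → κ k ≤ κ j

/-- The max-heap condition may fail at the node `i` only, and it would hold between the parent
and the children of `i`. -/
structure HeapExcept (κ : ℕ → ℝ) (lo s i : ℕ) : Prop where
  le : ∀ j k, lo ≤ j → j ≠ i → k < s → IsChild j k → κ k ≤ κ j
  skip : ∀ p k, lo ≤ p → IsChild p i → k < s → IsChild i k → κ k ≤ κ p

lemma HeapFrom.le_root {κ : ℕ → ℝ} {s : ℕ} (h : HeapFrom κ 0 s) {k : ℕ} (hk : k < s) :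
    κ k ≤ κ 0 := by
  induction k using Nat.strong_induction_on with
  | _ k ih =>
    rcases Nat.eq_zero_or_pos k with rfl | hpos
    · exact le_rfl
    · exact (h ((k - 1) / 2) k (Nat.zero_le _) hk (by unfold IsChild; omega)).trans
        (ih _ (by omega) (by omega))

lemma HeapFrom.heapExcept {κ : ℕ → ℝ} {i s : ℕ} (h : HeapFrom κ (i + 1) s) :
    HeapExcept κ i s i := by
  refine ⟨fun j k hj hne hk hjk => h j k (by omega) hk hjk, fun p k hp hpi => ?_⟩
  unfold IsChild at hpi
  omega

/-- Replacing the root by an arbitrary node and dropping the last node. -/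
lemma HeapFrom.replace_root {κ κ' : ℕ → ℝ} {s : ℕ} (h : HeapFrom κ 0 (s + 1))
    (hκ : ∀ j, j ≠ 0 → κ' j = κ j) : HeapExcept κ' 0 s 0 := by
  refine ⟨fun j k hj hne hk hjk => ?_, fun p k hp hpi => ?_⟩
  · rw [hκ j hne, hκ k (by unfold IsChild at hjk; omega)]
    exact h j k hj (by omega) hjk
  · unfold IsChild at hpi
    omega

lemma HeapExcept.heapFrom_of_le {κ : ℕ → ℝ} {lo s i : ℕ} (h : HeapExcept κ lo s i)
    (hi : ∀ k < s, IsChild i k → κ k ≤ κ i) : HeapFrom κ lo s := by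
  intro j k hj hk hjk
  by_cases hji : j = i
  · subst hji
    exact hi k hk hjk
  · exact h.le j k hj hji hk hjk

/-- One step of sifting down: the node `i` is exchanged with its larger child `c`. -/
lemma HeapExcept.swap {κ κ' : ℕ → ℝ} {lo s i c : ℕ} (h : HeapExcept κ lo s i) (hlo : lo ≤ i)
    (hc : IsChild i c) (hcs : c < s) (hmax : ∀ k < s, IsChild i k → κ k ≤ κ c) (hlt : κ i < κ c)
    (hi' : κ' i = κ c) (hc' : κ' c = κ i) (hκ : ∀ j, j ≠ i → j ≠ c → κ' j = κ j) :
    HeapExcept κ' lo s c := by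
  refine ⟨fun j k hj hne hk hjk => ?_, fun p k hp hpc hk hck => ?_⟩
  · by_cases hji : j = i
    · subst hji
      rw [hi']
      by_cases hkc : k = c
      · rw [hkc, hc']
        exact hlt.le
      · rw [hκ k (by unfold IsChild at hjk; omega) hkc]
        exact hmax k hk hjk
    · rw [hκ j hji hne]
      by_cases hki : k = i
      · subst hki
        rw [hi']
        exact h.skip j c hj hjk hcs hc
      · rw [hκ k hki (by unfold IsChild at *; omega)]
        exact h.le j k hj hji hk hjk
  · obtain rfl : p = i := by unfold IsChild at *; omega
    have hne : k ≠ p ∧ k ≠ c := by unfold IsChild at *; omega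
    rw [hi', hκ k hne.1 hne.2]
    exact h.le c k (by unfold IsChild at *; omega) (by unfold IsChild at *; omega) hk hck

lemma bijOn_update_update {h : ℕ → ℕ} {s i c : ℕ} {R : Set ℕ} (hi : i < s) (hc : c < s)
    (hR : Set.BijOn h (Set.Iio s) R) :
    Set.BijOn (Function.update (Function.update h i (h c)) c (h i)) (Set.Iio s) R := by
  have : Function.update (Function.update h i (h c)) c (h i) = h ∘ Equiv.swap i c := by
    funext j
    simp only [Function.update_apply, Function.comp, Equiv.swap_apply_def]
    split_ifs <;> simp_all
  rw [this]
  refine hR.comp ⟨fun j hj => ?_, (Equiv.swap i c).injective.injOn, fun j hj =>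
    ⟨Equiv.swap i c j, ?_, Equiv.swap_apply_self i c j⟩⟩ <;>
  · simp only [Set.mem_Iio, Equiv.swap_apply_def] at *
    split_ifs <;> omega

/-- Sifts down the node in register `18` of the heap of size given by register `17`. The heap
of natural numbers holds indices, whose keys are stored from the address in register `10` on.
Register `19` points to the first child. -/
def siftProg : Prog :=
  loop (natLt 19 17)
    (seq (code [natLoad 21 19, natAdd 22 21 10, realLoad 7 22, natAdd 20 19 5])
      (seq (branch (natLt 20 17)
          (seq (code [natLoad 23 20, natAdd 22 23 10, realLoad 8 22])
            (branch (realLt 7 8)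
              (code [natAdd 19 20 7, natAdd 21 23 7, realLoad 7 22])
              (code [])))
          (code []))
        (seq (code [natLoad 24 18, natAdd 22 24 10, realLoad 9 22])
          (branch (realLt 9 7)
            (code [natStore 18 21, natStore 19 24, natAdd 18 19 7, natAdd 19 18 18, natAdd 19 19 5])
            (code [natAdd 19 17 7])))))

/-- The key of node `j` of the heap. -/
def heapKey (σ : State) (B j : ℕ) : ℝ := σ.realHeap (B + σ.natHeap j)

lemma runs_siftProg {B lo s i N : ℕ} {σ : State} {R : Set ℕ}
    (h5 : σ.natReg 5 = 1) (h10 : σ.natReg 10 = B) (h17 : σ.natReg 17 = s)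
    (h18 : σ.natReg 18 = i) (h19 : σ.natReg 19 = 2 * i + 1) (hlo : lo ≤ i)
    (hh : HeapExcept (heapKey σ B) lo s i) (hN : s < (i + 1) * 2 ^ N)
    (hR : Set.BijOn σ.natHeap (Set.Iio s) R) :
    Runs siftProg σ (N * 29 + 1) fun σ' =>
      HeapFrom (heapKey σ' B) lo s ∧ Set.BijOn σ'.natHeap (Set.Iio s) R := by
  refine (Runs.while (c := 28) (I := fun n σ' => Set.BijOn σ'.natHeap (Set.Iio s) R ∧
    (HeapFrom (heapKey σ' B) lo s ∧ s ≤ σ'.natReg 19 ∨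
      ∃ i, σ'.natReg 18 = i ∧ σ'.natReg 19 = 2 * i + 1 ∧ lo ≤ i ∧
        HeapExcept (heapKey σ' B) lo s i ∧ s < (i + 1) * 2 ^ n)) ?_ ?_).mono le_rfl ?_
  · exact ⟨hR, .inr ⟨i, h18, h19, hlo, hh, hN⟩⟩
  · rintro n σ' ⟨iR, hcase⟩ F hb
    have f5 := (F.nat 5 rfl).trans h5
    have f10 := (F.nat 10 rfl).trans h10
    have f17 := (F.nat 17 rfl).trans h17
    simp only [holds, f17] at hb
    obtain ⟨-, hle⟩ | ⟨i, i18, i19, hlo, hh, hN⟩ := hcase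
    · omega
    rw [i19] at hb
    obtain ⟨n, rfl⟩ : ∃ n', n = n' + 1 := by
      refine Nat.exists_eq_succ_of_ne_zero ?_
      rintro rfl
      omega
    refine ⟨n, rfl, ?_⟩
    set κ := heapKey σ' B with hκ
    refine (Runs.seq' (fun τ => τ.natReg 21 = σ'.natHeap (2 * i + 1) ∧
      τ.realReg 7 = κ (2 * i + 1) ∧ τ.natReg 20 = 2 * i + 2) (Runs.code ?_) (l := 23)
      fun σ₁ h₁ F₁ => ?_).of_le (by simp)
    · simp [apply, i19, f5, f10, hκ, heapKey, add_comm B]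
    obtain ⟨a21, a7, a20⟩ := h₁
    have a5 := (F₁.nat 5 rfl).trans f5
    have a10 := (F₁.nat 10 rfl).trans f10
    have a17 := (F₁.nat 17 rfl).trans f17
    have a18 := (F₁.nat 18 rfl).trans i18
    have a19 := (F₁.nat 19 rfl).trans i19
    have aN := F₁.natHeap rfl
    have aH := F₁.realHeap rfl
    refine (Runs.seq' (fun τ => ∃ c, IsChild i c ∧ c < s ∧ (∀ k < s, IsChild i k → κ k ≤ κ c) ∧
      τ.natReg 19 = c ∧ τ.natReg 21 = σ'.natHeap c ∧ τ.realReg 7 = κ c)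
      (Runs.branch (k := 9) (fun hb' => ?_) fun hb' => ?_) (l := 11)
      fun σ₂ h₂ F₂ => ?_).of_le (by simp)
    · simp only [holds, a20, a17] at hb'
      refine (Runs.seq' (fun τ => τ.natReg 23 = σ'.natHeap (2 * i + 2) ∧
        τ.realReg 8 = κ (2 * i + 2) ∧ τ.natReg 22 = B + σ'.natHeap (2 * i + 2) ∧ τ.natReg 7 = 0)
        (Runs.code ?_) (l := 5) fun σ₂ h₂ F₂ => ?_).of_le (by simp)
      · simp [apply, a20, a10, hκ, heapKey, add_comm B, aN, aH]
      obtain ⟨b23, b8, b22, b0⟩ := h₂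
      refine Runs.branch (k := 4) (fun hc => ?_) fun hc => ?_
      · simp only [holds, b8, F₂.real 7 rfl, a7] at hc
        refine (Runs.code ⟨2 * i + 2, .inr rfl, hb', ?_, ?_⟩).of_le (by simp)
        · rintro k - (rfl | rfl)
          exacts [hc.le, le_rfl]
        · simp [apply, F₂.nat 20 rfl, a20, b0, b23, b22, F₂.realHeap rfl, aH, hκ, heapKey]
      · simp only [holds, b8, F₂.real 7 rfl, a7] at hc
        refine (Runs.code ⟨2 * i + 1, .inl rfl, hb, ?_, ?_⟩).of_le (by simp)
        · rintro k - (rfl | rfl)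
          exacts [le_rfl, not_lt.1 hc]
        · simp [apply, F₂.nat 19 rfl, a19, F₂.nat 21 rfl, a21, F₂.real 7 rfl, a7]
    · simp only [holds, a20, a17] at hb'
      refine (Runs.code ⟨2 * i + 1, .inl rfl, hb, ?_, ?_⟩).of_le (by simp)
      · rintro k hk (rfl | rfl)
        exacts [le_rfl, absurd hk hb']
      · simp [apply, a19, a21, a7]
    obtain ⟨c, hc, hcs, hmax, b19, b21, b7⟩ := h₂
    have b5 := (F₂.nat 5 rfl).trans a5
    have b10 := (F₂.nat 10 rfl).trans a10
    have b17 := (F₂.nat 17 rfl).trans a17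
    have b18 := (F₂.nat 18 rfl).trans a18
    have bN := (F₂.natHeap rfl).trans aN
    have bH := (F₂.realHeap rfl).trans aH
    refine (Runs.seq' (fun τ => τ.natReg 24 = σ'.natHeap i ∧ τ.realReg 9 = κ i ∧ τ.natReg 7 = 0)
      (Runs.code ?_) (l := 7) fun σ₃ h₃ F₃ => ?_).of_le (by simp)
    · simp [apply, b18, b10, bN, bH, hκ, heapKey, add_comm B]
    obtain ⟨d24, d9, d0⟩ := h₃
    have d5 := (F₃.nat 5 rfl).trans b5
    have d17 := (F₃.nat 17 rfl).trans b17
    have d18 := (F₃.nat 18 rfl).trans b18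
    have d19 := (F₃.nat 19 rfl).trans b19
    have d21 := (F₃.nat 21 rfl).trans b21
    have d7 := (F₃.real 7 rfl).trans b7
    have dN := (F₃.natHeap rfl).trans bN
    have dH := (F₃.realHeap rfl).trans bH
    refine Runs.branch (k := 6) (fun hlt => ?_) fun hlt => ?_
    · simp only [holds, d9, d7] at hlt
      refine (Runs.code (Q := fun τ => τ.natHeap = Function.update (Function.update σ'.natHeap i
        (σ'.natHeap c)) c (σ'.natHeap i) ∧ τ.realHeap = σ'.realHeap ∧ τ.natReg 18 = c ∧
        τ.natReg 19 = 2 * c + 1) ?_).mono (by simp) ?_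
      · simp [apply, d18, d21, d19, d24, d0, d5, dN, dH, two_mul]
      · rintro τ - ⟨tN, tH, t18, t19⟩
        have hic : i ≠ c := by unfold IsChild at hc; omega
        have his : i < s := by omega
        refine ⟨tN ▸ bijOn_update_update his hcs iR, .inr ⟨c, t18, t19, ?_, ?_, ?_⟩⟩
        · unfold IsChild at hc; omega
        · refine hh.swap hlo hc hcs hmax hlt ?_ ?_ fun j hji hjc => ?_ <;>
            simp_all [heapKey]
        · refine hN.trans_le ?_
          rw [pow_succ', ← mul_assoc]
          exact Nat.mul_le_mul_right _ (by unfold IsChild at hc; omega)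
    · simp only [holds, d9, d7] at hlt
      refine (Runs.code (Q := fun τ => τ.natHeap = σ'.natHeap ∧ τ.realHeap = σ'.realHeap ∧
        τ.natReg 19 = s) ?_).mono (by simp) ?_
      · simp [apply, d17, d0, dN, dH]
      · rintro τ - ⟨tN, tH, t19⟩
        refine ⟨tN ▸ iR, .inl ⟨?_, t19.ge⟩⟩
        have : heapKey τ B = κ := by funext j; simp [heapKey, hκ, tN, tH]
        rw [this]
        exact hh.heapFrom_of_le fun k hk hik => (hmax k hk hik).trans (not_lt.1 hlt)
  · rintro σ' - ⟨⟨n, iR, hcase⟩, hb, F⟩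
    refine ⟨?_, iR⟩
    obtain ⟨hh, -⟩ | ⟨i, i18, i19, hlo, hh, hN⟩ := hcase
    · exact hh
    · simp only [holds, i19, (F.nat 17 rfl).trans h17] at hb
      refine hh.heapFrom_of_le fun k hk hik => ?_
      unfold IsChild at hik
      omega

end RealRAM

/-! ### Computing the radius -/

namespace RealRAM
open Instr Prog Test

/-- Turns the array of indices into a heap, by sifting down all nodes from the last to the first. -/
def heapifyProg : Prog :=
  seq (code [natAdd 17 2 7, natAdd 25 2 7])
    (loop (natLt 7 25) (seq (code [natSub 25 25 5, natAdd 18 25 7, natAdd 19 18 18, natAdd 19 19 5])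
      siftProg))

lemma runs_heapifyProg {B m N : ℕ} {σ : State} {R : Set ℕ}
    (h2 : σ.natReg 2 = m) (h5 : σ.natReg 5 = 1) (h7 : σ.natReg 7 = 0) (h10 : σ.natReg 10 = B)
    (hN : m < 2 ^ N) (hR : Set.BijOn σ.natHeap (Set.Iio m) R) :
    Runs heapifyProg σ (m * (N * 29 + 7) + 4) fun σ' =>
      HeapFrom (heapKey σ' B) 0 m ∧ Set.BijOn σ'.natHeap (Set.Iio m) R := by
  refine (Runs.seq' (fun τ => τ.natReg 17 = m ∧ τ.natReg 25 = m) (Runs.code ?_)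
    (l := m * (N * 29 + 7) + 1) fun σ₁ h₁ F₁ => ?_).of_le (by simp; omega)
  · simp [apply, h2, h7]
  obtain ⟨a17, a25⟩ := h₁
  have a5 := (F₁.nat 5 rfl).trans h5
  have a7 := F₁.zero rfl h7
  have a10 := (F₁.nat 10 rfl).trans h10
  refine (Runs.for (c := N * 29 + 6) (N := m) (I := fun j σ' => σ'.natReg 25 = m - j ∧
    HeapFrom (heapKey σ' B) (m - j) m ∧ Set.BijOn σ'.natHeap (Set.Iio m) R)
    ?_ ?_ ?_).mono le_rfl ?_
  · refine ⟨a25, fun j k hj hk hjk => ?_, (F₁.natHeap rfl) ▸ hR⟩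
    unfold IsChild at hjk
    omega
  · rintro j σ' ⟨hj, -, -⟩ F hjm
    simp only [holds, hj, F.zero rfl a7]
    omega
  · rintro j σ' hj ⟨i25, iH, iR⟩ F
    have f5 := (F.nat 5 rfl).trans a5
    have f7 := F.zero rfl a7
    have f10 := (F.nat 10 rfl).trans a10
    have f17 := (F.nat 17 rfl).trans a17
    refine (Runs.seq' (fun τ => τ.natReg 25 = m - (j + 1) ∧ τ.natReg 18 = m - (j + 1) ∧
      τ.natReg 19 = 2 * (m - (j + 1)) + 1) (Runs.code ?_)
      (l := N * 29 + 1) fun σ₂ h₂ F₂ => ?_).of_le (by simp; omega)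
    · simp [apply, i25, f5, f7, two_mul, Nat.sub_sub]
    obtain ⟨b25, b18, b19⟩ := h₂
    have hkey : heapKey σ₂ B = heapKey σ' B := by
      funext j
      simp [heapKey, F₂.natHeap rfl, F₂.realHeap rfl]
    refine (runs_siftProg (lo := m - (j + 1)) ((F₂.nat 5 rfl).trans f5) ((F₂.nat 10 rfl).trans f10)
      ((F₂.nat 17 rfl).trans f17) b18 b19 le_rfl ?_ ?_ ((F₂.natHeap rfl) ▸ iR)).mono le_rfl ?_
    · rw [hkey]
      refine HeapFrom.heapExcept ?_
      rwa [show m - (j + 1) + 1 = m - j by omega]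
    · exact hN.trans_le (Nat.le_mul_of_pos_left _ (by omega))
    · rintro τ F₃ ⟨t1, t2⟩
      exact ⟨(F₃.nat 25 rfl).trans b25, t1, t2⟩
  · rintro σ' - ⟨⟨-, iH, iR⟩, F⟩
    exact ⟨by simpa using iH, iR⟩

/-- Extracts the indices from the heap in the order of decreasing margins. The real register `14`
holds the sum of the losses over the heap, `19` the last margin extracted, `20` and `21` the best
mean loss so far and its radius. -/
def selectProg : Prog :=
  seq (code [realConst 10 0, realConst 9 1, realAdd 19 15 9, realAdd 21 19 10, realOfNat 24 2,
      realDiv 20 14 24, realConst 23 6, realDiv 22 0 23, natAdd 17 2 7])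
    (loop (natLt 7 17)
      (seq (code [natLoad 26 7, natAdd 27 26 10, realLoad 25 27, natAdd 27 26 11, realLoad 26 27,
          realOfNat 27 17, realDiv 28 27 24, realDiv 29 14 27])
        (seq (branch (realLt 25 19)
            (branch (realLt 28 22) (code [])
              (branch (realLt 20 29) (code [realAdd 20 29 10, realAdd 21 19 10]) (code [])))
            (code []))
          (seq (code [realSub 14 14 26, realAdd 19 25 10, natSub 17 17 5, natLoad 27 17,
            natStore 7 27, natConst 18 0, natConst 19 1]) siftProg))))

lemma card_eq_of_bijOn {m s : ℕ} {h : ℕ → ℕ} {R : Finset (Fin m)}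
    (hR : Set.BijOn h (Set.Iio s) (Fin.val '' (R : Set (Fin m)))) : R.card = s := by
  have h1 := hR.image_eq ▸ hR.injOn.ncard_image
  rw [Set.ncard_image_of_injective _ Fin.val_injective, Set.ncard_coe_finset] at h1
  rw [h1, ← Finset.coe_Iio, Set.ncard_coe_finset, Nat.card_Iio]

/-- Removing the root from the heap: the last node takes its place. -/
lemma bijOn_update_root {m s : ℕ} {h : ℕ → ℕ} {R : Finset (Fin m)} {i : Fin m}
    (hR : Set.BijOn h (Set.Iio (s + 1)) (Fin.val '' (R : Set (Fin m)))) (hi : h 0 = i) :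
    Set.BijOn (Function.update h 0 (h s)) (Set.Iio s)
      (Fin.val '' ((R.erase i : Finset (Fin m)) : Set (Fin m))) := by
  have h0 : ∀ j < s, (if j = 0 then h s else h j) ≠ i := by
    intro j hj
    rw [← hi]
    split_ifs with hj0
    · intro he
      have := hR.injOn (show s ∈ Set.Iio (s + 1) by simp) (show 0 ∈ Set.Iio (s + 1) by simp) he
      omega
    · intro he
      exact hj0 (hR.injOn (show j ∈ Set.Iio (s + 1) by simp; omega)
        (show 0 ∈ Set.Iio (s + 1) by simp)
        he)
  refine ⟨fun j hj => ?_, fun j hj k hk hjk => ?_, ?_⟩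
  · simp only [Set.mem_Iio] at hj
    obtain ⟨k, hk, hkj⟩ : Function.update h 0 (h s) j ∈ Fin.val '' (R : Set (Fin m)) := by
      rw [Function.update_apply]
      split_ifs
      · exact hR.mapsTo (by simp)
      · exact hR.mapsTo (by simp; omega)
    refine ⟨k, ?_, hkj⟩
    have := h0 j hj
    rw [← Function.update_apply, ← hkj] at this
    simp only [Finset.coe_erase, Set.mem_sdiff, Set.mem_singleton_iff]
    exact ⟨hk, fun h => this (by rw [h])⟩
  · simp only [Set.mem_Iio] at hj hk
    simp only [Function.update_apply] at hjk
    split_ifs at hjk with h1 h2 h2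
    · omega
    · have := hR.injOn (show s ∈ Set.Iio (s + 1) by simp)
        (show k ∈ Set.Iio (s + 1) by simp; omega) hjk
      omega
    · have := hR.injOn (show j ∈ Set.Iio (s + 1) by simp; omega)
        (show s ∈ Set.Iio (s + 1) by simp) hjk
      omega
    · exact hR.injOn (show j ∈ Set.Iio (s + 1) by simp; omega)
        (show k ∈ Set.Iio (s + 1) by simp; omega) hjk
  · rintro _ ⟨k, hk, rfl⟩
    simp only [Finset.coe_erase, Set.mem_sdiff, Set.mem_singleton_iff] at hk
    obtain ⟨j, hj, hjk⟩ := hR.surjOn ⟨k, hk.1, rfl⟩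
    simp only [Set.mem_Iio] at hj
    have hj0 : j ≠ 0 := by
      rintro rfl
      exact hk.2 (Fin.ext (hjk.symm.trans hi))
    rcases Nat.lt_succ_iff_lt_or_eq.1 hj with hj' | rfl
    · exact ⟨j, hj', by rw [Function.update_of_ne hj0, hjk]⟩
    · exact ⟨0, by simp; omega, by simpa using hjk⟩

lemma runs_selectProg {d m B N : ℕ} {ε lam : ℝ} {σ : State} {w : Vec d} {S : Fin m → Example d}
    (hm : 0 < m) (hε : 0 < ε) (hε1 : ε ≤ 1)
    (h2 : σ.natReg 2 = m) (h5 : σ.natReg 5 = 1) (h7 : σ.natReg 7 = 0) (h10 : σ.natReg 10 = B)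
    (h11 : σ.natReg 11 = B + m) (hr0 : σ.realReg 0 = ε) (hM : MarginsAt lam w S B m σ)
    (h14 : σ.realReg 14 = ∑ i, lossAt lam S w i) (h15 : σ.realReg 15 = ∑ i, absMargin S w i)
    (hN : m < 2 ^ N) (hH : HeapFrom (heapKey σ B) 0 m)
    (hR : Set.BijOn σ.natHeap (Set.Iio m)
      (Fin.val '' ((Finset.univ : Finset (Fin m)) : Set (Fin m)))) :
    Runs selectProg σ (m * (N * 29 + 25) + 11) fun σ' =>
      σ'.realReg 21 = oracleRadius (ε / 6) lam S w := by
  have : Nonempty (Fin m) := ⟨⟨0, hm⟩⟩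
  set z := absMargin S w with hz
  set l := lossAt lam S w with hl
  have hznn : ∀ i, 0 ≤ z i := absMargin_nonneg S w
  refine (Runs.seq' (fun τ => τ.realReg 10 = 0 ∧ τ.realReg 19 = radius z none ∧
    τ.realReg 21 = radius z none ∧ τ.realReg 20 = meanBelow z l (radius z none) ∧
    τ.realReg 24 = m ∧ τ.realReg 22 = ε / 6 ∧ τ.natReg 17 = m) (Runs.code ?_)
    (l := m * (N * 29 + 25) + 1) fun σ₁ h₁ F₁ => ?_).of_le (by simp; omega)
  · have : (Finset.univ.filter fun i => z i < radius z none) = Finset.univ :=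
      Finset.filter_true_of_mem fun i _ => lt_radius_none hznn i
    simp [apply, h2, h7, h14, h15, hr0, meanBelow, this]
    simp [radius]
  obtain ⟨a10, a19, a21, a20, a24, a22, a17⟩ := h₁
  have b5 := (F₁.nat 5 rfl).trans h5
  have b7 := F₁.zero rfl h7
  have b10 := (F₁.nat 10 rfl).trans h10
  have b11 := (F₁.nat 11 rfl).trans h11
  have bH := F₁.realHeap rfl
  have bN := F₁.natHeap rfl
  have b14 := (F₁.real 14 rfl).trans h14
  refine (Runs.for (c := N * 29 + 24) (N := m) (I := fun j σ' => ∃ R : Finset (Fin m),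
    Set.BijOn σ'.natHeap (Set.Iio (m - j)) (Fin.val '' (R : Set (Fin m))) ∧
    HeapFrom (heapKey σ' B) 0 (m - j) ∧ σ'.natReg 17 = m - j ∧ σ'.realReg 14 = ∑ i ∈ R, l i ∧
    σ'.realReg 20 = meanBelow z l (σ'.realReg 21) ∧
    IsSelection (ε / 6) z l R (σ'.realReg 19) (σ'.realReg 21)) ?_ ?_ ?_).mono le_rfl ?_
  · have hkey : heapKey σ₁ B = heapKey σ B := by
      funext j
      simp [heapKey, bH, bN]
    refine ⟨Finset.univ, bN ▸ hR, hkey ▸ hH, a17, b14, by rw [a20, a21], ?_⟩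
    rw [a19, a21]
    exact IsSelection.init (by linarith) hznn l
  · rintro j σ' ⟨R, -, -, i17, -⟩ F hj
    simp only [holds, i17, F.zero rfl b7]
    omega
  · rintro j σ' hj ⟨R, iR, iH, i17, i14, i20, iS⟩ F
    obtain ⟨s, hs⟩ : ∃ s, m - j = s + 1 := ⟨m - j - 1, by omega⟩
    rw [hs] at iR iH i17
    rw [show m - (j + 1) = s by omega]
    have hcard : R.card = s + 1 := card_eq_of_bijOn iR
    obtain ⟨i, hi, hi0⟩ := iR.mapsTo (show 0 ∈ Set.Iio (s + 1) by simp)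
    have hi : i ∈ R := hi
    have c5 := (F.nat 5 rfl).trans b5
    have c7 := F.zero rfl b7
    have c10 := (F.nat 10 rfl).trans b10
    have c11 := (F.nat 11 rfl).trans b11
    have cH := (F.realHeap rfl).trans bH
    have cr10 := (F.real 10 rfl).trans a10
    have cr22 := (F.real 22 rfl).trans a22
    have cr24 := (F.real 24 rfl).trans a24
    have hzB : ∀ k : Fin m, σ'.realHeap (B + k) = z k := fun k => by
      rw [cH]; exact hM.margin k k.2
    have hlB : ∀ k : Fin m, σ'.realHeap (B + m + k) = l k := fun k => by
      rw [cH]; exact hM.loss k k.2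
    have hmax : ∀ k ∈ R, z k ≤ z i := by
      intro k hk
      obtain ⟨n, hn, hnk⟩ := iR.surjOn ⟨k, hk, rfl⟩
      have := iH.le_root hn
      rwa [heapKey, heapKey, hnk, ← hi0, hzB, hzB] at this
    refine (Runs.seq' (fun τ => τ.realReg 25 = z i ∧ τ.realReg 26 = l i ∧
      τ.realReg 28 = (R.card : ℝ) / Fintype.card (Fin m) ∧
      τ.realReg 29 = (∑ k ∈ R, l k) / R.card) (Runs.code ?_)
      (l := N * 29 + 15) fun σ₂ h₂ F₂ => ?_).of_le (by simp; omega)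
    · simp [apply, c7, c10, c11, ← hi0, cr24, i14, i17, hcard, add_comm _ B, add_comm _ (B + m),
        hzB, hlB]
    obtain ⟨d25, d26, d28, d29⟩ := h₂
    have e5 := (F₂.nat 5 rfl).trans c5
    have e7 := F₂.zero rfl c7
    have e17 := (F₂.nat 17 rfl).trans i17
    have e14 := (F₂.real 14 rfl).trans i14
    have e10 := (F₂.real 10 rfl).trans cr10
    have e22 := (F₂.real 22 rfl).trans cr22
    have e19 := F₂.real 19 rfl
    have e20 := (F₂.real 20 rfl).trans i20
    have e21 := F₂.real 21 rfl
    refine (Runs.seq' (fun τ => IsSelection (ε / 6) z l (R.erase i) (z i) (τ.realReg 21) ∧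
      τ.realReg 20 = meanBelow z l (τ.realReg 21)) ?_ (k := 6) (l := N * 29 + 9)
      fun σ₃ h₃ F₃ => ?_).of_le (by omega)
    · have keep : (z i < σ'.realReg 19 → ε / 6 ≤ (R.card : ℝ) / Fintype.card (Fin m) →
          (∑ k ∈ R, l k) / R.card ≤ meanBelow z l (σ'.realReg 21)) →
          Runs (code []) σ₂ 1 fun τ => IsSelection (ε / 6) z l (R.erase i) (z i) (τ.realReg 21) ∧
            τ.realReg 20 = meanBelow z l (τ.realReg 21) := fun hk => by
        refine Runs.code ?_
        simp only [List.foldl, apply, e21, e20, and_true]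
        exact iS.step_keep hi hmax hk
      refine Runs.branch (k := 5) (fun g₁ => ?_) fun g₁ => ?_ <;>
        simp only [holds, d25, e19] at g₁
      · refine Runs.branch (k := 4) (fun g₂ => ?_) fun g₂ => ?_ <;>
          simp only [holds, d28, e22] at g₂
        · exact (keep fun _ h => absurd g₂ h.not_gt).of_le (by omega)
        · refine Runs.branch (k := 3) (fun g₃ => ?_) fun g₃ => ?_ <;>
            simp only [holds, d29, e20] at g₃
          · refine (Runs.code ?_).of_le (by simp)
            have := iS.step_change hi hmax g₁ (not_lt.1 g₂) g₃
            simpa [apply, e10, d29, e19, this.2] using this.1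
          · exact (keep fun _ _ => not_lt.1 g₃).of_le (by omega)
      · exact (keep fun h => absurd h g₁).of_le (by omega)
    obtain ⟨f21, f20⟩ := h₃
    have g5 := (F₃.nat 5 rfl).trans e5
    have g7 := F₃.zero rfl e7
    have g17 := (F₃.nat 17 rfl).trans e17
    have g14 := (F₃.real 14 rfl).trans e14
    have g10 := (F₃.real 10 rfl).trans e10
    have g25 := (F₃.real 25 rfl).trans d25
    have g26 := (F₃.real 26 rfl).trans d26
    have gH := (F₃.realHeap rfl).trans (F₂.realHeap rfl)
    have gN := (F₃.natHeap rfl).trans (F₂.natHeap rfl)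
    refine (Runs.seq' (fun τ => τ.realReg 14 = ∑ k ∈ R.erase i, l k ∧ τ.realReg 19 = z i ∧
      τ.natReg 17 = s ∧ τ.natHeap = Function.update σ'.natHeap 0 (σ'.natHeap s) ∧
      τ.natReg 18 = 0 ∧ τ.natReg 19 = 2 * 0 + 1) (Runs.code ?_)
      (l := N * 29 + 1) fun σ₄ h₄ F₄ => ?_).of_le (by simp; omega)
    · rw [← Finset.sum_erase_add _ _ hi] at g14
      simp [apply, g14, g26, g25, g10, g17, g5, g7, gN]
    obtain ⟨p14, p19, p17, pN, p18, q19⟩ := h₄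
    have hR' := bijOn_update_root iR hi0.symm
    refine (runs_siftProg (lo := 0) (B := B) ((F₄.nat 5 rfl).trans g5)
      ((F₄.nat 10 rfl).trans ((F₃.nat 10 rfl).trans ((F₂.nat 10 rfl).trans c10)))
      p17 p18 q19 le_rfl ?_ ?_ (pN ▸ hR')).mono le_rfl ?_
    · refine iH.replace_root fun k hk => ?_
      rw [heapKey, heapKey, pN, Function.update_of_ne hk, F₄.realHeap rfl, gH]
    · rw [zero_add, one_mul]
      omega
    · rintro τ F₅ ⟨t1, t2⟩
      refine ⟨R.erase i, t2, t1, (F₅.nat 17 rfl).trans p17, (F₅.real 14 rfl).trans p14, ?_, ?_⟩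
      · rw [F₅.real 20 rfl, F₅.real 21 rfl, F₄.real 20 rfl, F₄.real 21 rfl, f20]
      · rw [F₅.real 19 rfl, F₅.real 21 rfl, F₄.real 21 rfl, p19]
        exact f21
  · rintro σ' - ⟨⟨R, iR, -, -, -, -, iS⟩, -⟩
    have : R = ∅ := by
      rw [← Finset.card_eq_zero]
      rw [Nat.sub_self] at iR
      exact card_eq_of_bijOn iR
    rw [this] at iS
    exact iS.eq_bestRadius (by linarith) hznn

end RealRAM

/-! ### Computing the subgradient -/

namespace RealRAM
open Instr Prog Test

/-- Adds a multiple of the example at the address in register `14` to the gradient; the factor is in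
the real register `11`, the address of the gradient in register `13`. -/
def addRowProg : Prog :=
  seq (code [natConst 15 0, natAdd 20 13 7, natAdd 21 14 7])
    (loop (natLt 15 4) (code [realLoad 7 20, realLoad 8 21, realMul 8 11 8, realAdd 7 7 8,
      realStore 20 7, natAdd 20 20 5, natAdd 21 21 5, natAdd 15 15 5]))

lemma runs_addRowProg {d A G : ℕ} {a : ℝ} {σ : State} {g x : Vec d} (h4 : σ.natReg 4 = d)
    (h5 : σ.natReg 5 = 1) (h7 : σ.natReg 7 = 0) (h13 : σ.natReg 13 = G) (h14 : σ.natReg 14 = A)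
    (ha : σ.realReg 11 = a) (hAG : A + d ≤ G) (hg : VecAt σ.realHeap G g)
    (hx : VecAt σ.realHeap A x) :
    Runs addRowProg σ (d * 10 + 5) fun σ' =>
      VecAt σ'.realHeap G (g + a • x) ∧ ∀ k < G, σ'.realHeap k = σ.realHeap k := by
  refine (Runs.seq' (fun τ => τ.natReg 15 = 0 ∧ τ.natReg 20 = G ∧ τ.natReg 21 = A)
    (Runs.code ?_) (l := d * 10 + 1) fun σ₁ h₁ F₁ => ?_).of_le (by simp; omega)
  · simp [apply, h13, h14, h7]
  obtain ⟨a15, a20, a21⟩ := h₁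
  have a4 := (F₁.nat 4 rfl).trans h4
  have a5 := (F₁.nat 5 rfl).trans h5
  have a11 := (F₁.real 11 rfl).trans ha
  have aH := F₁.realHeap rfl
  refine (Runs.for (c := 9) (N := d) (I := fun j τ => τ.natReg 15 = j ∧ τ.natReg 20 = G + j ∧
    τ.natReg 21 = A + j ∧ (∀ k < G, τ.realHeap k = σ.realHeap k) ∧
    ∀ k : Fin d, τ.realHeap (G + k) = if k.val < j then g k + a * x k else g k)
    ?_ ?_ ?_).mono le_rfl ?_
  · refine ⟨a15, a20, a21, fun k _ => by rw [aH], fun k => ?_⟩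
    rw [aH, if_neg (Nat.not_lt_zero _), hg k]
  · rintro j τ ⟨i15, -⟩ F -
    simp [holds, i15, F.nat 4 rfl, a4]
  · rintro j τ hj ⟨i15, i20, i21, iH, ig⟩ F
    have f5 := (F.nat 5 rfl).trans a5
    have f11 := (F.real 11 rfl).trans a11
    have hgj : τ.realHeap (G + j) = g ⟨j, hj⟩ := by simpa using ig ⟨j, hj⟩
    have hxj : τ.realHeap (A + j) = x ⟨j, hj⟩ := by
      rw [iH _ (by omega)]; exact hx ⟨j, hj⟩
    refine (Runs.code (Q := fun τ' => τ'.natReg 15 = j + 1 ∧ τ'.natReg 20 = G + j + 1 ∧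
      τ'.natReg 21 = A + j + 1 ∧ τ'.realHeap = Function.update τ.realHeap (G + j)
        (g ⟨j, hj⟩ + a * x ⟨j, hj⟩)) ?_).mono (by simp) ?_
    · simp [apply, i15, i20, i21, f5, f11, hgj, hxj]
    · rintro τ' - ⟨t15, t20, t21, tH⟩
      refine ⟨t15, t20, t21, fun k hk => ?_, fun k => ?_⟩
      · rw [tH, Function.update_of_ne (by omega), iH k hk]
      · rw [tH, Function.update_apply]
        rcases lt_trichotomy k.val j with h | h | h
        · rw [if_neg (by omega), ig k, if_pos h, if_pos (by omega)]
        · obtain rfl : k = ⟨j, hj⟩ := Fin.ext h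
          simp
        · rw [if_neg (by omega), ig k, if_neg (by omega), if_neg (by omega)]
  · rintro τ - ⟨⟨-, -, -, iH, ig⟩, -⟩
    exact ⟨fun k => by rw [ig k, if_pos k.2]; simp, iH⟩

/-- Sums the subgradients over the slab whose radius is in the real register `21`, and counts its
points in register `25`. -/
def gradProg : Prog :=
  seq (code [realConst 10 0, natConst 15 0, natAdd 20 13 7])
    (seq (loop (natLt 15 4) (code [realStore 20 10, natAdd 20 20 5, natAdd 15 15 5]))
      (seq (code [natConst 16 0, natConst 25 0, natAdd 14 9 7])
        (loop (natLt 16 2)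
          (seq (code [natAdd 20 10 16, realLoad 6 20, natAdd 20 12 16, realLoad 11 20])
            (seq (branch (realLt 6 21) (seq (code [natAdd 25 25 5]) addRowProg) (code []))
              (code [natAdd 14 14 4, natAdd 14 14 5, natAdd 16 16 5]))))))

lemma runs_gradProg {d m A B : ℕ} {lam r : ℝ} {σ : State} {w : Vec d} {S : Fin m → Example d}
    (h2 : σ.natReg 2 = m) (h4 : σ.natReg 4 = d) (h5 : σ.natReg 5 = 1) (h7 : σ.natReg 7 = 0)
    (h9 : σ.natReg 9 = A) (h10 : σ.natReg 10 = B) (h12 : σ.natReg 12 = B + 2 * m)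
    (h13 : σ.natReg 13 = B + 3 * m) (hr : σ.realReg 21 = r) (hAB : A + m * (d + 1) ≤ B)
    (hS : SampleAt σ.realHeap A S) (hM : MarginsAt lam w S B m σ) :
    Runs gradProg σ (d * 5 + m * (d * 10 + 18) + 10) fun σ' =>
      VecAt σ'.realHeap (B + 3 * m) (∑ i ∈ slab S w r,
        MassartHalfspace.slope lam (S i).2 (inner ℝ w (S i).1) • (S i).1) ∧
      σ'.natReg 25 = (slab S w r).card ∧
      ∀ k < B, σ'.realHeap k = σ.realHeap k := by
  refine (Runs.seq' (fun τ => τ.realReg 10 = 0 ∧ τ.natReg 15 = 0 ∧ τ.natReg 20 = B + 3 * m)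
    (Runs.code ?_) (l := d * 5 + m * (d * 10 + 18) + 6) fun σ₁ h₁ F₁ => ?_).of_le (by simp; omega)
  · simp [apply, h13, h7]
  obtain ⟨a10, a15, a20⟩ := h₁
  have a4 := (F₁.nat 4 rfl).trans h4
  have a5 := (F₁.nat 5 rfl).trans h5
  have aH := F₁.realHeap rfl
  refine (Runs.seq' (fun τ => VecAt τ.realHeap (B + 3 * m) (0 : Vec d) ∧
    ∀ k < B + 3 * m, τ.realHeap k = σ.realHeap k)
    ((Runs.for (c := 4) (N := d) (I := fun j τ => τ.natReg 15 = j ∧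
      τ.natReg 20 = B + 3 * m + j ∧ (∀ k < B + 3 * m, τ.realHeap k = σ.realHeap k) ∧
      ∀ k < j, τ.realHeap (B + 3 * m + k) = 0) ?_ ?_ ?_).mono le_rfl ?_)
    (l := m * (d * 10 + 18) + 5) fun σ₂ h₂ F₂ => ?_).of_le (by omega)
  · exact ⟨a15, a20, fun k _ => by rw [aH], fun k hk => absurd hk (Nat.not_lt_zero _)⟩
  · rintro j τ ⟨i15, -⟩ F -
    simp [holds, i15, F.nat 4 rfl, a4]
  · rintro j τ hj ⟨i15, i20, iH, ig⟩ F
    refine (Runs.code (Q := fun τ' => τ'.natReg 15 = j + 1 ∧ τ'.natReg 20 = B + 3 * m + j + 1 ∧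
      τ'.realHeap = Function.update τ.realHeap (B + 3 * m + j) 0) ?_).mono (by simp) ?_
    · simp [apply, i15, i20, (F.nat 5 rfl).trans a5, (F.real 10 rfl).trans a10]
    · rintro τ' - ⟨t15, t20, tH⟩
      refine ⟨t15, t20, fun k hk => ?_, fun k hk => ?_⟩
      · rw [tH, Function.update_of_ne (by omega), iH k hk]
      · rw [tH, Function.update_apply]
        split_ifs with hkj
        · rfl
        · exact ig k (by omega)
  · rintro τ - ⟨⟨-, -, iH, ig⟩, -⟩
    exact ⟨fun k => by simpa using ig k k.2, iH⟩
  obtain ⟨bG, bH⟩ := h₂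
  have b2 := (F₂.nat 2 rfl).trans ((F₁.nat 2 rfl).trans h2)
  have b4 := (F₂.nat 4 rfl).trans a4
  have b5 := (F₂.nat 5 rfl).trans a5
  have b7 := F₂.zero rfl (F₁.zero rfl h7)
  have b9 := (F₂.nat 9 rfl).trans ((F₁.nat 9 rfl).trans h9)
  have b10 := (F₂.nat 10 rfl).trans ((F₁.nat 10 rfl).trans h10)
  have b12 := (F₂.nat 12 rfl).trans ((F₁.nat 12 rfl).trans h12)
  have b13 := (F₂.nat 13 rfl).trans ((F₁.nat 13 rfl).trans h13)
  have br := (F₂.real 21 rfl).trans ((F₁.real 21 rfl).trans hr)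
  refine (Runs.seq' (fun τ => τ.natReg 16 = 0 ∧ τ.natReg 25 = 0 ∧ τ.natReg 14 = A)
    (Runs.code ?_) (l := m * (d * 10 + 18) + 1) fun σ₃ h₃ F₃ => ?_).of_le (by simp; omega)
  · simp [apply, b9, b7]
  obtain ⟨c16, c25, c14⟩ := h₃
  have c2 := (F₃.nat 2 rfl).trans b2
  have c4 := (F₃.nat 4 rfl).trans b4
  have c5 := (F₃.nat 5 rfl).trans b5
  have c7 := F₃.zero rfl b7
  have c10 := (F₃.nat 10 rfl).trans b10
  have c12 := (F₃.nat 12 rfl).trans b12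
  have c13 := (F₃.nat 13 rfl).trans b13
  have cr := (F₃.real 21 rfl).trans br
  have cH := F₃.realHeap rfl
  let f : Fin m → Vec d := fun i => if absMargin S w i < r then
    MassartHalfspace.slope lam (S i).2 (inner ℝ w (S i).1) • (S i).1 else 0
  let c : Fin m → ℕ := fun i => if absMargin S w i < r then 1 else 0
  refine (Runs.for (c := d * 10 + 17) (N := m) (I := fun j τ => τ.natReg 16 = j ∧
    τ.natReg 14 = A + j * (d + 1) ∧ τ.natReg 25 = ∑ i : Fin m with i.val < j, c i ∧
    VecAt τ.realHeap (B + 3 * m) (∑ i : Fin m with i.val < j, f i) ∧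
    ∀ k < B + 3 * m, τ.realHeap k = σ.realHeap k) ?_ ?_ ?_).mono le_rfl ?_
  · exact ⟨c16, by simp [c14], by simp [c25], by simpa [cH] using bG, by rwa [cH]⟩
  · rintro j τ ⟨i16, -⟩ F -
    simp [holds, i16, F.nat 2 rfl, c2]
  · rintro j τ hj ⟨i16, i14, i25, ig, iH⟩ F
    have d2 := (F.nat 2 rfl).trans c2
    have d4 := (F.nat 4 rfl).trans c4
    have d5 := (F.nat 5 rfl).trans c5
    have d7 := F.zero rfl c7
    have d10 := (F.nat 10 rfl).trans c10
    have d12 := (F.nat 12 rfl).trans c12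
    have d13 := (F.nat 13 rfl).trans c13
    have dr := (F.real 21 rfl).trans cr
    have hzj : τ.realHeap (B + j) = absMargin S w ⟨j, hj⟩ := by
      rw [iH _ (by clear * - hj; omega)]; exact hM.margin ⟨j, hj⟩ hj
    have hsj : τ.realHeap (B + 2 * m + j) =
        MassartHalfspace.slope lam (S ⟨j, hj⟩).2 (inner ℝ w (S ⟨j, hj⟩).1) := by
      rw [iH _ (by clear * - hj; omega)]; exact hM.slope ⟨j, hj⟩ hj
    rw [sum_val_lt_succ hj, sum_val_lt_succ hj]
    refine (Runs.seq' (fun τ' => τ'.realReg 6 = absMargin S w ⟨j, hj⟩ ∧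
      τ'.realReg 11 = MassartHalfspace.slope lam (S ⟨j, hj⟩).2 (inner ℝ w (S ⟨j, hj⟩).1))
      (Runs.code ?_) (l := d * 10 + 12) fun σ₄ h₄ F₄ => ?_).of_le (by clear * -; simp; omega)
    · simp [apply, d10, d12, i16, hzj, hsj]
    obtain ⟨e6, e11⟩ := h₄
    have eH := F₄.realHeap rfl
    have e4 := (F₄.nat 4 rfl).trans d4
    have e5 := (F₄.nat 5 rfl).trans d5
    have e7 := F₄.zero rfl d7
    have e13 := (F₄.nat 13 rfl).trans d13
    have e14 := (F₄.nat 14 rfl).trans i14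
    have e25 := (F₄.nat 25 rfl).trans i25
    refine (Runs.seq' (fun τ' => τ'.natReg 25 =
      ∑ i : Fin m with i.val < j, c i + c ⟨j, hj⟩ ∧
      VecAt τ'.realHeap (B + 3 * m) (∑ i : Fin m with i.val < j, f i + f ⟨j, hj⟩) ∧
      ∀ k < B + 3 * m, τ'.realHeap k = σ.realHeap k)
      (Runs.branch (k := d * 10 + 7) (fun g => ?_) fun g => ?_)
      (l := 4) fun σ₅ h₅ F₅ => ?_).of_le (by clear * -; omega)
    · simp only [holds, e6, F₄.real 21 rfl, dr] at g
      have hc : c ⟨j, hj⟩ = 1 := if_pos g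
      have hf : f ⟨j, hj⟩ = _ := if_pos g
      rw [hc, hf]
      refine (Runs.seq' (fun τ' => τ'.natReg 25 = ∑ i : Fin m with i.val < j, c i + 1)
        (Runs.code ?_) (l := d * 10 + 5) fun σ₅ h₅ F₅ => ?_).of_le (by clear * -; simp; omega)
      · simp [apply, e25, e5]
      have gH := (F₅.realHeap rfl).trans eH
      refine (runs_addRowProg ((F₅.nat 4 rfl).trans e4) ((F₅.nat 5 rfl).trans e5)
        (F₅.zero rfl e7) ((F₅.nat 13 rfl).trans e13) ((F₅.nat 14 rfl).trans e14)
        ((F₅.real 11 rfl).trans e11) (g := ∑ i : Fin m with i.val < j, f i)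
        (x := (S ⟨j, hj⟩).1) ?_ (gH ▸ ig) ?_).mono le_rfl ?_
      · have := add_mul_add_lt hAB hj le_rfl
        clear * - this
        omega
      · rw [gH]
        exact (hS.congr hAB (fun k hk => iH k (by clear * - hk; omega)) ⟨j, hj⟩).1
      · rintro τ' F₆ ⟨t1, t2⟩
        exact ⟨(F₆.nat 25 rfl).trans h₅, t1, fun k hk => by rw [t2 k hk, gH, iH k hk]⟩
    · simp only [holds, e6, F₄.real 21 rfl, dr] at g
      have hc : c ⟨j, hj⟩ = 0 := if_neg g
      have hf : f ⟨j, hj⟩ = 0 := if_neg g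
      rw [hc, hf, add_zero, add_zero]
      refine (Runs.code ?_).of_le (by simp)
      simp only [List.foldl, apply, eH]
      exact ⟨by simpa using e25, ig, iH⟩
    · refine (Runs.code ?_).of_le (by simp)
      simp [apply, (F₅.nat 14 rfl).trans e14, (F₅.nat 4 rfl).trans e4, (F₅.nat 5 rfl).trans e5,
        (F₅.nat 16 rfl).trans ((F₄.nat 16 rfl).trans i16), h₅.1, h₅.2.1]
      exact ⟨by ring, h₅.2.2⟩
  · rintro τ - ⟨⟨-, -, i25, ig, iH⟩, -⟩
    rw [sum_val_lt_self] at i25 ig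
    refine ⟨?_, ?_, fun k hk => iH k (by clear * - hk; omega)⟩
    · rw [slab, Finset.sum_filter]
      exact ig
    · rw [i25, slab, Finset.card_filter]
      rfl

end RealRAM

/-! ### The gradient step -/

namespace RealRAM
open Instr Prog Test

/-- The gradient step with the sum of subgradients stored from the address in register `13` on,
the number of summands in register `25`, and the number of finished rounds in register `6`. -/
def updateProg : Prog :=
  seq (code [realOfNat 6 25, natAdd 20 6 5, realOfNat 7 20, realSqrt 7 7, realConst 9 1,
      realDiv 8 9 7, realConst 12 0, realConst 10 0, natConst 15 0, natAdd 20 13 7])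
    (seq (loop (natLt 15 4) (code [realLoad 11 20, realDiv 11 11 6, realMul 11 8 11, realLoad 13 15,
        realSub 13 13 11, realStore 15 13, realMul 13 13 13, realAdd 12 12 13, natAdd 20 20 5,
        natAdd 15 15 5]))
      (seq (code [realSqrt 12 12, natConst 15 0])
        (seq (branch (realLt 9 12) (code []) (code [realAdd 12 9 10]))
          (loop (natLt 15 4) (code [realLoad 13 15, realDiv 13 13 12, realStore 15 13,
            natAdd 15 15 5])))))

lemma runs_updateProg {d G t c : ℕ} {σ : State} {w g : Vec d} (h4 : σ.natReg 4 = d)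
    (h5 : σ.natReg 5 = 1) (h6 : σ.natReg 6 = t) (h7 : σ.natReg 7 = 0) (h13 : σ.natReg 13 = G)
    (h25 : σ.natReg 25 = c) (hdG : d ≤ G) (hw : VecAt σ.realHeap 0 w) (hg : VecAt σ.realHeap G g) :
    Runs updateProg σ (d * 18 + 21) fun σ' =>
      VecAt σ'.realHeap 0 (projBall (w - (1 / Real.sqrt (t + 1 : ℕ)) • ((c : ℝ)⁻¹ • g))) ∧
      ∀ k, d ≤ k → σ'.realHeap k = σ.realHeap k := by
  set u := w - (1 / Real.sqrt (t + 1 : ℕ)) • ((c : ℝ)⁻¹ • g) with hu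
  refine (Runs.seq' (fun τ => τ.realReg 6 = c ∧ τ.realReg 9 = 1 ∧
    τ.realReg 8 = 1 / Real.sqrt (t + 1 : ℕ) ∧ τ.realReg 12 = 0 ∧ τ.realReg 10 = 0 ∧
    τ.natReg 15 = 0 ∧ τ.natReg 20 = G)
    (Runs.code ?_) (l := d * 18 + 10) fun σ₁ h₁ F₁ => ?_).of_le (by simp; omega)
  · simp [apply, h13, h7, h25, h6, h5]
  obtain ⟨a6, a9, a8, a12, a10, a15, a20⟩ := h₁
  have a4 := (F₁.nat 4 rfl).trans h4
  have a5 := (F₁.nat 5 rfl).trans h5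
  have aH := F₁.realHeap rfl
  refine (Runs.seq' (fun τ => VecAt τ.realHeap 0 u ∧ τ.realReg 12 = ∑ k, u k ^ 2 ∧
    ∀ k, d ≤ k → τ.realHeap k = σ.realHeap k)
    ((Runs.for (c := 11) (N := d) (I := fun j τ => τ.natReg 15 = j ∧ τ.natReg 20 = G + j ∧
      (∀ k, d ≤ k → τ.realHeap k = σ.realHeap k) ∧
      (∀ k : Fin d, τ.realHeap k = if k.val < j then u k else w k) ∧
      τ.realReg 12 = ∑ k : Fin d with k.val < j, u k ^ 2) ?_ ?_ ?_).mono le_rfl ?_)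
    (l := d * 6 + 9) fun σ₂ h₂ F₂ => ?_).of_le (by omega)
  · exact ⟨a15, a20, fun k _ => by rw [aH], fun k => by simpa [aH] using hw k, by simp [a12]⟩
  · rintro j τ ⟨i15, -⟩ F -
    simp [holds, i15, F.nat 4 rfl, a4]
  · rintro j τ hj ⟨i15, i20, iH, iu, i12⟩ F
    have hgj : τ.realHeap (G + j) = g ⟨j, hj⟩ := by
      rw [iH _ (by omega)]
      exact hg ⟨j, hj⟩
    have hwj : τ.realHeap j = w ⟨j, hj⟩ := by simpa using iu ⟨j, hj⟩
    have huj : u ⟨j, hj⟩ = w ⟨j, hj⟩ - 1 / Real.sqrt (t + 1 : ℕ) * (g ⟨j, hj⟩ / c) := by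
      simp [hu, div_eq_inv_mul]
    refine (Runs.code (Q := fun τ' => τ'.natReg 15 = j + 1 ∧ τ'.natReg 20 = G + j + 1 ∧
      τ'.realHeap = Function.update τ.realHeap j (u ⟨j, hj⟩) ∧
      τ'.realReg 12 = ∑ k : Fin d with k.val < j + 1, u k ^ 2) ?_).mono (by simp) ?_
    · rw [sum_val_lt_succ hj, huj]
      simp [apply, i15, i20, (F.nat 5 rfl).trans a5, (F.real 8 rfl).trans a8,
        (F.real 6 rfl).trans a6, hgj, hwj, i12, sq]
    · rintro τ' - ⟨t15, t20, tH, t12⟩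
      refine ⟨t15, t20, fun k hk => ?_, fun k => ?_, t12⟩
      · rw [tH, Function.update_of_ne (by omega), iH k hk]
      · rw [tH, Function.update_apply]
        rcases lt_trichotomy k.val j with h | h | h
        · rw [if_neg (by omega), iu k, if_pos h, if_pos (by omega)]
        · obtain rfl : k = ⟨j, hj⟩ := Fin.ext h
          simp
        · rw [if_neg (by omega), iu k, if_neg (by omega), if_neg (by omega)]
  · rintro τ - ⟨⟨-, -, iH, iu, i12⟩, -⟩
    rw [sum_val_lt_self] at i12
    exact ⟨fun k => by simpa using iu k, i12, iH⟩
  obtain ⟨bu, b12, bH⟩ := h₂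
  have b4 := (F₂.nat 4 rfl).trans a4
  have b5 := (F₂.nat 5 rfl).trans a5
  have b9 := (F₂.real 9 rfl).trans a9
  have b10 := (F₂.real 10 rfl).trans a10
  refine (Runs.seq' (fun τ => τ.realReg 12 = ‖u‖ ∧ τ.natReg 15 = 0)
    (Runs.code ?_) (l := d * 6 + 5) fun σ₃ h₃ F₃ => ?_).of_le (by simp; omega)
  · simp [apply, b12, EuclideanSpace.norm_eq]
  obtain ⟨c12, c15⟩ := h₃
  have c9 := (F₃.real 9 rfl).trans b9
  have c10 := (F₃.real 10 rfl).trans b10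
  have cH := F₃.realHeap rfl
  refine (Runs.seq' (fun τ => τ.realReg 12 = max 1 ‖u‖)
    (Runs.branch (k := 2) (fun g => ?_) fun g => ?_) (l := d * 6 + 1)
    fun σ₄ h₄ F₄ => ?_).of_le (by omega)
  · simp only [holds, c9, c12] at g
    refine (Runs.code ?_).of_le (by simp)
    simp [apply, c12, g.le]
  · simp only [holds, c9, c12] at g
    refine (Runs.code ?_).of_le (by simp)
    simp [apply, c9, c10, not_lt.1 g]
  have e4 := (F₄.nat 4 rfl).trans ((F₃.nat 4 rfl).trans b4)
  have e5 := (F₄.nat 5 rfl).trans ((F₃.nat 5 rfl).trans b5)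
  have e15 := (F₄.nat 15 rfl).trans c15
  have eH := (F₄.realHeap rfl).trans cH
  refine (Runs.for (c := 5) (N := d) (I := fun j τ => τ.natReg 15 = j ∧
      (∀ k, d ≤ k → τ.realHeap k = σ.realHeap k) ∧
      (∀ k : Fin d, τ.realHeap k = if k.val < j then projBall u k else u k))
      ?_ ?_ ?_).mono le_rfl ?_
  · refine ⟨e15, by rwa [eH], fun k => ?_⟩
    rw [eH]
    simpa using bu k
  · rintro j τ ⟨i15, -⟩ F -
    simp [holds, i15, F.nat 4 rfl, e4]
  · rintro j τ hj ⟨i15, iH, iu⟩ F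
    have huj : τ.realHeap j = u ⟨j, hj⟩ := by simpa using iu ⟨j, hj⟩
    refine (Runs.code (Q := fun τ' => τ'.natReg 15 = j + 1 ∧
      τ'.realHeap = Function.update τ.realHeap j (projBall u ⟨j, hj⟩)) ?_).mono (by simp) ?_
    · simp [apply, i15, (F.nat 5 rfl).trans e5, (F.real 12 rfl).trans h₄, huj, projBall,
        div_eq_inv_mul]
    · rintro τ' - ⟨t15, tH⟩
      refine ⟨t15, fun k hk => ?_, fun k => ?_⟩
      · rw [tH, Function.update_of_ne (by omega), iH k hk]
      · rw [tH, Function.update_apply]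
        rcases lt_trichotomy k.val j with h | h | h
        · rw [if_neg (by omega), iu k, if_pos h, if_pos (by omega)]
        · obtain rfl : k = ⟨j, hj⟩ := Fin.ext h
          simp
        · rw [if_neg (by omega), iu k, if_neg (by omega), if_neg (by omega)]
  · rintro τ - ⟨⟨-, iH, iu⟩, -⟩
    exact ⟨fun k => by simpa using iu k, iH⟩

/-- One round of the learner: a call of the oracle on the training block whose address is in
register `9`, followed by a gradient step. -/
def stepProg : Prog :=
  seq marginProg (seq heapifyProg (seq selectProg (seq gradProg updateProg)))

lemma runs_stepProg {d m t A B N : ℕ} {ε lam : ℝ} {σ : State} {w : Vec d} {S : Fin m → Example d}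
    (hm : 0 < m) (hε : 0 < ε) (hε1 : ε ≤ 1) (h2 : σ.natReg 2 = m) (h4 : σ.natReg 4 = d)
    (h5 : σ.natReg 5 = 1) (h6 : σ.natReg 6 = t) (h7 : σ.natReg 7 = 0) (h9 : σ.natReg 9 = A)
    (h10 : σ.natReg 10 = B) (h11 : σ.natReg 11 = B + m) (h12 : σ.natReg 12 = B + 2 * m)
    (h13 : σ.natReg 13 = B + 3 * m) (hr0 : σ.realReg 0 = ε) (hr2 : σ.realReg 2 = lam)
    (hAB : A + m * (d + 1) ≤ B) (hdB : d ≤ B) (hN : m < 2 ^ N) (hw : VecAt σ.realHeap 0 w)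
    (hS : SampleAt σ.realHeap A S) :
    Runs stepProg σ (m * (18 * d + N * 58 + 76) + 23 * d + 55) fun σ' =>
      VecAt σ'.realHeap 0
        (projBall (w - (1 / Real.sqrt (t + 1 : ℕ)) • oracle (ε / 6) lam S w)) ∧
      ∀ k, d ≤ k → k < B → σ'.realHeap k = σ.realHeap k := by
  refine (Runs.seq' _ (runs_marginProg h2 h4 h5 h7 h9 h10 h11 h12 hr2 hAB hdB hw hS)
    (l := m * (10 * d + N * 58 + 50) + 23 * d + 46) fun σ₁ h₁ F₁ => ?_).of_le (by
      apply le_of_eq; ring)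
  obtain ⟨aM, aN, a14, a15, aH⟩ := h₁
  refine (Runs.seq' _ (runs_heapifyProg (N := N)
    (R := Fin.val '' ((Finset.univ : Finset (Fin m)) : Set (Fin m))) ((F₁.nat 2 rfl).trans h2)
    ((F₁.nat 5 rfl).trans h5) (F₁.zero rfl h7) ((F₁.nat 10 rfl).trans h10) hN ?_)
    (l := m * (10 * d + N * 29 + 43) + 23 * d + 42) fun σ₂ h₂ F₂ => ?_).of_le (by
      apply le_of_eq; ring)
  · rw [Finset.coe_univ, Set.image_univ, Fin.range_val]
    exact (Set.bijOn_id _).congr fun k hk => (aN k hk).symm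
  obtain ⟨bH, bR⟩ := h₂
  have bM : MarginsAt lam w S B m σ₂ := by
    have := F₂.realHeap rfl
    exact ⟨this ▸ aM.margin, this ▸ aM.loss, this ▸ aM.slope⟩
  refine (Runs.seq' _ (runs_selectProg hm hε hε1 (B := B) (N := N)
    ((F₂.nat 2 rfl).trans ((F₁.nat 2 rfl).trans h2))
    ((F₂.nat 5 rfl).trans ((F₁.nat 5 rfl).trans h5)) (F₂.zero rfl (F₁.zero rfl h7))
    ((F₂.nat 10 rfl).trans ((F₁.nat 10 rfl).trans h10))
    ((F₂.nat 11 rfl).trans ((F₁.nat 11 rfl).trans h11))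
    ((F₂.real 0 rfl).trans ((F₁.real 0 rfl).trans hr0)) bM ((F₂.real 14 rfl).trans a14)
    ((F₂.real 15 rfl).trans a15) hN bH bR)
    (l := m * (10 * d + 18) + 23 * d + 31) fun σ₃ h₃ F₃ => ?_).of_le (by
      apply le_of_eq; ring)
  have c2 := (F₃.nat 2 rfl).trans ((F₂.nat 2 rfl).trans ((F₁.nat 2 rfl).trans h2))
  have c4 := (F₃.nat 4 rfl).trans ((F₂.nat 4 rfl).trans ((F₁.nat 4 rfl).trans h4))
  have c5 := (F₃.nat 5 rfl).trans ((F₂.nat 5 rfl).trans ((F₁.nat 5 rfl).trans h5))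
  have c6 := (F₃.nat 6 rfl).trans ((F₂.nat 6 rfl).trans ((F₁.nat 6 rfl).trans h6))
  have c7 := F₃.zero rfl (F₂.zero rfl (F₁.zero rfl h7))
  have c9 := (F₃.nat 9 rfl).trans ((F₂.nat 9 rfl).trans ((F₁.nat 9 rfl).trans h9))
  have c10 := (F₃.nat 10 rfl).trans ((F₂.nat 10 rfl).trans ((F₁.nat 10 rfl).trans h10))
  have c12 := (F₃.nat 12 rfl).trans ((F₂.nat 12 rfl).trans ((F₁.nat 12 rfl).trans h12))
  have c13 := (F₃.nat 13 rfl).trans ((F₂.nat 13 rfl).trans ((F₁.nat 13 rfl).trans h13))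
  have cH := (F₃.realHeap rfl).trans (F₂.realHeap rfl)
  have cM : MarginsAt lam w S B m σ₃ := ⟨cH ▸ aM.margin, cH ▸ aM.loss, cH ▸ aM.slope⟩
  have cB : ∀ k < B, σ₃.realHeap k = σ.realHeap k := cH ▸ aH
  refine (Runs.seq' _ (runs_gradProg c2 c4 c5 c7 c9 c10 c12 c13 h₃ hAB (hS.congr hAB cB) cM)
    (l := d * 18 + 21) fun σ₄ h₄ F₄ => ?_).of_le (by apply le_of_eq; ring)
  obtain ⟨dg, d25, dH⟩ := h₄
  refine (runs_updateProg ((F₄.nat 4 rfl).trans c4) ((F₄.nat 5 rfl).trans c5)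
    ((F₄.nat 6 rfl).trans c6) (F₄.zero rfl c7) ((F₄.nat 13 rfl).trans c13) d25 (by omega)
    (hw.congr fun k hk => by rw [dH k (by omega), cB k (by omega)]) dg).mono le_rfl ?_
  rintro τ - ⟨t1, t2⟩
  exact ⟨t1, fun k hk hkB => by rw [t2 k hk, dH k hkB, cB k hkB]⟩

end RealRAM

namespace RealRAM
open Instr Prog Test

/-! ### The layout of the input -/

lemma getD_flatMap_ofFn {α β : Type*} {n L : ℕ} (f : Fin n → β) (g : β → List α)
    (hL : ∀ b, (g b).length = L) (x : α) (i : Fin n) {k : ℕ} (hk : k < L) :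
    ((List.ofFn f).flatMap g).getD (i * L + k) x = (g (f i)).getD k x := by
  induction n with
  | zero => exact i.elim0
  | succ n ih =>
    rw [List.ofFn_succ, List.flatMap_cons]
    refine Fin.cases ?_ (fun i => ?_) i
    · rw [List.getD_append _ _ _ _ (by simp [hL, hk])]
      simp
    · rw [List.getD_append_right _ _ _ _ (by simp [hL, add_mul]; omega), hL,
        ← ih (fun i => f i.succ) i]
      congr 1
      simp [add_mul]
      omega

lemma length_encodeExample {d : ℕ} (p : Example d) : (encodeExample p).length = d + 1 := by
  simp [encodeExample]

lemma length_encodeSample {d m : ℕ} (S : Fin m → Example d) :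
    (encodeSample S).length = m * (d + 1) := by
  simp [encodeSample, List.length_flatMap, length_encodeExample, Function.comp_def]

lemma sampleAt_of_getD {d m a : ℕ} {H : ℕ → ℝ} {S : Fin m → Example d}
    (h : ∀ k < m * (d + 1), H (a + k) = (encodeSample S).getD k 0) : SampleAt H a S := by
  have key : ∀ (i : Fin m) (k : ℕ), k < d + 1 →
      H (a + i * (d + 1) + k) = (encodeExample (S i)).getD k 0 := by
    intro i k hk
    rw [add_assoc, h _ ((zero_add (i.val * (d + 1))) ▸
      add_mul_add_lt (B := m * (d + 1)) (by omega) i.2 (by omega)), encodeSample,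
      getD_flatMap_ofFn _ _ length_encodeExample _ _ hk]
  refine fun i => ⟨fun j => ?_, ?_⟩
  · rw [key i j (by omega), encodeExample, List.getD_append _ _ _ _ (by simp)]
    simp
  · rw [key i d (by omega), encodeExample, List.getD_append_right _ _ _ _ (by simp)]
    simp

section Input

variable {d m₀ m T : ℕ} (ε η lam : ℝ) (w₁ : Vec d) (test : Fin m₀ → Example d)
  (train : Fin T → Fin m → Example d)

lemma vecAt_inputState : VecAt (inputState ε η lam w₁ test train).realHeap 0 w₁ := by
  intro j
  simp only [inputState, zero_add]
  rw [List.append_assoc, List.getD_append _ _ _ _ (by simp)]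
  simp

lemma sampleAt_inputState_test :
    SampleAt (inputState ε η lam w₁ test train).realHeap d test := by
  refine sampleAt_of_getD fun k hk => ?_
  simp only [inputState]
  rw [List.append_assoc, List.getD_append_right _ _ _ _ (by simp),
    List.getD_append _ _ _ _ (by simpa [length_encodeSample] using hk)]
  simp

lemma sampleAt_inputState_train (t : Fin T) :
    SampleAt (inputState ε η lam w₁ test train).realHeap
      (d + m₀ * (d + 1) + t * (m * (d + 1))) (train t) := by
  refine sampleAt_of_getD fun k hk => ?_
  simp only [inputState]
  rw [add_assoc, List.getD_append_right _ _ _ _ (by simp [length_encodeSample]),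
    ← getD_flatMap_ofFn train encodeSample length_encodeSample 0 t hk]
  congr 1
  simp [length_encodeSample]

end Input

/-! ### The complete program -/

/-- Initializes the registers; the addresses are computed by repeated addition. -/
def setupProg : Prog :=
  seq (code [natAdd 4 0 7, natConst 5 1, natConst 0 0, natConst 6 0, natAdd 20 4 5, natAdd 9 4 7,
      natConst 16 0])
    (seq (loop (natLt 16 1) (code [natAdd 9 9 20, natAdd 16 16 5]))
      (seq (code [natConst 16 0, natConst 28 0])
        (seq (loop (natLt 16 2) (code [natAdd 28 28 20, natAdd 16 16 5]))
          (seq (code [natConst 16 0, natAdd 10 9 7])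
            (seq (loop (natLt 16 3) (code [natAdd 10 10 28, natAdd 16 16 5]))
              (code [natAdd 11 10 2, natAdd 12 11 2, natAdd 13 12 2, natAdd 29 3 7]))))))

/-- Adds register `b` to register `a` as often as register `c` says. -/
lemma runs_addLoop {a b c N x y : ℕ} {σ : State} (hab : a ≠ b) (hac : a ≠ c) (ha5 : a ≠ 5)
    (ha7 : a ≠ 7) (ha16 : a ≠ 16) (hb7 : b ≠ 7) (hb16 : b ≠ 16) (hc7 : c ≠ 7) (hc16 : c ≠ 16)
    (h5 : σ.natReg 5 = 1) (h16 : σ.natReg 16 = 0)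
    (hc : σ.natReg c = N) (ha : σ.natReg a = x) (hb : σ.natReg b = y) :
    Runs (loop (natLt 16 c) (code [natAdd a a b, natAdd 16 16 5])) σ (N * 4 + 1) fun σ' =>
      σ'.natReg a = x + N * y := by
  refine (Runs.for (c := 3) (N := N) (I := fun j τ => τ.natReg 16 = j ∧
    τ.natReg a = x + j * y ∧ τ.natReg b = y ∧ τ.natReg c = N ∧ τ.natReg 5 = 1)
    ?_ ?_ ?_).mono le_rfl ?_
  · exact ⟨h16, by simp [ha], hb, hc, h5⟩
  · rintro j τ ⟨i16, -, -, ic, -⟩ F -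
    simp [holds, i16, ic]
  · rintro j τ hj ⟨i16, ia, ib, ic, i5⟩ F
    refine (Runs.code ?_).of_le (by simp)
    simp [apply, Function.update_of_ne, ha7, ha16, hb7, hb16, hc7, hc16, hab.symm,
      hac.symm, ha5.symm, ha16.symm, i16, ia, ib, ic, i5]
    ring
  · rintro τ - ⟨⟨-, ia, -⟩, -⟩
    exact ia

lemma runs_setupProg {d m₀ m T : ℕ} {σ : State} (h0 : σ.natReg 0 = d) (h1 : σ.natReg 1 = m₀)
    (h2 : σ.natReg 2 = m) (h3 : σ.natReg 3 = T) (h7 : σ.natReg 7 = 0) :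
    Runs setupProg σ (4 * (m₀ + m + T) + 22) fun σ' =>
      σ'.natReg 0 = 0 ∧ σ'.natReg 4 = d ∧ σ'.natReg 5 = 1 ∧ σ'.natReg 6 = 0 ∧
      σ'.natReg 9 = d + m₀ * (d + 1) ∧
      σ'.natReg 10 = d + m₀ * (d + 1) + T * (m * (d + 1)) ∧
      σ'.natReg 11 = σ'.natReg 10 + m ∧ σ'.natReg 12 = σ'.natReg 10 + 2 * m ∧
      σ'.natReg 13 = σ'.natReg 10 + 3 * m ∧ σ'.natReg 28 = m * (d + 1) ∧ σ'.natReg 29 = T := by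
  refine (Runs.seq' (fun τ => τ.natReg 4 = d ∧ τ.natReg 5 = 1 ∧ τ.natReg 0 = 0 ∧
    τ.natReg 6 = 0 ∧ τ.natReg 20 = d + 1 ∧ τ.natReg 9 = d ∧ τ.natReg 16 = 0)
    (Runs.code ?_) (l := 4 * (m₀ + m + T) + 14) fun σ₁ h₁ F₁ => ?_).of_le (by simp; omega)
  · simp [apply, h0, h7]
  obtain ⟨a4, a5, a0, a6, a20, a9, a16⟩ := h₁
  refine (Runs.seq' _ (runs_addLoop (by decide) (by decide) (by decide) (by decide) (by decide)
    (by decide) (by decide) (by decide) (by decide) a5 a16 ((F₁.nat 1 rfl).trans h1) a9 a20)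
    (l := 4 * (m + T) + 13) fun σ₂ h₂ F₂ => ?_).of_le (by omega)
  refine (Runs.seq' (fun τ => τ.natReg 16 = 0 ∧ τ.natReg 28 = 0) (Runs.code ?_)
    (l := 4 * (m + T) + 10) fun σ₃ h₃ F₃ => ?_).of_le (by simp; omega)
  · simp [apply]
  have c5 := (F₃.nat 5 rfl).trans ((F₂.nat 5 rfl).trans a5)
  have c2 := (F₃.nat 2 rfl).trans ((F₂.nat 2 rfl).trans ((F₁.nat 2 rfl).trans h2))
  have c20 := (F₃.nat 20 rfl).trans ((F₂.nat 20 rfl).trans a20)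
  refine (Runs.seq' _ (runs_addLoop (by decide) (by decide) (by decide) (by decide) (by decide)
    (by decide) (by decide) (by decide) (by decide) c5 h₃.1 c2 h₃.2 c20)
    (l := 4 * T + 9) fun σ₄ h₄ F₄ => ?_).of_le (by omega)
  refine (Runs.seq' (fun τ => τ.natReg 16 = 0 ∧ τ.natReg 10 = d + m₀ * (d + 1)) (Runs.code ?_)
    (l := 4 * T + 6) fun σ₅ h₅ F₅ => ?_).of_le (by simp; omega)
  · simp [apply, (F₄.nat 9 rfl).trans ((F₃.nat 9 rfl).trans h₂),
      F₄.zero rfl (F₃.zero rfl (F₂.zero rfl (F₁.zero rfl h7)))]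
  have e5 := (F₅.nat 5 rfl).trans ((F₄.nat 5 rfl).trans c5)
  have e3 := (F₅.nat 3 rfl).trans ((F₄.nat 3 rfl).trans ((F₃.nat 3 rfl).trans
    ((F₂.nat 3 rfl).trans ((F₁.nat 3 rfl).trans h3))))
  have e28 := (F₅.nat 28 rfl).trans (h₄.trans (zero_add _))
  refine (Runs.seq' _ (runs_addLoop (by decide) (by decide) (by decide) (by decide) (by decide)
    (by decide) (by decide) (by decide) (by decide) e5 h₅.1 e3 h₅.2 e28)
    (l := 5) fun σ₆ h₆ F₆ => ?_).of_le (by omega)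
  have f0 := (F₆.nat 0 rfl).trans ((F₅.nat 0 rfl).trans ((F₄.nat 0 rfl).trans
    ((F₃.nat 0 rfl).trans ((F₂.nat 0 rfl).trans a0))))
  have f2 := (F₆.nat 2 rfl).trans ((F₅.nat 2 rfl).trans ((F₄.nat 2 rfl).trans c2))
  have f4 := (F₆.nat 4 rfl).trans ((F₅.nat 4 rfl).trans ((F₄.nat 4 rfl).trans
    ((F₃.nat 4 rfl).trans ((F₂.nat 4 rfl).trans a4))))
  have f6 := (F₆.nat 6 rfl).trans ((F₅.nat 6 rfl).trans ((F₄.nat 6 rfl).trans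
    ((F₃.nat 6 rfl).trans ((F₂.nat 6 rfl).trans a6))))
  have f9 := (F₆.nat 9 rfl).trans ((F₅.nat 9 rfl).trans ((F₄.nat 9 rfl).trans
    ((F₃.nat 9 rfl).trans h₂)))
  have f7 := F₆.zero rfl (F₅.zero rfl (F₄.zero rfl (F₃.zero rfl (F₂.zero rfl (F₁.zero rfl h7)))))
  refine (Runs.code ?_).of_le (by simp)
  simp [apply, f0, f2, f4, f6, f9, f7, h₆, (F₆.nat 5 rfl).trans e5, (F₆.nat 3 rfl).trans e3,
    (F₆.nat 28 rfl).trans e28]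
  constructor <;> ring

/-- The learner. Register `6` counts the finished rounds, register `29` holds the number of rounds
after which the loop stops; it is set to `0` when a vector is returned. -/
def filterTronProg : Prog :=
  seq setupProg
    (loop (natLt 6 29)
      (seq errProg (seq (code [realOfNat 6 1, realDiv 8 8 6, realConst 6 2, realDiv 6 0 6,
          realAdd 6 1 6])
        (branch (realLt 8 6) (code [natConst 0 1, natConst 29 0])
          (seq stepProg (code [natAdd 9 9 28, natAdd 6 6 5]))))))

lemma runs_filterTronProg {d m₀ m T N : ℕ} {ε η lam : ℝ} (hm : 0 < m) (hε : 0 < ε) (hε1 : ε ≤ 1)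
    (hN : m < 2 ^ N) (w₁ : Vec d) (test : Fin m₀ → Example d) (train : Fin T → Fin m → Example d) :
    Runs filterTronProg (inputState ε η lam w₁ test train)
      (T * (m₀ * (8 * d + 13) + m * (18 * d + N * 58 + 76) + 23 * d + 73) +
        4 * (m₀ + m + T) + 23) fun σ' =>
      Represents σ' (filterTron ε η (oracle (ε / 6) lam) w₁ test train) := by
  set σ := inputState ε η lam w₁ test train with hσ
  set res := filterTron ε η (oracle (ε / 6) lam) w₁ test train with hres
  have h1 : σ.natReg 1 = m₀ := by simp [hσ, inputState]
  have h2 : σ.natReg 2 = m := by simp [hσ, inputState]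
  have hr0 : σ.realReg 0 = ε := by simp [hσ, inputState]
  have hr1 : σ.realReg 1 = η := by simp [hσ, inputState]
  have hr2 : σ.realReg 2 = lam := by simp [hσ, inputState]
  have h7 : σ.natReg 7 = 0 := by simp [hσ, inputState]
  refine (Runs.seq' _ (runs_setupProg (d := d) (by simp [hσ, inputState]) h1 h2
    (T := T) (by simp [hσ, inputState]) h7)
    (l := T * (m₀ * (8 * d + 13) + m * (18 * d + N * 58 + 76) + 23 * d + 73) + 1)
    fun σ₁ h₁ F₁ => ?_).of_le (by omega)
  obtain ⟨a0, a4, a5, a6, a9, a10, a11, a12, a13, a28, a29⟩ := h₁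
  set B := d + m₀ * (d + 1) + T * (m * (d + 1)) with hB
  have b1 := (F₁.nat 1 rfl).trans h1
  have b2 := (F₁.nat 2 rfl).trans h2
  have b7 := F₁.zero rfl h7
  have br0 := (F₁.real 0 rfl).trans hr0
  have br1 := (F₁.real 1 rfl).trans hr1
  have br2 := (F₁.real 2 rfl).trans hr2
  have bH := F₁.realHeap rfl
  rw [a10] at a11 a12 a13
  refine (Runs.while (c := m₀ * (8 * d + 13) + m * (18 * d + N * 58 + 76) + 23 * d + 72) (N := T)
    (I := fun n τ => (τ.natReg 29 = 0 ∧ Represents τ res) ∨ ∃ (t : ℕ) (w : Vec d),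
      t + n = T ∧ τ.natReg 6 = t ∧ τ.natReg 29 = T ∧ τ.natReg 0 = 0 ∧
      τ.natReg 9 = d + m₀ * (d + 1) + t * (m * (d + 1)) ∧ VecAt τ.realHeap 0 w ∧
      (∀ k, d ≤ k → k < B → τ.realHeap k = σ.realHeap k) ∧
      res = filterTronLoop ε η (oracle (ε / 6) lam) test (t + 1) ((List.ofFn train).drop t) w)
    (.inr ⟨0, w₁, zero_add _, a6, a29, a0, by simp [a9], ?_, by simp [bH], rfl⟩) ?_).mono le_rfl ?_
  · rw [bH]
    exact vecAt_inputState ε η lam w₁ test train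
  · rintro n τ hI F hb
    rcases hI with ⟨i29, -⟩ | ⟨t, w, htn, i6, i29, i0, i9, iw, iH, ires⟩
    · simp [holds, i29] at hb
    simp only [holds, i6, i29] at hb
    refine ⟨n - 1, by omega, ?_⟩
    have c1 := (F.nat 1 rfl).trans b1
    have c2 := (F.nat 2 rfl).trans b2
    have c4 := (F.nat 4 rfl).trans a4
    have c5 := (F.nat 5 rfl).trans a5
    have c7 := F.zero rfl b7
    have c10 := (F.nat 10 rfl).trans a10
    have c11 := (F.nat 11 rfl).trans a11
    have c12 := (F.nat 12 rfl).trans a12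
    have c13 := (F.nat 13 rfl).trans a13
    have c28 := (F.nat 28 rfl).trans a28
    have cr0 := (F.real 0 rfl).trans br0
    have cr1 := (F.real 1 rfl).trans br1
    have cr2 := (F.real 2 rfl).trans br2
    have hsplit : (List.ofFn train).drop t = train ⟨t, hb⟩ :: (List.ofFn train).drop (t + 1) := by
      rw [List.drop_eq_getElem_cons (by simpa using hb)]
      simp
    rw [hsplit, filterTronLoop] at ires
    have htB : d + m₀ * (d + 1) + t * (m * (d + 1)) + m * (d + 1) ≤ B := by
      have : (t + 1) * (m * (d + 1)) ≤ T * (m * (d + 1)) := Nat.mul_le_mul_right _ hb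
      rw [add_mul, one_mul] at this
      clear * - this hB
      omega
    have htest : SampleAt τ.realHeap d test := by
      refine fun i => ⟨fun j => ?_, ?_⟩
      · rw [iH _ (by clear * -; omega) ((add_mul_add_lt le_rfl i.2 j.2.le).trans_le
          (by clear * - hB; omega))]
        exact (sampleAt_inputState_test ε η lam w₁ test train i).1 j
      · rw [iH _ (by clear * -; omega) ((add_mul_add_lt le_rfl i.2 le_rfl).trans_le
          (by clear * - hB; omega))]
        exact (sampleAt_inputState_test ε η lam w₁ test train i).2
    have htrain : SampleAt τ.realHeap (d + m₀ * (d + 1) + t * (m * (d + 1))) (train ⟨t, hb⟩) := by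
      have := sampleAt_inputState_train ε η lam w₁ test train ⟨t, hb⟩
      refine fun i => ⟨fun j => ?_, ?_⟩
      · rw [iH _ (by clear * -; omega) (add_mul_add_lt htB i.2 j.2.le)]
        exact (this i).1 j
      · rw [iH _ (by clear * -; omega) (add_mul_add_lt htB i.2 le_rfl)]
        exact (this i).2
    refine (Runs.seq' _ (runs_errProg c1 c4 c5 c7 iw htest)
      (l := m * (18 * d + N * 58 + 76) + 23 * d + 65) fun σ₂ h₂ F₂ => ?_).of_le
      (by clear * -; omega)
    refine (Runs.seq' (fun τ' => τ'.realReg 8 = empErr test w ∧ τ'.realReg 6 = η + ε / 2)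
      (Runs.code ?_) (l := m * (18 * d + N * 58 + 76) + 23 * d + 59) fun σ₃ h₃ F₃ => ?_).of_le
      (by clear * -; simp; omega)
    · simp [apply, empErr, h₂, (F₂.nat 1 rfl).trans c1, (F₂.real 0 rfl).trans cr0,
        (F₂.real 1 rfl).trans cr1]
    have e0 := (F₃.nat 0 rfl).trans ((F₂.nat 0 rfl).trans i0)
    have e2 := (F₃.nat 2 rfl).trans ((F₂.nat 2 rfl).trans c2)
    have e4 := (F₃.nat 4 rfl).trans ((F₂.nat 4 rfl).trans c4)
    have e5 := (F₃.nat 5 rfl).trans ((F₂.nat 5 rfl).trans c5)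
    have e6 := (F₃.nat 6 rfl).trans ((F₂.nat 6 rfl).trans i6)
    have e7 := F₃.zero rfl (F₂.zero rfl c7)
    have e9 := (F₃.nat 9 rfl).trans ((F₂.nat 9 rfl).trans i9)
    have e10 := (F₃.nat 10 rfl).trans ((F₂.nat 10 rfl).trans c10)
    have e11 := (F₃.nat 11 rfl).trans ((F₂.nat 11 rfl).trans c11)
    have e12 := (F₃.nat 12 rfl).trans ((F₂.nat 12 rfl).trans c12)
    have e13 := (F₃.nat 13 rfl).trans ((F₂.nat 13 rfl).trans c13)
    have e28 := (F₃.nat 28 rfl).trans ((F₂.nat 28 rfl).trans c28)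
    have e29 := (F₃.nat 29 rfl).trans ((F₂.nat 29 rfl).trans i29)
    have er0 := (F₃.real 0 rfl).trans ((F₂.real 0 rfl).trans cr0)
    have er2 := (F₃.real 2 rfl).trans ((F₂.real 2 rfl).trans cr2)
    have eH := (F₃.realHeap rfl).trans (F₂.realHeap rfl)
    refine Runs.branch (k := m * (18 * d + N * 58 + 76) + 23 * d + 58) (fun g => ?_) fun g => ?_
    · simp only [holds, h₃.1, h₃.2] at g
      rw [if_pos g] at ires
      refine (Runs.code (.inl ⟨?_, ?_⟩)).of_le (by simp)
      · simp [apply]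
      · rw [ires]
        refine ⟨by simp [apply], fun j => ?_⟩
        simp only [List.foldl, apply, eH]
        simpa using iw j
    · simp only [holds, h₃.1, h₃.2] at g
      rw [if_neg g] at ires
      refine (Runs.seq' _ (runs_stepProg hm hε hε1 e2 e4 e5 e6 e7 e9 e10 e11 e12 e13 er0 er2 htB
        (by clear * - hB; omega) hN (eH ▸ iw) (eH ▸ htrain)) (l := 3)
        fun σ₄ h₄ F₄ => ?_).of_le (by clear * -; omega)
      refine (Runs.code (Q := fun τ' => τ'.realHeap = σ₄.realHeap ∧ τ'.natReg 6 = t + 1 ∧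
        τ'.natReg 9 = d + m₀ * (d + 1) + (t + 1) * (m * (d + 1)) ∧ τ'.natReg 29 = T ∧
        τ'.natReg 0 = 0) ?_).mono (by simp) ?_
      · simp [apply, (F₄.nat 6 rfl).trans e6, (F₄.nat 5 rfl).trans e5, (F₄.nat 9 rfl).trans e9,
          (F₄.nat 28 rfl).trans e28, (F₄.nat 29 rfl).trans e29, (F₄.nat 0 rfl).trans e0]
        ring
      · rintro τ' - ⟨tH, t6, t9, t29, t0⟩
        refine .inr ⟨t + 1, _, by omega, t6, t29, t0, t9, tH ▸ h₄.1, fun k hk hkB => ?_, ires⟩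
        rw [tH, h₄.2 k hk hkB, eH, iH k hk hkB]
  · rintro τ - ⟨⟨n, hI⟩, hb, -⟩
    rcases hI with ⟨-, h⟩ | ⟨t, w, htn, i6, i29, i0, -, -, -, ires⟩
    · exact h
    · simp only [holds, i6, i29] at hb
      rw [List.drop_eq_nil_of_le (by simp; omega), filterTronLoop] at ires
      rw [ires]
      exact i0

end RealRAM

/-! ### Geometry of one oracle call -/

namespace MassartHalfspace

/-- Summation by parts: if all sums of `b` over `{i | z i < r}` with `r > r₀` are nonpositive, then
so is the sum with weights that decrease in `z` and do not distinguish the values below `r₀`. -/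
lemma sum_mul_antitone_nonpos {ι : Type*} (s : Finset ι) (z b : ι → ℝ) (r₀ : ℝ)
    (hb : ∀ r, r₀ < r → ∑ i ∈ s with z i < r, b i ≤ 0) (φ : ℝ → ℝ) (hφ : Antitone φ)
    (hφ0 : ∀ i ∈ s, 0 ≤ φ (z i)) (hφc : ∀ x ≤ r₀, φ x = φ r₀) :
    ∑ i ∈ s, b i * φ (z i) ≤ 0 := by
  induction s using Finset.strongInduction generalizing φ with
  | _ s ih =>
    rcases s.eq_empty_or_nonempty with rfl | hs
    · simp
    obtain ⟨k, hk, hmax⟩ := s.exists_max_image z hs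
    have htot : ∑ i ∈ s, b i ≤ 0 := by
      have := hb (max r₀ (z k) + 1) (by linarith [le_max_left r₀ (z k)])
      rwa [Finset.filter_true_of_mem fun i hi => by
        linarith [hmax i hi, le_max_right r₀ (z k)]] at this
    rcases le_or_gt (z k) r₀ with hkr | hkr
    · have : ∀ i ∈ s, b i * φ (z i) = φ (z k) * b i := fun i hi => by
        rw [hφc _ ((hmax i hi).trans hkr), hφc _ hkr, mul_comm]
      rw [Finset.sum_congr rfl this, ← Finset.mul_sum]
      exact mul_nonpos_of_nonneg_of_nonpos (hφ0 k hk) htot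
    · have hsub : (s.filter fun i => z i < z k) ⊂ s :=
        Finset.filter_ssubset.2 ⟨k, hk, lt_irrefl _⟩
      have h1 := ih _ hsub (fun r hr => ?_) (fun x => φ x - φ (z k))
        (fun x y hxy => sub_le_sub_right (hφ hxy) _) (fun i hi => sub_nonneg.2
          (hφ (hmax i (Finset.mem_of_mem_filter i hi)))) (fun x hx => by simp [hφc x hx])
      · have h2 : ∑ i ∈ s, b i * φ (z i) =
            ∑ i ∈ s with z i < z k, b i * (φ (z i) - φ (z k)) + φ (z k) * ∑ i ∈ s, b i := by
          rw [Finset.sum_filter, Finset.mul_sum, ← Finset.sum_add_distrib]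
          refine Finset.sum_congr rfl fun i hi => ?_
          split_ifs with h
          · ring
          · rw [le_antisymm (hmax i hi) (not_lt.1 h)]; ring
        rw [h2]
        exact add_nonpos h1 (mul_nonpos_of_nonneg_of_nonpos (hφ0 k hk) htot)
      · rw [Finset.filter_filter]
        have := hb (min (z k) r) (lt_min hkr hr)
        simpa only [lt_min_iff] using this

lemma leakyRelu_neg_labelVal_mul (lam : ℝ) (y : ℤˣ) (p : ℝ) :
    leakyRelu lam (-labelVal y * p) = ((if sgn p ≠ y then 1 else 0) - lam) * |p| := by
  unfold leakyRelu sgn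
  rcases Int.units_eq_one_or y with rfl | rfl <;> rcases le_or_gt 0 p with h | h <;>
    simp [labelVal, h, abs_of_nonneg, abs_of_neg, not_le.2]
  all_goals try ring

/-- If `w` has a large error on the sample, then it has nonnegative loss on some heavy slab. Let
`r₀` be the largest value `|⟨w, x⟩|` on the sample whose open slab is light. Putting the weight
`min (|⟨w, x⟩| / r₀) 1` on an example lowers the sum of the excesses of the error indicator over
`lam` by at most the size of the slab of radius `r₀`, and `min (z / r₀) 1` is a mixture of the
functions `z 1[z < r]` with `r > r₀`. -/
lemma exists_heavyRadii_slabLoss_nonneg {d m : ℕ} {ε lam : ℝ} (hm : 0 < m) (hε : 0 < ε)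
    (hlam : 0 ≤ lam) (S : Fin m → Example d) (w : Vec d) (herr : lam + ε ≤ empErr S w) :
    ∃ r ∈ heavyRadii ε S w, 0 ≤ slabLoss lam S w r w := by
  have hm' : (0 : ℝ) < m := by exact_mod_cast hm
  have : Nonempty (Fin m) := ⟨⟨0, hm⟩⟩
  set z : Fin m → ℝ := fun i => |inner ℝ w (S i).1| with hz
  have hz0 : ∀ i, 0 ≤ z i := fun i => abs_nonneg _
  set e : Fin m → ℝ := fun i => (if sgn (inner ℝ w (S i).1) ≠ (S i).2 then 1 else 0) - lam with he
  have hsum : ∑ i, e i = m * (empErr S w - lam) := by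
    rw [empErr, Finset.card_filter]
    simp only [he, Finset.sum_sub_distrib, Finset.sum_const, Finset.card_univ, Fintype.card_fin,
      nsmul_eq_mul]
    push_cast
    field_simp
  have he1 : ∀ i, e i ≤ 1 := fun i => by
    simp only [he]; split_ifs <;> linarith
  have hε1 : ε ≤ 1 := by
    have : ∑ i, e i ≤ m := (Finset.sum_le_sum fun i _ => he1 i).trans (by simp)
    rw [hsum] at this
    nlinarith
  by_contra! hneg
  have hneg' : ∀ r, 0 < r → ε * m ≤ (slab S w r).card → ∑ i with z i < r, e i * z i < 0 := by
    intro r hr hc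
    have h1 := hneg r ⟨hr, by rwa [le_div_iff₀ hm']⟩
    have hcard : (0 : ℝ) < (slab S w r).card := by nlinarith
    rw [slabLoss, div_lt_iff₀ hcard, zero_mul] at h1
    simp only [leakyRelu_neg_labelVal_mul] at h1
    exact h1
  obtain ⟨k, hk, hkmax⟩ := Finset.exists_max_image
    (Finset.univ.filter fun k => ((slab S w (z k)).card : ℝ) < ε * m) z (by
      obtain ⟨k, -, hk⟩ := Finset.exists_min_image Finset.univ z Finset.univ_nonempty
      refine ⟨k, ?_⟩
      simp only [Finset.mem_filter, Finset.mem_univ, true_and]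
      have : slab S w (z k) = ∅ := Finset.filter_false_of_mem fun i _ =>
        not_lt.2 (hk i (Finset.mem_univ i))
      rw [this]
      simpa using mul_pos hε hm')
  simp only [Finset.mem_filter, Finset.mem_univ, true_and] at hk hkmax
  have hheavy : ∀ r, z k < r → ε * m ≤ (slab S w r).card := by
    intro r hr
    obtain ⟨o, ho⟩ := exists_radius_filter_eq hz0 r
    rw [slab, ← ho]
    rcases o with _ | j
    · rw [Finset.filter_true_of_mem fun i _ => lt_radius_none hz0 i]
      simp
      nlinarith
    · by_contra! hlt
      have h1 := hkmax j hlt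
      have h2 : k ∈ Finset.univ.filter fun i => z i < radius z (some j) := by
        rw [ho]; simpa using hr
      have h3 : z k < z j := (Finset.mem_filter.1 h2).2
      linarith
  have hall : ∀ r, z k < r → ∑ i with z i < r, e i * z i < 0 := fun r hr =>
    hneg' r ((hz0 k).trans_lt hr) (hheavy r hr)
  rcases (hz0 k).eq_or_lt with hk0 | hk0
  · -- The points on the hyperplane are heavy: a slab without other points has loss zero.
    have hev : ∀ᶠ r in nhdsWithin (0 : ℝ) (Set.Ioi 0), ∀ i, z i < r → z i = 0 := by
      rw [Filter.eventually_all]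
      intro i
      rcases (hz0 i).eq_or_lt with h | h
      · exact Filter.Eventually.of_forall fun _ _ => h.symm
      · filter_upwards [nhdsWithin_le_nhds (Iio_mem_nhds h)] with r hr hr'
        exact absurd hr' (not_lt.2 (le_of_lt hr))
    obtain ⟨r, hr, hr0⟩ := (hev.and self_mem_nhdsWithin).exists
    have h1 := hall r (hk0 ▸ hr0)
    rw [Finset.sum_eq_zero] at h1
    · exact lt_irrefl _ h1
    · intro i hi
      rw [hr i (by simpa using hi), mul_zero]
  · -- The weights `(max (z i) (z k))⁻¹` turn `e i * z i` into `e i`, except where `z i < z k`.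
    have h1 := sum_mul_antitone_nonpos Finset.univ z (fun i => e i * z i) (z k)
      (fun r hr => (hall r hr).le) (fun x => (max x (z k))⁻¹)
      (fun x y hxy => inv_anti₀ (lt_max_of_lt_right hk0) (max_le_max_right _ hxy))
      (fun i _ => inv_nonneg.2 (hk0.le.trans (le_max_right _ _)))
      (fun x hx => by simp [hx])
    have h2 : ∑ i, e i ≤ ∑ i, e i * z i * (max (z i) (z k))⁻¹ +
        ∑ i, if z i < z k then (1 : ℝ) else 0 := by
      rw [← Finset.sum_add_distrib]
      refine Finset.sum_le_sum fun i _ => ?_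
      split_ifs with h
      · have h3 : e i * z i * (max (z i) (z k))⁻¹ + 1 - e i = e i * (z i * (z k)⁻¹ - 1) + 1 := by
          rw [max_eq_right h.le]; ring
        have h4 : z i * (z k)⁻¹ ≤ 1 := by
          rw [← div_eq_mul_inv]; exact (div_le_one hk0).2 h.le
        have h5 : 0 ≤ z i * (z k)⁻¹ := mul_nonneg (hz0 i) (inv_nonneg.2 hk0.le)
        nlinarith [he1 i]
      · have h3 : 0 < z i := hk0.trans_le (not_lt.1 h)
        rw [max_eq_left (not_lt.1 h), mul_assoc, mul_inv_cancel₀ h3.ne']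
        simp
    have h3 : ∑ i, (if z i < z k then (1 : ℝ) else 0) = (slab S w (z k)).card := by
      rw [slab, Finset.card_filter]
      push_cast
      rfl
    rw [hsum, h3] at h2
    nlinarith

/-! ### Properties of subgradients of the slab loss -/

lemma slabLoss_smul {d m : ℕ} (lam : ℝ) (S : Fin m → Example d) (w : Vec d) (r : ℝ) {a : ℝ}
    (ha : 0 ≤ a) (v : Vec d) : slabLoss lam S w r (a • v) = a * slabLoss lam S w r v := by
  unfold slabLoss leakyRelu
  rw [← mul_div_assoc, Finset.mul_sum]
  congr 1
  refine Finset.sum_congr rfl fun i _ => ?_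
  rw [inner_smul_left, conj_trivial, mul_left_comm (-_) a, abs_mul a, abs_of_nonneg ha]
  ring

lemma slabLoss_le_norm {d m : ℕ} {lam : ℝ} (hlam0 : 0 ≤ lam)
    {S : Fin m → Example d}
    (hS : ∀ i, ‖(S i).1‖ ≤ 1) (w : Vec d) (r : ℝ) (v : Vec d) : slabLoss lam S w r v ≤ ‖v‖ := by
  unfold slabLoss
  refine div_le_of_le_mul₀ (by positivity) (norm_nonneg _) ?_
  rw [mul_comm, ← nsmul_eq_mul]
  refine Finset.sum_le_card_nsmul _ _ _ fun i _ => ?_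
  rw [leakyRelu_neg_labelVal_mul]
  have h1 : |inner ℝ v (S i).1| ≤ ‖v‖ := (abs_real_inner_le_norm _ _).trans
    (mul_le_of_le_one_right (norm_nonneg _) (hS i))
  have h2 := abs_nonneg (inner ℝ v (S i).1)
  split_ifs <;> nlinarith

section Subgradient

variable {d m : ℕ} {lam r : ℝ} {S : Fin m → Example d} {w g : Vec d}

lemma IsSubgradientAt.inner_self (h : IsSubgradientAt (slabLoss lam S w r) w g) :
    inner ℝ g w = slabLoss lam S w r w := by
  have h0 := h ((0 : ℝ) • w)
  have h2 := h ((2 : ℝ) • w)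
  rw [slabLoss_smul _ _ _ _ (by norm_num), inner_sub_right, inner_smul_right] at h0 h2
  linarith

lemma IsSubgradientAt.inner_le (h : IsSubgradientAt (slabLoss lam S w r) w g) (v : Vec d) :
    inner ℝ g v ≤ slabLoss lam S w r v := by
  have h1 := h v
  rw [inner_sub_right, h.inner_self] at h1
  linarith

lemma IsSubgradientAt.norm_le_one (hlam0 : 0 ≤ lam)
    (hS : ∀ i, ‖(S i).1‖ ≤ 1) (h : IsSubgradientAt (slabLoss lam S w r) w g) : ‖g‖ ≤ 1 := by
  have h1 := (h.inner_le g).trans (slabLoss_le_norm hlam0 hS w r g)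
  rw [real_inner_self_eq_norm_sq] at h1
  nlinarith [norm_nonneg g]

end Subgradient

/-! ### Convergence of the projected iteration -/

/-- A vector of positive correlation with all negative gradients is found by projected gradient
descent: the iteration cannot go on for long if every step moves towards `v`. As long as
`p t = ⟨w t, v⟩` is negative, it grows by `Δ / √t` in every step; afterwards `√t * p t` grows
by `Δ`. -/
lemma projBall_iteration_bound {E : Type*} [NormedAddCommGroup E] [InnerProductSpace ℝ E]
    {v : E} (hv : ‖v‖ = 1) {Δ : ℝ} (hΔ : 0 < Δ) (hΔ8 : Δ ≤ 1 / 8) {T : ℕ}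
    (hT : 145 / 64 / Δ ^ 2 ≤ T) (w g : ℕ → E) (hw1 : ‖w 1‖ ≤ 1)
    (hstep : ∀ t, 1 ≤ t → t ≤ T → w (t + 1) =
      (max 1 ‖w t - (1 / Real.sqrt t) • g t‖)⁻¹ • (w t - (1 / Real.sqrt t) • g t))
    (hgw : ∀ t, 1 ≤ t → t ≤ T → 0 ≤ inner ℝ (g t) (w t))
    (hgv : ∀ t, 1 ≤ t → t ≤ T → inner ℝ (g t) v ≤ -Δ)
    (hg : ∀ t, 1 ≤ t → t ≤ T → ‖g t‖ ≤ 1) : False := by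
  set p : ℕ → ℝ := fun t => inner ℝ (w t) v with hp
  have hball : ∀ t, 1 ≤ t → t ≤ T + 1 → ‖w t‖ ≤ 1 := by
    intro t h1 hT'
    rcases h1.eq_or_lt with rfl | h1
    · exact hw1
    obtain ⟨t, rfl⟩ : ∃ k, t = k + 1 := ⟨t - 1, by omega⟩
    rw [hstep t (by omega) (by omega), norm_smul, norm_inv, Real.norm_of_nonneg (by positivity),
      inv_mul_le_one₀ (by positivity)]
    exact le_max_right _ _
  have hpbd : ∀ t, 1 ≤ t → t ≤ T + 1 → |p t| ≤ 1 := fun t h1 hT' =>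
    (abs_real_inner_le_norm _ _).trans (by rw [hv, mul_one]; exact hball t h1 hT')
  -- The factor `N` of the projection in round `t` is at most `√(1 + 1 / t)`.
  have hrec : ∀ t, 1 ≤ t → t ≤ T → ∃ N : ℝ, 1 ≤ N ∧ Real.sqrt t * N ≤ Real.sqrt (t + 1) ∧
      ∃ q, p (t + 1) * N = q ∧ p t + Δ / Real.sqrt t ≤ q := by
    intro t h1 hT'
    have ht : (0 : ℝ) < t := by exact_mod_cast h1
    have hst : 0 < Real.sqrt t := Real.sqrt_pos.2 ht
    set u := w t - (1 / Real.sqrt t) • g t with hu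
    have hN : 0 < max 1 ‖u‖ := by positivity
    refine ⟨max 1 ‖u‖, le_max_left _ _, ?_, _, rfl, ?_⟩
    · have hu2 : ‖u‖ ^ 2 ≤ 1 + 1 / t := by
        rw [hu, norm_sub_sq_real, inner_smul_right, norm_smul, mul_pow, real_inner_comm]
        have h2 := hball t h1 (by omega)
        have h3 := hg t h1 hT'
        have h4 : ‖1 / Real.sqrt t‖ ^ 2 = 1 / t := by
          rw [Real.norm_of_nonneg (by positivity), div_pow, Real.sq_sqrt ht.le, one_pow]
        rw [h4]
        have h5 : 0 ≤ 1 / Real.sqrt t * inner ℝ (g t) (w t) :=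
          mul_nonneg (by positivity) (hgw t h1 hT')
        have h6 : ‖w t‖ ^ 2 ≤ 1 := pow_le_one₀ (norm_nonneg _) h2
        have h7 : 1 / (t : ℝ) * ‖g t‖ ^ 2 ≤ 1 / t :=
          mul_le_of_le_one_right (by positivity) (pow_le_one₀ (norm_nonneg _) h3)
        linarith
      rw [Real.le_sqrt (by positivity) (by positivity), mul_pow, Real.sq_sqrt ht.le]
      rcases max_cases 1 ‖u‖ with ⟨h, -⟩ | ⟨h, -⟩ <;> rw [h]
      · linarith
      · calc (t : ℝ) * ‖u‖ ^ 2 ≤ t * (1 + 1 / t) := by gcongr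
          _ = t + 1 := by field_simp
    · simp only [hp]
      rw [hstep t h1 hT', inner_smul_left, conj_trivial, mul_comm, mul_inv_cancel_left₀ hN.ne',
        inner_sub_left, inner_smul_left, conj_trivial]
      have h2 : 1 / Real.sqrt t * inner ℝ (g t) v ≤ 1 / Real.sqrt t * -Δ := by
        gcongr
        exact hgv t h1 hT'
      have h3 : 1 / Real.sqrt t * -Δ = -(Δ / Real.sqrt t) := by ring
      linarith
  -- While `p t` is negative, `2 * Δ * (√t - 1) < 1`; so this lasts for less than `b` rounds.
  set b : ℝ := (1 + 1 / (2 * Δ)) ^ 2 + 1 with hb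
  have hinv : ∀ t, 1 ≤ t → t ≤ T + 1 → (p t < 0 ∧ -1 + 2 * Δ * (Real.sqrt t - 1) ≤ p t) ∨
      (0 ≤ p t ∧ (t - b) * Δ ≤ Real.sqrt t * p t) := by
    intro t h1
    induction t, h1 using Nat.le_induction with
    | base =>
      intro hT'
      rcases lt_or_ge (p 1) 0 with h | h
      · left
        refine ⟨h, ?_⟩
        have := (abs_le.1 (hpbd 1 le_rfl hT')).1
        simpa using this
      · right
        refine ⟨h, le_trans ?_ (mul_nonneg (Real.sqrt_nonneg _) h)⟩
        refine mul_nonpos_of_nonpos_of_nonneg ?_ hΔ.le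
        rw [hb]
        push_cast
        nlinarith [sq_nonneg (1 + 1 / (2 * Δ))]
    | succ t h1 ih =>
      intro hT'
      have ht : (0 : ℝ) < t := by exact_mod_cast h1
      have hst : 0 < Real.sqrt t := Real.sqrt_pos.2 ht
      obtain ⟨N, hN1, hN2, q, hq, hq'⟩ := hrec t h1 (by omega)
      have hN0 : 0 < N := by linarith
      push_cast
      rcases lt_or_ge (p (t + 1)) 0 with h | h
      · left
        refine ⟨h, ?_⟩
        have hpq : q ≤ p (t + 1) := by rw [← hq]; nlinarith
        have hpt : p t < 0 := by
          have : 0 < Δ / Real.sqrt t := by positivity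
          have : q < 0 := by rw [← hq]; exact mul_neg_of_neg_of_pos h hN0
          linarith
        have hIH := ((ih (by omega)).resolve_right fun hr => absurd hr.1 (not_le.2 hpt)).2
        -- `√(t + 1) - √t ≤ 1 / (2 √t)`
        have hsq : Real.sqrt (t + 1) ≤ Real.sqrt t + 1 / (2 * Real.sqrt t) := by
          rw [Real.sqrt_le_left (by positivity), add_sq, Real.sq_sqrt ht.le]
          have : 2 * Real.sqrt t * (1 / (2 * Real.sqrt t)) = 1 := by field_simp
          rw [this]
          nlinarith [sq_nonneg (1 / (2 * Real.sqrt t))]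
        have h2 : 2 * Δ * (1 / (2 * Real.sqrt t)) = Δ / Real.sqrt t := by field_simp
        nlinarith
      · right
        refine ⟨h, ?_⟩
        have hsN : Real.sqrt t * q ≤ Real.sqrt (t + 1) * p (t + 1) := by
          rw [← hq]
          nlinarith
        rcases ih (by omega) with ⟨hn, hI⟩ | ⟨hn, hI⟩
        · have h2 : Real.sqrt t < 1 + 1 / (2 * Δ) := by
            have : 2 * Δ * (Real.sqrt t - 1) < 1 := by linarith
            have : Real.sqrt t - 1 < 1 / (2 * Δ) := by
              rw [lt_div_iff₀ (by positivity)]; linarith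
            linarith
          have h3 : (t : ℝ) ≤ (1 + 1 / (2 * Δ)) ^ 2 := by
            rw [← Real.sq_sqrt ht.le]
            gcongr
          refine le_trans ?_ (mul_nonneg (Real.sqrt_nonneg _) h)
          refine mul_nonpos_of_nonpos_of_nonneg ?_ hΔ.le
          rw [hb]
          linarith
        · have h2 : Real.sqrt t * (p t + Δ / Real.sqrt t) = Real.sqrt t * p t + Δ := by
            field_simp
          have h3 : Real.sqrt t * (p t + Δ / Real.sqrt t) ≤ Real.sqrt t * q := by gcongr
          nlinarith
  have hT1 : 1 ≤ T := by
    have : (0 : ℝ) < T := lt_of_lt_of_le (by positivity) hT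
    exact_mod_cast this
  have hTΔ : 145 / 64 ≤ T * Δ ^ 2 := by rwa [div_le_iff₀ (by positivity)] at hT
  -- With `x = Δ * √(T + 1) ≥ 3 / 2`, the invariant would give
  -- `x ^ 2 - (Δ + 1 / 2) ^ 2 - Δ ^ 2 ≤ x`.
  set y := Real.sqrt (T + 1) with hy
  have hy0 : 0 ≤ y := Real.sqrt_nonneg _
  have hyy : y ^ 2 = T + 1 := Real.sq_sqrt (by positivity)
  have hx : 145 / 64 ≤ (y * Δ) ^ 2 := by rw [mul_pow, hyy]; nlinarith [sq_nonneg Δ]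
  have hx0 : 0 ≤ y * Δ := by positivity
  have hx1 : 3 / 2 ≤ y * Δ := by nlinarith
  rcases hinv (T + 1) (by omega) le_rfl with ⟨hn, hI⟩ | ⟨hn, hI⟩ <;> push_cast at hI <;>
    rw [← hy] at hI
  · nlinarith
  · have hp1 := (abs_le.1 (hpbd (T + 1) (by omega) le_rfl)).2
    have h1 : (T + 1 - b) * Δ ≤ y := hI.trans (mul_le_of_le_one_right hy0 hp1)
    have h2 : (T + 1 - b) * Δ * Δ ≤ y * Δ := by gcongr
    have h3 : b * Δ ^ 2 = (Δ + 1 / 2) ^ 2 + Δ ^ 2 := by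
      rw [hb]; field_simp
    have h4 : (T + 1 - b) * Δ * Δ = (y * Δ) ^ 2 - ((Δ + 1 / 2) ^ 2 + Δ ^ 2) := by
      rw [← h3, mul_pow, hyy]; ring
    rw [h4] at h2
    nlinarith

end MassartHalfspace

/-! ### Concentration for independent examples -/

namespace MassartHalfspace

section Product

variable {ι X : Type*} [Fintype ι] [MeasurableSpace X] (μ : Measure X) [IsProbabilityMeasure μ]

/-- Resampling one coordinate of an i.i.d. family does not change the law. -/
lemma measurePreserving_update [DecidableEq ι] (j : ι) :
    MeasurePreserving (fun p : X × (ι → X) => Function.update p.2 j p.1)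
      (μ.prod (Measure.pi fun _ => μ)) (Measure.pi fun _ => μ) := by
  have hmeas : Measurable fun p : X × (ι → X) => Function.update p.2 j p.1 := by
    refine measurable_pi_lambda _ fun i => ?_
    by_cases h : i = j
    · subst h; simpa using measurable_fst
    · simp only [Function.update_of_ne h]; fun_prop
  refine ⟨hmeas, (Measure.pi_eq fun s hs => ?_).symm⟩
  rw [Measure.map_apply hmeas (.univ_pi hs)]
  have : (fun p : X × (ι → X) => Function.update p.2 j p.1) ⁻¹' Set.univ.pi s =
      s j ×ˢ Set.univ.pi (Function.update s j Set.univ) := by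
    ext ⟨x, S⟩
    simp only [Set.mem_preimage, Set.mem_pi, Set.mem_univ, true_implies, Set.mem_prod]
    constructor
    · refine fun h => ⟨by simpa using h j, fun i => ?_⟩
      by_cases hi : i = j
      · subst hi; simp
      · simpa [hi] using h i
    · rintro ⟨h1, h2⟩ i
      by_cases hi : i = j
      · subst hi; simpa using h1
      · simpa [hi] using h2 i
  rw [this, Measure.prod_prod, Measure.pi_pi, ← Finset.mul_prod_erase _ _ (Finset.mem_univ j),
    ← Finset.mul_prod_erase _ (fun i => μ (s i)) (Finset.mem_univ j)]
  simp only [Function.update_self, measure_univ, one_mul]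
  congr 1
  refine Finset.prod_congr rfl fun i hi => ?_
  rw [Function.update_of_ne (Finset.ne_of_mem_erase hi)]

variable {μ}

/-- An event is unlikely if it is unlikely for every value of the other coordinates. -/
lemma pi_le_of_forall_update [DecidableEq ι] {B : Set (ι → X)} (hB : MeasurableSet B) (j : ι)
    {β : ENNReal} (h : ∀ S, μ {x | Function.update S j x ∈ B} ≤ β) :
    Measure.pi (fun _ : ι => μ) B ≤ β := by
  have hp := measurePreserving_update (ι := ι) μ j
  rw [← hp.measure_preimage hB.nullMeasurableSet, Measure.prod_apply_symm (hp.measurable hB)]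
  refine (lintegral_mono fun S => h S).trans ?_
  simp

/-- An event is unlikely if it is unlikely for every value of one coordinate. -/
lemma pi_le_of_forall_value [DecidableEq ι] {B : Set (ι → X)} (hB : MeasurableSet B) (j : ι)
    {β : ENNReal} (h : ∀ x, Measure.pi (fun _ : ι => μ) {S | Function.update S j x ∈ B} ≤ β) :
    Measure.pi (fun _ : ι => μ) B ≤ β := by
  have hp := measurePreserving_update (ι := ι) μ j
  rw [← hp.measure_preimage hB.nullMeasurableSet, Measure.prod_apply (hp.measurable hB)]
  refine (lintegral_mono fun x => h x).trans ?_
  simp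

/-- The exponential Markov inequality for a sum of independent terms whose exponential moments
are at most one. -/
lemma pi_le_sum_le_exp {f : ι → X → ℝ} (hf : ∀ i, Measurable (f i))
    (h1 : ∀ i, ∫⁻ x, ENNReal.ofReal (Real.exp (f i x)) ∂μ ≤ 1) (k : ℝ) :
    Measure.pi (fun _ : ι => μ) {S | k ≤ ∑ i, f i (S i)} ≤ ENNReal.ofReal (Real.exp (-k)) := by
  have hg : ∀ i, Measurable fun x => ENNReal.ofReal (Real.exp (f i x)) := fun i =>
    (hf i).exp.ennreal_ofReal
  have hprod : ∫⁻ S : ι → X, ∏ i, ENNReal.ofReal (Real.exp (f i (S i))) ∂(Measure.pi fun _ => μ) ≤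
      1 := by
    have hind := ProbabilityTheory.iIndepFun_pi (μ := fun _ : ι => μ)
      (X := fun i x => ENNReal.ofReal (Real.exp (f i x))) fun i => (hg i).aemeasurable
    rw [ProbabilityTheory.lintegral_prod_eq_prod_lintegral_of_indepFun Finset.univ _ hind
      fun i => (hg i).comp (measurable_pi_apply i)]
    refine Finset.prod_le_one' fun i _ => ?_
    rw [(measurePreserving_eval (fun _ : ι => μ) i).lintegral_comp (hg i)]
    exact h1 i
  have hM := mul_meas_ge_le_lintegral (μ := Measure.pi fun _ : ι => μ)
    (f := fun S => ∏ i, ENNReal.ofReal (Real.exp (f i (S i))))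
    (Finset.measurable_prod _ fun i _ => (hg i).comp (measurable_pi_apply i))
    (ENNReal.ofReal (Real.exp k))
  have hset : {S : ι → X | k ≤ ∑ i, f i (S i)} ⊆ {S | ENNReal.ofReal (Real.exp k) ≤
      ∏ i, ENNReal.ofReal (Real.exp (f i (S i)))} := by
    intro S hS
    show ENNReal.ofReal (Real.exp k) ≤ ∏ i, ENNReal.ofReal (Real.exp (f i (S i)))
    rw [← ENNReal.ofReal_prod_of_nonneg fun i _ => (Real.exp_pos _).le, ← Real.exp_sum]
    exact ENNReal.ofReal_le_ofReal (Real.exp_le_exp.2 hS)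
  rw [Real.exp_neg, ENNReal.ofReal_inv_of_pos (Real.exp_pos k)]
  rw [ENNReal.le_inv_iff_mul_le, mul_comm]
  exact (mul_le_mul_right (measure_mono hset) _).trans (hM.trans hprod)

end Product

/-! ### The law of an example -/

lemma labelVal_injective : Function.Injective labelVal := fun x y h => by
  rcases Int.units_eq_one_or x with rfl | rfl <;> rcases Int.units_eq_one_or y with rfl | rfl
  · rfl
  · norm_num [labelVal] at h
  · norm_num [labelVal] at h
  · rfl

lemma measurable_sgn : Measurable sgn :=
  Measurable.ite measurableSet_Ici measurable_const measurable_const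

lemma measurable_neg_sgn : Measurable fun z => -sgn z := by
  have : (fun z => -sgn z) = fun z : ℝ => if 0 ≤ z then -1 else 1 := by
    funext z
    unfold sgn
    split_ifs <;> simp
  rw [this]
  exact Measurable.ite measurableSet_Ici measurable_const measurable_const

lemma measurableSet_sgn_ne {α : Type*} [MeasurableSpace α] {f : α → ℝ} {g : α → ℤˣ}
    (hf : Measurable f) (hg : Measurable g) : MeasurableSet {a | sgn (f a) ≠ g a} := by
  have : {a | sgn (f a) ≠ g a} = {a | labelVal (sgn (f a)) = labelVal (g a)}ᶜ := by
    ext a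
    simp [labelVal_injective.eq_iff]
  rw [this]
  exact (measurableSet_eq_fun (measurable_labelVal.comp (measurable_sgn.comp hf))
    (measurable_labelVal.comp hg)).compl

section Law

variable {d : ℕ} {η γ : ℝ} {Dx : Measure (Vec d)} {flip : Vec d → ℝ} {wstar : Vec d}

lemma lintegral_massartLaw (hflip : Measurable flip) {f : Example d → ENNReal}
    (hf : Measurable f) : ∫⁻ p, f p ∂(massartLaw Dx flip wstar) =
      ∫⁻ x, (ENNReal.ofReal (1 - flip x) * f (x, sgn (inner ℝ wstar x)) +
        ENNReal.ofReal (flip x) * f (x, -sgn (inner ℝ wstar x))) ∂Dx := by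
  have hi : Measurable fun x : Vec d => inner ℝ wstar x := by fun_prop
  have h1 : Measurable fun x : Vec d => (x, sgn (inner ℝ wstar x)) :=
    measurable_id.prodMk (measurable_sgn.comp hi)
  have h2 : Measurable fun x : Vec d => (x, -sgn (inner ℝ wstar x)) :=
    measurable_id.prodMk (measurable_neg_sgn.comp hi)
  have hg1 : Measurable fun x => ENNReal.ofReal (1 - flip x) := (hflip.const_sub 1).ennreal_ofReal
  have hg2 : Measurable fun x => ENNReal.ofReal (flip x) := hflip.ennreal_ofReal
  have hf1 : Measurable fun x : Vec d => f (x, sgn (inner ℝ wstar x)) := hf.comp h1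
  have hf2 : Measurable fun x : Vec d => f (x, -sgn (inner ℝ wstar x)) := hf.comp h2
  rw [massartLaw, lintegral_add_measure, lintegral_map hf h1, lintegral_map hf h2,
    lintegral_withDensity_eq_lintegral_mul _ hg1 hf1,
    lintegral_withDensity_eq_lintegral_mul _ hg2 hf2, ← lintegral_add_left (hg1.mul hf1)]
  rfl

/-- An integral bound against the law of an example, from a bound for almost every `x`. -/
lemma lintegral_massartLaw_le (h : IsMassartHalfspace η γ Dx flip wstar) (hη : η ≤ 1)
    {f : Example d → ℝ} (hf : Measurable f) (hf0 : ∀ p, 0 ≤ f p) {c : ℝ}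
    (hc : ∀ᵐ x ∂Dx, (1 - flip x) * f (x, sgn (inner ℝ wstar x)) +
      flip x * f (x, -sgn (inner ℝ wstar x)) ≤ c) :
    ∫⁻ p, ENNReal.ofReal (f p) ∂(massartLaw Dx flip wstar) ≤ ENNReal.ofReal c := by
  have := h.isProbabilityMeasure
  rw [lintegral_massartLaw h.measurable_flip hf.ennreal_ofReal]
  refine (lintegral_mono_ae (g := fun _ => ENNReal.ofReal c) ?_).trans (by simp)
  filter_upwards [hc] with x hx
  have h1 : 0 ≤ 1 - flip x := by linarith [h.flip_le x]
  rw [← ENNReal.ofReal_mul h1, ← ENNReal.ofReal_mul (h.flip_nonneg x),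
    ← ENNReal.ofReal_add (mul_nonneg h1 (hf0 _)) (mul_nonneg (h.flip_nonneg x) (hf0 _))]
  exact ENNReal.ofReal_le_ofReal hx

lemma isProbabilityMeasure_massartLaw (h : IsMassartHalfspace η γ Dx flip wstar) (hη : η ≤ 1) :
    IsProbabilityMeasure (massartLaw Dx flip wstar) := by
  have := h.isProbabilityMeasure
  constructor
  have h1 := lintegral_massartLaw (Dx := Dx) (wstar := wstar) h.measurable_flip
    (f := fun _ => 1) measurable_const
  rw [lintegral_one] at h1
  rw [h1]
  have : ∀ x, ENNReal.ofReal (1 - flip x) * 1 + ENNReal.ofReal (flip x) * 1 = 1 := fun x => by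
    rw [mul_one, mul_one, ← ENNReal.ofReal_add (by linarith [h.flip_le x]) (h.flip_nonneg x)]
    simp
  rw [lintegral_congr this]
  simp

lemma ae_norm_le_one_massartLaw (h : IsMassartHalfspace η γ Dx flip wstar) :
    ∀ᵐ p ∂(massartLaw Dx flip wstar), ‖p.1‖ ≤ 1 := by
  have hset : MeasurableSet {p : Example d | ¬ ‖p.1‖ ≤ 1} :=
    (measurableSet_le measurable_fst.norm measurable_const).compl
  rw [ae_iff, ← lintegral_indicator_one hset,
    lintegral_massartLaw h.measurable_flip (measurable_one.indicator hset)]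
  rw [lintegral_eq_zero_of_ae_eq_zero]
  filter_upwards [h.norm_le_one] with x hx
  simp [hx]

end Law

end MassartHalfspace

namespace MassartHalfspace

/-! ### Deviations of the empirical error -/

lemma exp_le_one_add_add_sq {u : ℝ} (hu : |u| ≤ 1) : Real.exp u ≤ 1 + u + u ^ 2 := by
  have := (abs_le.1 (Real.abs_exp_sub_one_sub_id_le hu)).2
  linarith

/-- The exponential moment of a centred Bernoulli variable. -/
lemma bernoulli_exp_moment_le {q s : ℝ} (hq0 : 0 ≤ q) (hq1 : q ≤ 1) (hs : |s| ≤ 1) :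
    q * Real.exp (s * (1 - q) - s ^ 2) + (1 - q) * Real.exp (s * (0 - q) - s ^ 2) ≤ 1 := by
  have h1 : Real.exp (s * (1 - q)) ≤ 1 + s * (1 - q) + (s * (1 - q)) ^ 2 := by
    apply exp_le_one_add_add_sq
    rw [abs_mul, abs_of_nonneg (by linarith : 0 ≤ 1 - q)]
    nlinarith [abs_nonneg s]
  have h2 : Real.exp (s * (0 - q)) ≤ 1 + s * (0 - q) + (s * (0 - q)) ^ 2 := by
    apply exp_le_one_add_add_sq
    rw [abs_mul, zero_sub, abs_neg, abs_of_nonneg hq0]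
    nlinarith [abs_nonneg s]
  have h3 : 1 + s ^ 2 ≤ Real.exp (s ^ 2) := by linarith [Real.add_one_le_exp (s ^ 2)]
  rw [Real.exp_sub, Real.exp_sub, ← mul_div_assoc, ← mul_div_assoc, ← add_div,
    div_le_one (Real.exp_pos _)]
  have h4 : 0 ≤ s ^ 2 * (1 - q * (1 - q)) := by
    have : 0 ≤ 1 - q * (1 - q) := by nlinarith
    positivity
  nlinarith [mul_le_mul_of_nonneg_left h1 hq0,
    mul_le_mul_of_nonneg_left h2 (by linarith : 0 ≤ 1 - q)]

section Empirical

variable {d m : ℕ} {D : Measure (Example d)} [IsProbabilityMeasure D]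

lemma measurableSet_misclassified (w : Vec d) :
    MeasurableSet {p : Example d | sgn (inner ℝ w p.1) ≠ p.2} :=
  measurableSet_sgn_ne (by fun_prop) measurable_snd

/-- The exponential moment behind the two tail bounds for the empirical error, for which
`s = τ / 2` and `s = -τ / 2`. -/
lemma lintegral_exp_misclassified_le (w : Vec d) {s : ℝ} (hs : |s| ≤ 1) :
    ∫⁻ p, ENNReal.ofReal (Real.exp
      (s * ((if sgn (inner ℝ w p.1) ≠ p.2 then 1 else 0) - err D w) - s ^ 2)) ∂D ≤ 1 := by
  classical
  set E := {p : Example d | sgn (inner ℝ w p.1) ≠ p.2} with hE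
  have hEm : MeasurableSet E := measurableSet_misclassified w
  have hq0 : 0 ≤ err D w := measureReal_nonneg
  have hq1 : err D w ≤ 1 := measureReal_le_one
  have hDE : D E = ENNReal.ofReal (err D w) := (ofReal_measureReal).symm
  have hDE' : D Eᶜ = ENNReal.ofReal (1 - err D w) := by
    rw [prob_compl_eq_one_sub hEm, hDE, ENNReal.ofReal_sub _ hq0, ENNReal.ofReal_one]
  rw [← lintegral_add_compl _ hEm, setLIntegral_congr_fun (g := fun _ =>
      ENNReal.ofReal (Real.exp (s * (1 - err D w) - s ^ 2))) hEm,
    setLIntegral_congr_fun (g := fun _ =>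
      ENNReal.ofReal (Real.exp (s * (0 - err D w) - s ^ 2))) hEm.compl, setLIntegral_const,
    setLIntegral_const, hDE, hDE', ← ENNReal.ofReal_mul (Real.exp_pos _).le,
    ← ENNReal.ofReal_mul (Real.exp_pos _).le, ← ENNReal.ofReal_add (by positivity)
      (mul_nonneg (Real.exp_pos _).le (by linarith)), ENNReal.ofReal_le_one]
  · linarith [bernoulli_exp_moment_le hq0 hq1 hs]
  · intro p hp
    have : ¬ sgn (inner ℝ w p.1) ≠ p.2 := hp
    simp only [this, if_false]
  · intro p hp
    have : sgn (inner ℝ w p.1) ≠ p.2 := hp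
    simp only [this, not_false_eq_true, ne_eq, if_true]

lemma pi_le_sum_misclassified_le (w : Vec d) {s : ℝ} (hs : |s| ≤ 1) :
    Measure.pi (fun _ : Fin m => D)
      {S | m * s ^ 2 ≤ m * (s * (empErr S w - err D w)) - m * s ^ 2} ≤
        ENNReal.ofReal (Real.exp (-(m * s ^ 2))) := by
  refine (measure_mono fun S hS => ?_).trans (pi_le_sum_le_exp (μ := D)
    (f := fun (_ : Fin m) p =>
      s * ((if sgn (inner ℝ w p.1) ≠ p.2 then 1 else 0) - err D w) - s ^ 2)
    (fun _ => ?_) (fun _ => lintegral_exp_misclassified_le w hs) (m * s ^ 2))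
  · have hcard : (m : ℝ) * empErr S w =
        ∑ i, if sgn (inner ℝ w (S i).1) ≠ (S i).2 then (1 : ℝ) else 0 := by
      rw [Finset.sum_boole, empErr]
      rcases Nat.eq_zero_or_pos m with rfl | hm
      · simp
      · field_simp
    have hS' : m * s ^ 2 ≤ m * (s * (empErr S w - err D w)) - m * s ^ 2 := hS
    show m * s ^ 2 ≤ ∑ i, (s * ((if sgn (inner ℝ w (S i).1) ≠ (S i).2 then (1 : ℝ) else 0) -
      err D w) - s ^ 2)
    rw [Finset.sum_sub_distrib, ← Finset.mul_sum, Finset.sum_sub_distrib, ← hcard]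
    simp only [Finset.sum_const, Finset.card_univ, Fintype.card_fin, nsmul_eq_mul]
    linarith
  · have h : Measurable fun p : Example d =>
        if sgn (inner ℝ w p.1) ≠ p.2 then (1 : ℝ) else 0 :=
      Measurable.ite (measurableSet_misclassified w) measurable_const measurable_const
    exact ((h.sub_const _).const_mul s).sub_const _

lemma pi_err_add_le_empErr_le (w : Vec d) {τ : ℝ} (h0 : 0 ≤ τ) (h2 : τ ≤ 2) :
    Measure.pi (fun _ : Fin m => D) {S | err D w + τ ≤ empErr S w} ≤
      ENNReal.ofReal (Real.exp (-(m * τ ^ 2 / 4))) := by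
  have h := pi_le_sum_misclassified_le (m := m) (D := D) w (s := τ / 2)
    (by rw [abs_of_nonneg (by positivity)]; linarith)
  rw [show (m : ℝ) * (τ / 2) ^ 2 = m * τ ^ 2 / 4 by ring] at h
  refine (measure_mono fun S hS => ?_).trans h
  have hS' : err D w + τ ≤ empErr S w := hS
  have : 0 ≤ m * (τ / 2 * (empErr S w - err D w - τ)) :=
    mul_nonneg (Nat.cast_nonneg _) (mul_nonneg (by linarith) (by linarith))
  show m * τ ^ 2 / 4 ≤ m * (τ / 2 * (empErr S w - err D w)) - m * τ ^ 2 / 4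
  linarith

lemma pi_empErr_le_err_sub_le (w : Vec d) {τ : ℝ} (h0 : 0 ≤ τ) (h2 : τ ≤ 2) :
    Measure.pi (fun _ : Fin m => D) {S | empErr S w ≤ err D w - τ} ≤
      ENNReal.ofReal (Real.exp (-(m * τ ^ 2 / 4))) := by
  have h := pi_le_sum_misclassified_le (m := m) (D := D) w (s := -(τ / 2))
    (by rw [abs_neg, abs_of_nonneg (by positivity)]; linarith)
  rw [show (m : ℝ) * (-(τ / 2)) ^ 2 = m * τ ^ 2 / 4 by ring] at h
  refine (measure_mono fun S hS => ?_).trans h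
  have hS' : empErr S w ≤ err D w - τ := hS
  have : 0 ≤ m * (τ / 2 * (err D w - τ - empErr S w)) :=
    mul_nonneg (Nat.cast_nonneg _) (mul_nonneg (by linarith) (by linarith))
  show m * τ ^ 2 / 4 ≤ m * (-(τ / 2) * (empErr S w - err D w)) - m * τ ^ 2 / 4
  linarith

end Empirical

/-! ### Deviations of the loss of the target on slabs -/

/-- A score of an example whose exponential has mean at most one, and whose sum over a heavy slab
is large unless the slab loss of `wstar` is below `-(3 / 4) * ε * γ`. -/
noncomputable def slabScore {d : ℕ} (ε γ lam : ℝ) (wstar : Vec d) (p : Example d) : ℝ :=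
  ε / 8 * (((if sgn (inner ℝ wstar p.1) ≠ p.2 then 1 else 0) - lam) * |inner ℝ wstar p.1| +
    3 / 4 * ε * γ) + ε ^ 2 * γ / 64

lemma measurable_slabScore {d : ℕ} (ε γ lam : ℝ) (wstar : Vec d) :
    Measurable (slabScore ε γ lam wstar) := by
  have h : Measurable fun p : Example d =>
      if sgn (inner ℝ wstar p.1) ≠ p.2 then (1 : ℝ) else 0 :=
    Measurable.ite (measurableSet_misclassified wstar) measurable_const measurable_const
  have h' : Measurable fun p : Example d => |(inner ℝ wstar p.1 : ℝ)| := by fun_prop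
  exact ((((h.sub_const _).mul h').add_const _).const_mul _).add_const _

/-- At distance `a ≥ γ` from the boundary, the gain `ε * a` of the correct label over the noise
outweighs the second-order term of the exponential. -/
lemma slabScore_exp_moment_le {ε γ η f a : ℝ} (hε : 0 < ε) (hε1 : ε ≤ 1) (hη : η ≤ 1 / 2)
    (hf0 : 0 ≤ f) (hfη : f ≤ η) (hγ : 0 < γ) (ha : γ ≤ a) (ha1 : a ≤ 1) :
    (1 - f) * Real.exp (ε / 8 * ((0 - (η + ε)) * a + 3 / 4 * ε * γ) + ε ^ 2 * γ / 64) +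
      f * Real.exp (ε / 8 * ((1 - (η + ε)) * a + 3 / 4 * ε * γ) + ε ^ 2 * γ / 64) ≤ 1 := by
  set c := ε / 8 * ((0 - (η + ε)) * a + 3 / 4 * ε * γ) + ε ^ 2 * γ / 64 with hc
  set u := ε / 8 * a with hu
  have hu0 : 0 ≤ u := mul_nonneg (by positivity) (by linarith)
  have hu1 : u ≤ 1 := by nlinarith
  have hcu : ε / 8 * ((1 - (η + ε)) * a + 3 / 4 * ε * γ) + ε ^ 2 * γ / 64 = c + u := by
    rw [hc, hu]; ring
  have h1 := exp_le_one_add_add_sq (u := u) (by rwa [abs_of_nonneg hu0])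
  have h2 : (1 - f) + f * Real.exp u ≤ Real.exp (η * (u + u ^ 2)) := by
    have h3 := Real.add_one_le_exp (η * (u + u ^ 2))
    have h4 : f * (u + u ^ 2) ≤ η * (u + u ^ 2) :=
      mul_le_mul_of_nonneg_right hfη (by positivity)
    nlinarith [mul_le_mul_of_nonneg_left h1 hf0]
  have h5 : c + η * (u + u ^ 2) ≤ 0 := by
    have h6 : η * u ^ 2 ≤ ε ^ 2 * a / 128 := by
      have : u ^ 2 ≤ ε ^ 2 * a / 64 := by
        rw [hu]
        nlinarith [mul_nonneg (sq_nonneg ε) (mul_nonneg (by linarith : 0 ≤ a)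
          (by linarith : 0 ≤ 1 - a))]
      nlinarith [sq_nonneg u]
    have h7 : ε ^ 2 * γ ≤ ε ^ 2 * a := mul_le_mul_of_nonneg_left ha (sq_nonneg ε)
    have h8 : c + η * u = -(ε ^ 2 * a) / 8 + 7 / 64 * (ε ^ 2 * γ) := by rw [hc, hu]; ring
    have h9 : 0 ≤ ε ^ 2 * a := mul_nonneg (sq_nonneg ε) (by linarith)
    nlinarith
  rw [hcu, Real.exp_add c u]
  calc (1 - f) * Real.exp c + f * (Real.exp c * Real.exp u)
      = Real.exp c * ((1 - f) + f * Real.exp u) := by ring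
    _ ≤ Real.exp c * Real.exp (η * (u + u ^ 2)) :=
        mul_le_mul_of_nonneg_left h2 (Real.exp_pos c).le
    _ = Real.exp (c + η * (u + u ^ 2)) := (Real.exp_add _ _).symm
    _ ≤ 1 := Real.exp_le_one_iff.2 h5

section Slab

variable {d m : ℕ} {η γ ε : ℝ} {Dx : Measure (Vec d)} {flip : Vec d → ℝ} {wstar : Vec d}

lemma lintegral_exp_slabScore_le (h : IsMassartHalfspace η γ Dx flip wstar) (hε : 0 < ε)
    (hε1 : ε ≤ 1) (hη : η ≤ 1 / 2) (hγ : 0 < γ) (A : Set (Vec d)) [DecidablePred (· ∈ A)]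
    (hA : MeasurableSet A) :
    ∫⁻ p, ENNReal.ofReal (Real.exp (if p.1 ∈ A then slabScore ε γ (η + ε) wstar p else 0))
      ∂(massartLaw Dx flip wstar) ≤ 1 := by
  rw [← ENNReal.ofReal_one]
  refine lintegral_massartLaw_le h (by linarith) (Measurable.exp (Measurable.ite
    (measurable_fst hA) (measurable_slabScore _ _ _ _) measurable_const))
    (fun p => (Real.exp_pos _).le) ?_
  filter_upwards [h.norm_le_one, h.margin] with x hx hxγ
  by_cases hxA : x ∈ A
  · have ha1 : |inner ℝ wstar x| ≤ 1 := by
      refine (abs_real_inner_le_norm _ _).trans ?_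
      rw [h.norm_wstar, one_mul]
      exact hx
    have hne : sgn (inner ℝ wstar x) ≠ -sgn (inner ℝ wstar x) := by
      rcases Int.units_eq_one_or (sgn (inner ℝ wstar x)) with h | h <;> rw [h] <;> decide
    have := slabScore_exp_moment_le hε hε1 hη (h.flip_nonneg x) (h.flip_le x) hγ hxγ ha1
    simpa only [hxA, if_true, slabScore, ne_eq, not_true_eq_false, if_false, hne,
      not_false_eq_true] using this
  · simp [hxA]

/-- The failure of the sample `S` for the direction `w`: on the slab cut out by some candidate
radius, the scores of the target add up to a large number. The threshold is the contribution of the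
summand `ε ^ 2 * γ / 64` of the score on a slab with exactly `ε * m` points. -/
def IsBadSample {m : ℕ} (ε γ lam : ℝ) (wstar w : Vec d) (S : Fin m → Example d) : Prop :=
  ∃ o, ε ^ 3 * γ / 64 * m ≤ ∑ i, if |inner ℝ w (S i).1| < radius (fun i => |inner ℝ w (S i).1|) o
    then slabScore ε γ lam wstar (S i) else 0

lemma measurableSet_isBadSample (ε γ lam : ℝ) (wstar : Vec d) :
    MeasurableSet {p : (Fin m → Example d) × Vec d | IsBadSample ε γ lam wstar p.2 p.1} := by
  have hz : ∀ i, Measurable fun p : (Fin m → Example d) × Vec d =>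
      |(inner ℝ p.2 (p.1 i).1 : ℝ)| := fun i => by
    have : Measurable fun p : (Fin m → Example d) × Vec d => (p.1 i).1 := by fun_prop
    exact (Measurable.inner measurable_snd this).abs
  have hr : ∀ o, Measurable fun p : (Fin m → Example d) × Vec d =>
      radius (fun i => |(inner ℝ p.2 (p.1 i).1 : ℝ)|) o := by
    rintro (_ | i)
    · exact (Finset.measurable_sum _ fun i _ => hz i).add_const 1
    · exact hz i
  unfold IsBadSample
  rw [Set.ofPred_exists]
  refine MeasurableSet.iUnion fun o => measurableSet_le measurable_const ?_
  exact Finset.measurable_sum _ fun i _ => Measurable.ite (measurableSet_lt (hz i) (hr o))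
    ((measurable_slabScore _ _ _ _).comp ((measurable_pi_apply i).comp measurable_fst))
    measurable_const

/-- A union bound over the candidate radii. The radius given by an example is constant once
this example is fixed, and the example does not lie in its own slab. -/
lemma pi_isBadSample_le (h : IsMassartHalfspace η γ Dx flip wstar) (hε : 0 < ε)
    (hε1 : ε ≤ 1) (hη : η ≤ 1 / 2) (hγ : 0 < γ) (w : Vec d) :
    Measure.pi (fun _ : Fin m => massartLaw Dx flip wstar)
      {S | IsBadSample ε γ (η + ε) wstar w S} ≤
        (m + 1) * ENNReal.ofReal (Real.exp (-(ε ^ 3 * γ / 64 * m))) := by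
  classical
  have := isProbabilityMeasure_massartLaw h (by linarith)
  set D := massartLaw Dx flip wstar
  set k := ε ^ 3 * γ / 64 * m
  have hV := measurable_slabScore ε γ (η + ε) wstar
  have hz : ∀ i, Measurable fun S : Fin m → Example d => |(inner ℝ w (S i).1 : ℝ)| := fun i => by
    have : Measurable fun S : Fin m → Example d => (S i).1 := by fun_prop
    exact (Measurable.inner measurable_const this).abs
  have hA : ∀ r : ℝ, MeasurableSet {x : Vec d | |(inner ℝ w x : ℝ)| < r} := fun r =>
    measurableSet_lt (by fun_prop) measurable_const
  have hO : ∀ o : Option (Fin m), Measure.pi (fun _ : Fin m => D) {S | k ≤ ∑ i,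
      if |inner ℝ w (S i).1| < radius (fun i => |inner ℝ w (S i).1|) o
        then slabScore ε γ (η + ε) wstar (S i) else 0} ≤ ENNReal.ofReal (Real.exp (-k)) := by
    rintro (_ | j)
    · refine (measure_mono fun S hS => ?_).trans (pi_le_sum_le_exp (μ := D)
        (f := fun (_ : Fin m) p => if p.1 ∈ Set.univ then slabScore ε γ (η + ε) wstar p else 0)
        (fun _ => by simpa using hV)
        (fun _ => lintegral_exp_slabScore_le h hε hε1 hη hγ _ MeasurableSet.univ) k)
      refine le_of_le_of_eq (show k ≤ _ from hS) (Finset.sum_congr rfl fun i _ => ?_)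
      rw [if_pos (lt_radius_none (z := fun i => |inner ℝ w (S i).1|) (fun i => abs_nonneg _) i),
        if_pos (Set.mem_univ _)]
    · refine pi_le_of_forall_value ?_ j fun x => ?_
      · exact measurableSet_le measurable_const (Finset.measurable_sum _ fun i _ =>
          Measurable.ite (measurableSet_lt (hz i) (hz j)) (hV.comp (measurable_pi_apply i))
            measurable_const)
      · -- With example `j` fixed, its score is left out; the others have a slab of constant radius.
        refine (measure_mono fun S hS => ?_).trans (pi_le_sum_le_exp (μ := D)
          (f := fun (i : Fin m) p =>
            if p.1 ∈ {y : Vec d | i ≠ j ∧ |(inner ℝ w y : ℝ)| < |inner ℝ w x.1|}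
            then slabScore ε γ (η + ε) wstar p else 0)
          (fun i => ?_) (fun i => lintegral_exp_slabScore_le h hε hε1 hη hγ _ ?_) k)
        · refine le_of_le_of_eq (show k ≤ _ from hS) (Finset.sum_congr rfl fun i _ => ?_)
          by_cases hi : i = j
          · subst hi
            simp [radius]
          · simp [radius, hi]
        · exact Measurable.ite (measurable_fst ((MeasurableSet.const _).inter (hA _))) hV
            measurable_const
        · exact (MeasurableSet.const _).inter (hA _)
  unfold IsBadSample
  rw [Set.ofPred_exists]
  refine (measure_iUnion_le _).trans ((ENNReal.tsum_le_tsum hO).trans ?_)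
  rw [tsum_fintype, Finset.sum_const, Finset.card_univ, Fintype.card_option, Fintype.card_fin,
    nsmul_eq_mul]
  push_cast
  rfl

lemma slabLoss_le_of_not_isBadSample {lam : ℝ} (hε : 0 < ε) (hγ : 0 < γ) {w : Vec d}
    {S : Fin m → Example d}
    (hS : ¬ IsBadSample ε γ lam wstar w S) {r : ℝ} (hr : r ∈ heavyRadii ε S w) :
    slabLoss lam S w r wstar ≤ -(3 / 4 * ε * γ) := by
  obtain ⟨o, ho⟩ := exists_radius_filter_eq (z := fun i => |inner ℝ w (S i).1|)
    (fun i => abs_nonneg _) r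
  unfold IsBadSample at hS
  push Not at hS
  have h1 := hS o
  have hm : (0 : ℝ) < m := by
    rcases Nat.eq_zero_or_pos m with rfl | hm
    · have := hr.2
      simp at this
      linarith
    · exact_mod_cast hm
  have hcard : ε * m ≤ (slab S w r).card := by
    rw [← le_div_iff₀ hm]; exact hr.2
  have hcard0 : (0 : ℝ) < (slab S w r).card := (mul_pos hε hm).trans_le hcard
  rw [← Finset.sum_filter, ho] at h1
  change ∑ i ∈ slab S w r, slabScore ε γ lam wstar (S i) < _ at h1
  unfold slabLoss
  rw [div_le_iff₀ hcard0]
  simp_rw [leakyRelu_neg_labelVal_mul]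
  simp only [slabScore, Finset.sum_add_distrib, ← Finset.mul_sum, Finset.sum_const,
    nsmul_eq_mul] at h1
  have h2 : ε ^ 3 * γ / 64 * m ≤ (slab S w r).card * (ε ^ 2 * γ / 64) := by
    nlinarith [mul_le_mul_of_nonneg_left hcard (by positivity : 0 ≤ ε ^ 2 * γ / 64)]
  by_contra! hlt
  have h3 : ε / 8 * (∑ i ∈ slab S w r, ((if sgn (inner ℝ wstar (S i).1) ≠ (S i).2 then 1 else 0) -
      lam) * |inner ℝ wstar (S i).1| + (slab S w r).card * (3 / 4 * ε * γ)) < 0 := by linarith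
  exact absurd h3 (not_lt.2 (mul_nonneg (by positivity) (by linarith)))

end Slab

end MassartHalfspace

namespace MassartHalfspace

/-! ### The iterates of FilterTron -/

/-- The vector after `n` updates, when the test set is ignored and no round stops the loop. It is
constant after the last round. -/
noncomputable def iterate {d m T : ℕ} (F : (Fin m → Example d) → Vec d → Vec d) (w₁ : Vec d)
    (train : Fin T → Fin m → Example d) : ℕ → Vec d
  | 0 => w₁
  | n + 1 =>
    if h : n < T then
      projBall (iterate F w₁ train n -
        (1 / Real.sqrt (n + 1 : ℕ)) • F (train ⟨n, h⟩) (iterate F w₁ train n))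
    else iterate F w₁ train n

section Iterate

variable {d m₀ m T : ℕ} {F : (Fin m → Example d) → Vec d → Vec d} {w₁ : Vec d}

lemma iterate_update_of_le (train : Fin T → Fin m → Example d) (j : Fin T)
    (S : Fin m → Example d) {n : ℕ} (hn : n ≤ j) :
    iterate F w₁ (Function.update train j S) n = iterate F w₁ train n := by
  induction n with
  | zero => rfl
  | succ n ih =>
    have hne : ∀ h : n < T, (⟨n, h⟩ : Fin T) ≠ j := fun h he => by
      rw [← he] at hn
      exact absurd hn (Nat.not_succ_le_self n)
    simp only [iterate, ih (Nat.le_of_succ_le hn)]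
    split_ifs with h
    · rw [Function.update_of_ne (hne h)]
    · rfl

lemma measurable_projBall : Measurable (projBall : Vec d → Vec d) := by
  have h : Measurable fun u : Vec d => (max 1 ‖u‖)⁻¹ :=
    (measurable_const.max measurable_norm).inv
  exact h.smul measurable_id

lemma measurable_iterate
    (hF : Measurable fun p : (Fin m → Example d) × Vec d => F p.1 p.2) (n : ℕ) :
    Measurable fun train : Fin T → Fin m → Example d => iterate F w₁ train n := by
  induction n with
  | zero => exact measurable_const
  | succ n ih =>
    by_cases h : n < T
    · simp only [iterate, h, dite_true]
      have hg : Measurable fun train : Fin T → Fin m → Example d =>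
          F (train ⟨n, h⟩) (iterate F w₁ train n) :=
        hF.comp ((measurable_pi_apply (⟨n, h⟩ : Fin T)).prodMk ih)
      exact measurable_projBall.comp (ih.sub (hg.const_smul (1 / Real.sqrt (n + 1 : ℕ))))
    · simpa only [iterate, h, dite_false] using ih

/-- The loop, entered after `n` updates, either returns one of the iterates, which passes the test,
or all remaining iterates fail it. -/
lemma filterTronLoop_iterate (ε η : ℝ) (test : Fin m₀ → Example d)
    (train : Fin T → Fin m → Example d) {n : ℕ} (hn : n ≤ T) :
    (∃ k < T, filterTronLoop ε η F test (n + 1) ((List.ofFn train).drop n)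
        (iterate F w₁ train n) = some (iterate F w₁ train k) ∧
        empErr test (iterate F w₁ train k) < η + ε / 2) ∨
      ∀ k < T, n ≤ k → ¬ empErr test (iterate F w₁ train k) < η + ε / 2 := by
  induction hk : T - n generalizing n with
  | zero => exact .inr fun k hk' hnk => by omega
  | succ l ih =>
    have hnT : n < T := by omega
    rw [List.drop_eq_getElem_cons (by simpa using hnT), List.getElem_ofFn, filterTronLoop]
    by_cases hlt : empErr test (iterate F w₁ train n) < η + ε / 2
    · exact .inl ⟨n, hnT, if_pos hlt, hlt⟩
    · rw [if_neg hlt]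
      have hstep : projBall (iterate F w₁ train n - (1 / Real.sqrt (n + 1 : ℕ)) •
          F (train ⟨n, hnT⟩) (iterate F w₁ train n)) = iterate F w₁ train (n + 1) := by
        rw [iterate, dif_pos hnT]
      rw [hstep]
      refine (ih hnT (by omega)).imp id fun h k hkT hnk => ?_
      rcases hnk.eq_or_lt with rfl | hlt'
      · exact hlt
      · exact h k hkT hlt'

end Iterate

/-! ### The learning guarantee -/

section Learning

variable {d m₀ m T : ℕ} {η γ ε : ℝ} {Dx : Measure (Vec d)} {flip : Vec d → ℝ} {wstar : Vec d}
  {F : (Fin m → Example d) → Vec d → Vec d}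

/-- The test set misjudges `w`. The errors `η + ε / 3`, `η + 5 / 12 * ε` and `η + ε / 2` are
`ε / 12` apart, so that an iterate failing the test has a true error above the second number, and
an error above the first one on its training sample. -/
def TestFails {d m₀ : ℕ} (D : Measure (Example d)) (ε η : ℝ) (test : Fin m₀ → Example d)
    (w : Vec d) : Prop :=
  (η + ε < err D w ∧ empErr test w < η + ε / 2) ∨
    (err D w ≤ η + 5 / 12 * ε ∧ η + ε / 2 ≤ empErr test w)

/-- The training sample `S` may fail to yield a descent direction at `w`: it underestimates the
error of `w`, the loss of the target is too large on some slab, or an example lies outside the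
ball. -/
def TrainFails {d m : ℕ} (D : Measure (Example d)) (ε η γ : ℝ) (wstar : Vec d)
    (S : Fin m → Example d) (w : Vec d) : Prop :=
  ((η + 5 / 12 * ε < err D w ∧ empErr S w < η + ε / 3) ∨
    IsBadSample (ε / 6) γ (η + ε / 6) wstar w S) ∨ ∃ i, ¬ ‖(S i).1‖ ≤ 1

/-- If neither the test set nor a training sample fails, FilterTron succeeds: without a return,
all oracle answers would be descent directions towards `wstar`, for too many rounds. -/
lemma exists_filterTron_eq_some {D : Measure (Example d)} (hε : 0 < ε) (hε1 : ε ≤ 1)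
    (hη0 : 0 ≤ η) (hγ : 0 < γ) (hγ1 : γ ≤ 1) (hm : 0 < m)
    (hT : 145 / (γ ^ 2 * ε ^ 2) ≤ T) (hwstar : ‖wstar‖ = 1)
    (hF : IsFindDescentDirection (ε / 6) (η + ε / 6) F) {w₁ : Vec d} (hw₁ : ‖w₁‖ ≤ 1)
    (test : Fin m₀ → Example d) (train : Fin T → Fin m → Example d)
    (htest : ∀ k : Fin T, ¬ TestFails D ε η test (iterate F w₁ train k))
    (htrain : ∀ k : Fin T, ¬ TrainFails D ε η γ wstar (train k) (iterate F w₁ train k)) :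
    ∃ w, filterTron ε η F w₁ test train = some w ∧ err D w ≤ η + ε := by
  unfold TestFails at htest
  unfold TrainFails at htrain
  push Not at htest htrain
  rcases filterTronLoop_iterate (F := F) (w₁ := w₁) ε η test train (Nat.zero_le T) with
    ⟨k, hk, hsome, hlt⟩ | hnone
  · refine ⟨_, hsome, ?_⟩
    by_contra! h
    exact absurd hlt (not_lt.2 ((htest ⟨k, hk⟩).1 h))
  · exfalso
    have hmain : ∀ k (hk : k < T),
        0 ≤ inner ℝ (F (train ⟨k, hk⟩) (iterate F w₁ train k)) (iterate F w₁ train k) ∧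
        inner ℝ (F (train ⟨k, hk⟩) (iterate F w₁ train k)) wstar ≤ -(γ * ε / 8) ∧
        ‖F (train ⟨k, hk⟩) (iterate F w₁ train k)‖ ≤ 1 := by
      intro k hk
      obtain ⟨⟨h1, h2⟩, h3⟩ := htrain ⟨k, hk⟩
      have h4 := not_lt.1 (hnone k hk (Nat.zero_le k))
      have h5 : η + 5 / 12 * ε < err D (iterate F w₁ train k) := by
        by_contra! h
        exact absurd h4 (not_le.2 ((htest ⟨k, hk⟩).2 h))
      obtain ⟨r, hr, hmax, hg⟩ := hF.spec (train ⟨k, hk⟩) (iterate F w₁ train k)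
      refine ⟨?_, ?_, hg.norm_le_one (by positivity) h3⟩
      · obtain ⟨r', hr', hpos⟩ := exists_heavyRadii_slabLoss_nonneg (ε := ε / 6)
          (lam := η + ε / 6) hm (by positivity)
          (by positivity) (train ⟨k, hk⟩) (iterate F w₁ train k) (by linarith [h1 h5])
        rw [hg.inner_self]
        exact hpos.trans (hmax r' hr')
      · refine (hg.inner_le wstar).trans ?_
        have := slabLoss_le_of_not_isBadSample (by positivity) hγ h2 hr
        linarith
    refine projBall_iteration_bound hwstar (Δ := γ * ε / 8) (by positivity) (by nlinarith)
      (T := T) ?_ (fun t => iterate F w₁ train (t - 1))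
      -- Rounds are counted from one, updates from zero.
      (fun t => if h : t - 1 < T then F (train ⟨t - 1, h⟩) (iterate F w₁ train (t - 1)) else 0)
      hw₁ ?_ ?_ ?_ ?_
    · refine le_of_eq_of_le ?_ hT
      field_simp
      norm_num
    · intro t h1 hT
      obtain ⟨t, rfl⟩ := Nat.exists_eq_add_of_le' h1
      have ht : t < T := hT
      simp only [Nat.add_sub_cancel, ht, dite_true]
      rw [iterate, dif_pos ht]
      rfl
    all_goals
      intro t h1 hT
      have ht : t - 1 < T := by omega
      simp only [ht, dite_true]
    · exact (hmain _ ht).1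
    · exact (hmain _ ht).2.1
    · exact (hmain _ ht).2.2

lemma measurable_empErr :
    Measurable fun p : (Fin m → Example d) × Vec d => empErr p.1 p.2 := by
  unfold empErr
  simp_rw [Finset.card_filter, Nat.cast_sum, Nat.cast_ite]
  refine (Finset.measurable_sum _ fun i _ => Measurable.ite ?_ measurable_const
    measurable_const).div_const _
  have h1 : Measurable fun p : (Fin m → Example d) × Vec d => (p.1 i).1 := by fun_prop
  have h2 : Measurable fun p : (Fin m → Example d) × Vec d => (p.1 i).2 := by fun_prop
  exact measurableSet_sgn_ne (measurable_snd.inner h1) h2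

lemma measurable_err (D : Measure (Example d)) [IsProbabilityMeasure D] : Measurable (err D) := by
  have h : MeasurableSet {p : Vec d × Example d | sgn (inner ℝ p.1 p.2.1) ≠ p.2.2} :=
    measurableSet_sgn_ne (measurable_fst.inner (measurable_fst.comp measurable_snd))
      (measurable_snd.comp measurable_snd)
  exact (measurable_measure_prodMk_left h).ennreal_toReal

lemma measurableSet_testFails (D : Measure (Example d)) [IsProbabilityMeasure D] :
    MeasurableSet {p : (Fin m → Example d) × Vec d | TestFails D ε η p.1 p.2} := by
  have h1 : Measurable fun p : (Fin m → Example d) × Vec d => err D p.2 :=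
    (measurable_err D).comp measurable_snd
  exact ((measurableSet_lt measurable_const h1).inter
    (measurableSet_lt measurable_empErr measurable_const)).union
    ((measurableSet_le h1 measurable_const).inter
      (measurableSet_le measurable_const measurable_empErr))

lemma measurableSet_trainFails (D : Measure (Example d)) [IsProbabilityMeasure D] :
    MeasurableSet {p : (Fin m → Example d) × Vec d | TrainFails D ε η γ wstar p.1 p.2} := by
  have h1 : Measurable fun p : (Fin m → Example d) × Vec d => err D p.2 :=
    (measurable_err D).comp measurable_snd
  have h2 : ∀ i, Measurable fun p : (Fin m → Example d) × Vec d => ‖(p.1 i).1‖ := fun i => by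
    fun_prop
  have h3 : MeasurableSet {p : (Fin m → Example d) × Vec d | ∃ i, ¬ ‖(p.1 i).1‖ ≤ 1} := by
    rw [Set.ofPred_exists]
    exact MeasurableSet.iUnion fun i => (measurableSet_le (h2 i) measurable_const).compl
  exact ((((measurableSet_lt measurable_const h1).inter
    (measurableSet_lt measurable_empErr measurable_const)).union
    (measurableSet_isBadSample _ _ _ _))).union h3

lemma pi_testFails_le {D : Measure (Example d)} [IsProbabilityMeasure D] (hε : 0 < ε)
    (hε1 : ε ≤ 1) (w : Vec d) :
    Measure.pi (fun _ : Fin m => D) {S | TestFails D ε η S w} ≤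
      ENNReal.ofReal (2 * Real.exp (-(m * ε ^ 2 / 576))) := by
  have h1 := pi_err_add_le_empErr_le (m := m) (D := D) w (τ := ε / 12) (by positivity) (by linarith)
  have h2 := pi_empErr_le_err_sub_le (m := m) (D := D) w (τ := ε / 12) (by positivity) (by linarith)
  rw [show (m : ℝ) * (ε / 12) ^ 2 / 4 = m * ε ^ 2 / 576 by ring] at h1 h2
  rw [two_mul, ENNReal.ofReal_add (Real.exp_pos _).le (Real.exp_pos _).le]
  refine (measure_mono fun S hS => ?_).trans ((measure_union_le _ _).trans (add_le_add h2 h1))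
  rcases hS with ⟨ha, hb⟩ | ⟨ha, hb⟩
  · refine Or.inl (show empErr S w ≤ err D w - ε / 12 from ?_)
    linarith
  · refine Or.inr (show err D w + ε / 12 ≤ empErr S w from ?_)
    linarith

/-- Almost surely all examples lie in the ball, so the last kind of failure does not contribute. -/
lemma pi_trainFails_le (h : IsMassartHalfspace η γ Dx flip wstar) (hε : 0 < ε)
    (hε1 : ε ≤ 1) (hη : η ≤ 1 / 2) (hγ : 0 < γ) (w : Vec d) :
    Measure.pi (fun _ : Fin m => massartLaw Dx flip wstar)
      {S | TrainFails (massartLaw Dx flip wstar) ε η γ wstar S w} ≤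
      ENNReal.ofReal (Real.exp (-(m * ε ^ 2 / 576)) +
        (m + 1) * Real.exp (-((ε / 6) ^ 3 * γ / 64 * m))) := by
  have := isProbabilityMeasure_massartLaw h (by linarith)
  have h1 := pi_empErr_le_err_sub_le (m := m) (D := massartLaw Dx flip wstar) w (τ := ε / 12)
    (by positivity) (by linarith)
  rw [show (m : ℝ) * (ε / 12) ^ 2 / 4 = m * ε ^ 2 / 576 by ring] at h1
  have h2 := pi_isBadSample_le (m := m) h (ε := ε / 6) (by positivity) (by linarith) hη hγ w
  have h3 : Measure.pi (fun _ : Fin m => massartLaw Dx flip wstar)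
      {S | ∃ i, ¬ ‖(S i).1‖ ≤ 1} = 0 := by
    rw [Set.ofPred_exists, measure_iUnion_null_iff]
    intro i
    exact (measurePreserving_eval (fun _ : Fin m => massartLaw Dx flip wstar)
      i).quasiMeasurePreserving.ae (ae_norm_le_one_massartLaw h)
  have h4 : ENNReal.ofReal ((m + 1) * Real.exp (-((ε / 6) ^ 3 * γ / 64 * m))) =
      (m + 1) * ENNReal.ofReal (Real.exp (-((ε / 6) ^ 3 * γ / 64 * m))) := by
    rw [ENNReal.ofReal_mul (by positivity)]
    congr 1
    exact_mod_cast ENNReal.ofReal_natCast (m + 1)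
  rw [ENNReal.ofReal_add (Real.exp_pos _).le (by positivity), h4]
  refine (measure_mono (t := {S | empErr S w ≤ err (massartLaw Dx flip wstar) w - ε / 12} ∪
    {S | IsBadSample (ε / 6) γ (η + ε / 6) wstar w S} ∪ {S | ∃ i, ¬ ‖(S i).1‖ ≤ 1})
    fun S hS => ?_).trans ((measure_union_le _ _).trans ?_)
  · refine hS.imp_left (Or.imp_left fun hab => ?_)
    show empErr S w ≤ err (massartLaw Dx flip wstar) w - ε / 12
    linarith [hab.1, hab.2]
  · rw [h3, add_zero]
    exact (measure_union_le _ _).trans (add_le_add h1 h2)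

section Sampling

variable {D : Measure (Example d)} [IsProbabilityMeasure D]

/-- The training samples are independent of the test set. -/
lemma sampleLaw_test_le {B : Set ((Fin m₀ → Example d) × Vec d)} (hB : MeasurableSet B)
    {β : ENNReal} (h : ∀ w, Measure.pi (fun _ : Fin m₀ => D) {S | (S, w) ∈ B} ≤ β)
    {W : (Fin T → Fin m → Example d) → Vec d} (hW : Measurable W) :
    sampleLaw D m₀ m T {s | (s.1, W s.2) ∈ B} ≤ β := by
  have hmeas : MeasurableSet {s : (Fin m₀ → Example d) × (Fin T → Fin m → Example d) |
      (s.1, W s.2) ∈ B} := (measurable_fst.prodMk (hW.comp measurable_snd)) hB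
  rw [sampleLaw, Measure.prod_apply_symm hmeas]
  refine (lintegral_mono fun S => h (W S)).trans ?_
  simp

/-- The training sample of a round is independent of the iterate of this round. -/
lemma sampleLaw_train_le {B : Set ((Fin m → Example d) × Vec d)} (hB : MeasurableSet B)
    {β : ENNReal} (h : ∀ w, Measure.pi (fun _ : Fin m => D) {S | (S, w) ∈ B} ≤ β)
    {w₁ : Vec d} (hF : Measurable fun p : (Fin m → Example d) × Vec d => F p.1 p.2)
    (k : Fin T) : sampleLaw D m₀ m T {s | (s.2 k, iterate F w₁ s.2 k) ∈ B} ≤ β := by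
  have hmeas : MeasurableSet {S : Fin T → Fin m → Example d | (S k, iterate F w₁ S k) ∈ B} :=
    ((measurable_pi_apply k).prodMk (measurable_iterate hF k)) hB
  have : {s : (Fin m₀ → Example d) × (Fin T → Fin m → Example d) |
      (s.2 k, iterate F w₁ s.2 k) ∈ B} =
      Set.univ ×ˢ {S : Fin T → Fin m → Example d | (S k, iterate F w₁ S k) ∈ B} := by
    ext s
    simp
  rw [this, sampleLaw, Measure.prod_prod, measure_univ, one_mul]
  refine pi_le_of_forall_update hmeas k fun S => ?_
  refine le_trans (measure_mono fun x hx => ?_) (h (iterate F w₁ S k))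
  have hx' : (Function.update S k x k, iterate F w₁ (Function.update S k x) k) ∈ B := hx
  rw [iterate_update_of_le S k x le_rfl, Function.update_self] at hx'
  exact hx'

end Sampling

lemma sampleLaw_filterTron_fails_le (h : IsMassartHalfspace η γ Dx flip wstar) (hε : 0 < ε)
    (hε1 : ε ≤ 1) (hη0 : 0 ≤ η) (hη : η ≤ 1 / 2) (hγ : 0 < γ) (hγ1 : γ ≤ 1) (hm : 0 < m)
    (hT : 145 / (γ ^ 2 * ε ^ 2) ≤ T)
    (hF : IsFindDescentDirection (ε / 6) (η + ε / 6) F) {w₁ : Vec d} (hw₁ : ‖w₁‖ ≤ 1) :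
    sampleLaw (massartLaw Dx flip wstar) m₀ m T
        {s | ¬ ∃ w, filterTron ε η F w₁ s.1 s.2 = some w ∧
          err (massartLaw Dx flip wstar) w ≤ η + ε} ≤
      ENNReal.ofReal (T * (2 * Real.exp (-(m₀ * ε ^ 2 / 576)) + (Real.exp (-(m * ε ^ 2 / 576)) +
        (m + 1) * Real.exp (-((ε / 6) ^ 3 * γ / 64 * m))))) := by
  have := isProbabilityMeasure_massartLaw h (by linarith)
  set D := massartLaw Dx flip wstar
  refine (measure_mono (t := ⋃ k : Fin T,
    ({s | (s.1, iterate F w₁ s.2 k) ∈ {p | TestFails D ε η p.1 p.2}} ∪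
      {s | (s.2 k, iterate F w₁ s.2 k) ∈ {p | TrainFails D ε η γ wstar p.1 p.2}}))
    fun s hs => ?_).trans ?_
  · by_contra hgood
    simp only [Set.mem_iUnion, not_exists, Set.mem_union, not_or] at hgood
    exact hs (exists_filterTron_eq_some hε hε1 hη0 hγ hγ1 hm hT h.norm_wstar hF hw₁ s.1 s.2
      (fun k => (hgood k).1) fun k => (hgood k).2)
  · refine (measure_iUnion_fintype_le _ _).trans ((Finset.sum_le_sum fun (k : Fin T) _ =>
      (measure_union_le _ _).trans (add_le_add
        (sampleLaw_test_le (measurableSet_testFails D) (pi_testFails_le hε hε1)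
          (measurable_iterate hF.measurable k))
        (sampleLaw_train_le (measurableSet_trainFails D) (pi_trainFails_le h hε hε1 hη hγ)
          hF.measurable k))).trans ?_)
    rw [Finset.sum_const, Finset.card_univ, Fintype.card_fin, nsmul_eq_mul,
      ← ENNReal.ofReal_add (by positivity) (by positivity), ENNReal.ofReal_mul (by positivity),
      ENNReal.ofReal_natCast]

end Learning

end MassartHalfspace

namespace MassartHalfspace

/-! ### Sample sizes -/

section Sizes

variable {ε δ γ : ℝ}

lemma le_rounds (ε γ : ℝ) : 145 / (γ ^ 2 * ε ^ 2) ≤ rounds ε γ := Nat.le_ceil _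

lemma rounds_ge (hε : 0 < ε) (hε1 : ε ≤ 1) (hγ : 0 < γ) (hγ1 : γ ≤ 1) :
    (145 : ℝ) ≤ rounds ε γ := by
  refine le_trans ?_ (le_rounds ε γ)
  rw [le_div_iff₀ (by positivity)]
  have h1 : γ ^ 2 ≤ 1 := pow_le_one₀ hγ.le hγ1
  have h2 : ε ^ 2 ≤ 1 := pow_le_one₀ hε.le hε1
  nlinarith [mul_le_one₀ h1 (sq_nonneg ε) h2]

lemma rounds_le (hε : 0 < ε) (hε1 : ε ≤ 1) (hγ : 0 < γ) (hγ1 : γ ≤ 1) :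
    (rounds ε γ : ℝ) ≤ 146 / (γ ^ 2 * ε ^ 2) := by
  have h := (Nat.ceil_lt_add_one (by positivity : 0 ≤ 145 / (γ ^ 2 * ε ^ 2))).le
  have h1 : (1 : ℝ) ≤ 1 / (γ ^ 2 * ε ^ 2) := by
    rw [le_div_iff₀ (by positivity), one_mul]
    exact mul_le_one₀ (pow_le_one₀ hγ.le hγ1) (sq_nonneg ε) (pow_le_one₀ hε.le hε1)
  calc (rounds ε γ : ℝ) ≤ 145 / (γ ^ 2 * ε ^ 2) + 1 := h
    _ ≤ 145 / (γ ^ 2 * ε ^ 2) + 1 / (γ ^ 2 * ε ^ 2) := by linarith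
    _ = 146 / (γ ^ 2 * ε ^ 2) := by ring

/-- Since `4 * T / δ ≤ 584 / (δ * (γ * ε) ^ 2)`, the tenth power of `2 / (δ * γ * ε)` dominates. -/
lemma log_four_mul_rounds_le (hε : 0 < ε) (hε1 : ε ≤ 1) (hδ : 0 < δ) (hδ1 : δ < 1) (hγ : 0 < γ)
    (hγ1 : γ ≤ 1) : Real.log (4 * rounds ε γ / δ) ≤ 10 * Real.log (2 / (δ * γ * ε)) := by
  have hT := rounds_ge hε hε1 hγ hγ1
  rw [show (10 : ℝ) = (10 : ℕ) by norm_num, ← Real.log_pow]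
  refine Real.log_le_log (by positivity) ?_
  have hx : δ * γ * ε ≤ 1 :=
    mul_le_one₀ (mul_le_one₀ hδ1.le hγ.le hγ1) hε.le hε1
  have h1 : (δ * γ * ε) ^ 10 ≤ γ ^ 2 * ε ^ 2 * δ := by
    calc (δ * γ * ε) ^ 10 ≤ (δ * γ * ε) ^ 2 := pow_le_pow_of_le_one (by positivity) hx (by norm_num)
      _ = γ ^ 2 * ε ^ 2 * δ * δ := by ring
      _ ≤ γ ^ 2 * ε ^ 2 * δ * 1 := by gcongr
      _ = γ ^ 2 * ε ^ 2 * δ := mul_one _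
  calc 4 * rounds ε γ / δ ≤ 4 * (146 / (γ ^ 2 * ε ^ 2)) / δ := by
        have := rounds_le hε hε1 hγ hγ1
        gcongr
    _ = 584 / (γ ^ 2 * ε ^ 2 * δ) := by field_simp; norm_num
    _ ≤ 1024 / (δ * γ * ε) ^ 10 := by gcongr; norm_num
    _ = (2 / (δ * γ * ε)) ^ 10 := by rw [div_pow]; norm_num

lemma half_le_log (hε : 0 < ε) (hε1 : ε ≤ 1) (hδ : 0 < δ) (hδ1 : δ < 1) (hγ : 0 < γ)
    (hγ1 : γ ≤ 1) : 1 / 2 ≤ Real.log (2 / (δ * γ * ε)) := by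
  have hx : δ * γ * ε ≤ 1 :=
    mul_le_one₀ (mul_le_one₀ hδ1.le hγ.le hγ1) hε.le hε1
  have : Real.log 2 ≤ Real.log (2 / (δ * γ * ε)) := by
    refine Real.log_le_log (by norm_num) ?_
    rw [le_div_iff₀ (by positivity)]
    linarith
  linarith [Real.log_two_gt_d9]

lemma two_div_confidence {T : ℝ} (hT : 0 < T) (hδ : 0 < δ) : 2 / (δ / (2 * T)) = 4 * T / δ := by
  field_simp
  norm_num

/-- The test set does not dominate the running time. -/
lemma testSize_le_oracleSize (hε : 0 < ε) (hε1 : ε ≤ 1) (hδ : 0 < δ) (hδ1 : δ < 1) (hγ : 0 < γ)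
    (hγ1 : γ ≤ 1) : testSize 1152 ε δ (rounds ε γ) ≤
      oracleSize 512 (ε / 6) (δ / (2 * rounds ε γ)) γ := by
  have hT := rounds_ge hε hε1 hγ hγ1
  refine Nat.ceil_mono ?_
  rw [two_div_confidence (by linarith) hδ]
  have h0 : 0 ≤ Real.log (rounds ε γ / δ) := by
    refine Real.log_nonneg ?_
    rw [le_div_iff₀ hδ]
    linarith
  have h1 : Real.log (rounds ε γ / δ) ≤ Real.log (4 * rounds ε γ / δ) := by
    refine Real.log_le_log (by positivity) ?_
    gcongr
    linarith
  have h2 : (ε / 6) ^ 3 * γ ^ 2 ≤ ε ^ 2 / 216 := by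
    have : γ ^ 2 ≤ 1 := pow_le_one₀ hγ.le hγ1
    calc (ε / 6) ^ 3 * γ ^ 2 = ε ^ 2 / 216 * (ε * γ ^ 2) := by ring
      _ ≤ ε ^ 2 / 216 * 1 := by
        gcongr
        exact mul_le_one₀ hε1 (sq_nonneg γ) this
      _ = ε ^ 2 / 216 := mul_one _
  calc 1152 * Real.log (rounds ε γ / δ) / ε ^ 2
      ≤ 512 * Real.log (4 * rounds ε γ / δ) / (ε ^ 2 / 216) := by
        rw [div_div_eq_mul_div]
        refine div_le_div_of_nonneg_right ?_ (sq_nonneg ε)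
        linarith
    _ ≤ 512 * Real.log (4 * rounds ε γ / δ) / ((ε / 6) ^ 3 * γ ^ 2) := by
        have : 0 ≤ Real.log (4 * rounds ε γ / δ) := h0.trans h1
        gcongr

lemma oracleSize_pos (hε : 0 < ε) (hε1 : ε ≤ 1) (hδ : 0 < δ) (hδ1 : δ < 1) (hγ : 0 < γ)
    (hγ1 : γ ≤ 1) : 0 < oracleSize 512 (ε / 6) (δ / (2 * rounds ε γ)) γ := by
  have hT := rounds_ge hε hε1 hγ hγ1
  refine Nat.ceil_pos.2 ?_
  rw [two_div_confidence (by linarith) hδ]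
  have : 0 < Real.log (4 * rounds ε γ / δ) := by
    refine Real.log_pos ?_
    rw [lt_div_iff₀ hδ]
    linarith
  positivity

lemma sampleSize_le (hε : 0 < ε) (hε1 : ε ≤ 1) (hδ : 0 < δ) (hδ1 : δ < 1) (hγ : 0 < γ)
    (hγ1 : γ ≤ 1) : ((testSize 1152 ε δ (rounds ε γ) +
      rounds ε γ * oracleSize 512 (ε / 6) (δ / (2 * rounds ε γ)) γ : ℕ) : ℝ) ≤
        10 ^ 9 * (Real.log (2 / (δ * γ * ε)) / (γ ^ 4 * ε ^ 5)) := by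
  have hT := rounds_ge hε hε1 hγ hγ1
  have hT2 := rounds_le hε hε1 hγ hγ1
  have hL := half_le_log hε hε1 hδ hδ1 hγ hγ1
  have hlog := log_four_mul_rounds_le hε hε1 hδ hδ1 hγ hγ1
  have hle : (testSize 1152 ε δ (rounds ε γ) : ℝ) ≤
      oracleSize 512 (ε / 6) (δ / (2 * rounds ε γ)) γ := by
    exact_mod_cast testSize_le_oracleSize hε hε1 hδ hδ1 hγ hγ1
  set L := Real.log (2 / (δ * γ * ε))
  have hm : (oracleSize 512 (ε / 6) (δ / (2 * rounds ε γ)) γ : ℝ) ≤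
      1105922 * L / (ε ^ 3 * γ ^ 2) := by
    have hlog0 : 0 ≤ Real.log (4 * rounds ε γ / δ) := by
      refine Real.log_nonneg ?_
      rw [le_div_iff₀ hδ]
      linarith
    have h := (Nat.ceil_lt_add_one (a := 512 * Real.log (2 / (δ / (2 * rounds ε γ))) /
      ((ε / 6) ^ 3 * γ ^ 2)) (by
        rw [two_div_confidence (by linarith) hδ]
        positivity)).le
    rw [two_div_confidence (by linarith) hδ] at h
    have h1 : (1 : ℝ) ≤ 2 * L / (ε ^ 3 * γ ^ 2) := by
      rw [le_div_iff₀ (by positivity)]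
      have := mul_le_one₀ (pow_le_one₀ hε.le hε1 (n := 3)) (sq_nonneg γ) (pow_le_one₀ hγ.le hγ1)
      linarith
    have h2 : 512 * Real.log (4 * rounds ε γ / δ) / ((ε / 6) ^ 3 * γ ^ 2) ≤
        512 * (10 * L) / ((ε / 6) ^ 3 * γ ^ 2) := by gcongr
    have h3 : 512 * (10 * L) / ((ε / 6) ^ 3 * γ ^ 2) + 2 * L / (ε ^ 3 * γ ^ 2) =
        1105922 * L / (ε ^ 3 * γ ^ 2) := by
      field_simp
      norm_num
    unfold oracleSize
    rw [two_div_confidence (by linarith) hδ]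
    linarith
  push_cast
  set M : ℝ := (oracleSize 512 (ε / 6) (δ / (2 * rounds ε γ)) γ : ℝ)
  have hM0 : 0 ≤ M := Nat.cast_nonneg _
  calc (testSize 1152 ε δ (rounds ε γ) : ℝ) + rounds ε γ * M
      ≤ 2 * (rounds ε γ * M) := by nlinarith
    _ ≤ 2 * (146 / (γ ^ 2 * ε ^ 2) * (1105922 * L / (ε ^ 3 * γ ^ 2))) := by gcongr
    _ = 322929224 * (L / (γ ^ 4 * ε ^ 5)) := by
        field_simp
        norm_num
    _ ≤ 10 ^ 9 * (L / (γ ^ 4 * ε ^ 5)) := by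
        gcongr
        norm_num

/-- The sample sizes make the failure bound of the learner at most `δ`. The factor `m + 1` is
absorbed by half of the exponent, at the price of `3 * T ^ 2`. -/
lemma failure_le (hε : 0 < ε) (hε1 : ε ≤ 1) (hδ : 0 < δ) (hδ1 : δ < 1) (hγ : 0 < γ)
    (hγ1 : γ ≤ 1) {T m₀ m : ℕ} (hT : T = rounds ε γ) (hm₀ : m₀ = testSize 1152 ε δ T)
    (hm : m = oracleSize 512 (ε / 6) (δ / (2 * T)) γ) :
    T * (2 * Real.exp (-(m₀ * ε ^ 2 / 576)) + (Real.exp (-(m * ε ^ 2 / 576)) +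
        (m + 1) * Real.exp (-((ε / 6) ^ 3 * γ / 64 * m)))) ≤ δ := by
  have hT1 : (145 : ℝ) ≤ T := hT ▸ rounds_ge hε hε1 hγ hγ1
  have hT0 : (0 : ℝ) < T := by linarith
  have hTr : 145 / (γ ^ 2 * ε ^ 2) ≤ T := hT ▸ le_rounds ε γ
  have hm1 : (1 : ℝ) ≤ m := by
    have := oracleSize_pos hε hε1 hδ hδ1 hγ hγ1
    rw [← hT, ← hm] at this
    exact_mod_cast this
  set x := δ / (4 * T) with hx
  have hx0 : 0 < x := by positivity
  have hx1 : x ≤ 1 := by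
    rw [hx, div_le_one (by positivity)]
    linarith
  have hlogx : Real.log (4 * T / δ) = -Real.log x := by
    rw [hx, ← Real.log_inv, inv_div]
  have hlx : Real.log x ≤ 0 := Real.log_nonpos hx0.le hx1
  have h1 : Real.exp (-(m₀ * ε ^ 2 / 576)) ≤ (δ / T) ^ 2 := by
    have h : 1152 * Real.log (T / δ) / ε ^ 2 ≤ m₀ := hm₀ ▸ Nat.le_ceil _
    rw [div_le_iff₀ (by positivity)] at h
    rw [← Real.exp_log (by positivity : 0 < (δ / T) ^ 2), Real.exp_le_exp, Real.log_pow,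
      ← inv_div (T : ℝ) δ, Real.log_inv]
    push_cast
    linarith
  have hmx : 512 * -Real.log x ≤ m * ((ε / 6) ^ 3 * γ ^ 2) := by
    have h : 512 * Real.log (2 / (δ / (2 * T))) / ((ε / 6) ^ 3 * γ ^ 2) ≤ m := hm ▸ Nat.le_ceil _
    rwa [div_le_iff₀ (by positivity), two_div_confidence hT0 hδ, hlogx] at h
  have h2 : Real.exp (-(m * ε ^ 2 / 576)) ≤ x := by
    rw [← Real.exp_log hx0, Real.exp_le_exp]
    have : (ε / 6) ^ 3 * γ ^ 2 ≤ ε ^ 2 / 216 := by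
      have hγ2 : γ ^ 2 ≤ 1 := pow_le_one₀ hγ.le hγ1
      have := mul_le_one₀ hε1 (sq_nonneg γ) hγ2
      nlinarith [sq_nonneg ε]
    have := mul_le_mul_of_nonneg_left this (by linarith : (0 : ℝ) ≤ m)
    linarith
  set ψ := (ε / 6) ^ 3 * γ / 64 with hψ
  have hψ0 : 0 < ψ := by positivity
  have h3 : Real.exp (-(ψ * m / 2)) ≤ x ^ 4 := by
    rw [← Real.exp_log (by positivity : 0 < x ^ 4), Real.exp_le_exp, Real.log_pow]
    have h4 : (ε / 6) ^ 3 * γ ^ 2 ≤ (ε / 6) ^ 3 * γ := by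
      have : γ ^ 2 ≤ γ := by nlinarith
      gcongr
    have := mul_le_mul_of_nonneg_left h4 (by linarith : (0 : ℝ) ≤ m)
    rw [hψ]
    push_cast
    linarith
  have h4 : (m + 1 : ℝ) ≤ 3 * T ^ 2 * Real.exp (ψ * m / 2) := by
    have h5 : ψ * m / 2 ≤ Real.exp (ψ * m / 2) := by linarith [Real.add_one_le_exp (ψ * m / 2)]
    have h6 : 4 ≤ 3 * T ^ 2 * ψ := by
      have h7 : (145 / (γ ^ 2 * ε ^ 2)) ^ 2 ≤ (T : ℝ) ^ 2 := by gcongr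
      have h8 : 21025 / (γ * ε ^ 3) ≤ (145 / (γ ^ 2 * ε ^ 2)) ^ 2 := by
        rw [div_pow]
        norm_num
        refine div_le_div_of_nonneg_left (by norm_num) (by positivity) ?_
        have hg : γ ^ 4 ≤ γ ^ 1 := pow_le_pow_of_le_one hγ.le hγ1 (by norm_num)
        have he : ε ^ 4 ≤ ε ^ 3 := pow_le_pow_of_le_one hε.le hε1 (by norm_num)
        calc (γ ^ 2 * ε ^ 2) ^ 2 = γ ^ 4 * ε ^ 4 := by ring
          _ ≤ γ ^ 1 * ε ^ 3 := by gcongr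
          _ = γ * ε ^ 3 := by ring
      calc (4 : ℝ) ≤ 3 * (21025 / (γ * ε ^ 3)) * ψ := by
            rw [hψ]
            field_simp
            norm_num
        _ ≤ 3 * T ^ 2 * ψ := by
            have := h8.trans h7
            gcongr
    have h9 : 4 * (m / 2) ≤ 3 * T ^ 2 * ψ * (m / 2) :=
      mul_le_mul_of_nonneg_right h6 (by linarith)
    calc (m + 1 : ℝ) ≤ 4 * (m / 2) := by linarith
      _ ≤ 3 * T ^ 2 * (ψ * m / 2) := by linarith
      _ ≤ 3 * T ^ 2 * Real.exp (ψ * m / 2) := by gcongr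
  have h5 : (m + 1) * Real.exp (-(ψ * m)) ≤ 3 * T ^ 2 * x ^ 4 := by
    calc (m + 1) * Real.exp (-(ψ * m))
        ≤ 3 * T ^ 2 * Real.exp (ψ * m / 2) * Real.exp (-(ψ * m)) := by gcongr
      _ = 3 * T ^ 2 * Real.exp (-(ψ * m / 2)) := by
          rw [mul_assoc, ← Real.exp_add]
          ring_nf
      _ ≤ 3 * T ^ 2 * x ^ 4 := by gcongr
  calc T * (2 * Real.exp (-(m₀ * ε ^ 2 / 576)) + (Real.exp (-(m * ε ^ 2 / 576)) +
        (m + 1) * Real.exp (-(ψ * m))))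
      ≤ T * (2 * (δ / T) ^ 2 + (x + 3 * T ^ 2 * x ^ 4)) := by gcongr
    _ = δ * (2 * (δ / T) + 1 / 4 + 3 / 256 * (δ ^ 2 * (δ / T))) := by
        rw [hx]
        field_simp
        ring
    _ ≤ δ * (2 * (1 / 145) + 1 / 4 + 3 / 256 * (1 * (1 / 145))) := by
        have h6 : δ / T ≤ 1 / 145 := by gcongr
        have h7 : δ ^ 2 ≤ 1 := pow_le_one₀ hδ.le hδ1.le
        gcongr
    _ ≤ δ * 1 := by
        gcongr
        norm_num
    _ = δ := mul_one _

end Sizes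

/-! ### Running time -/

lemma log2_succ_le {m n : ℕ} (hm : 0 < m) (hmn : m ≤ n) :
    ((Nat.log2 m + 1 : ℕ) : ℝ) ≤ 1 + 2 * Real.log n := by
  have h1 : ((2 ^ Nat.log2 m : ℕ) : ℝ) ≤ n := by
    exact_mod_cast (Nat.log2_self_le hm.ne').trans hmn
  have h2 := Real.log_le_log (by positivity) h1
  push_cast at h2 ⊢
  rw [Real.log_pow] at h2
  nlinarith [Real.log_two_gt_d9, (Nat.cast_nonneg (Nat.log2 m) : (0 : ℝ) ≤ _)]

/-- The step count of the program, in terms of the total number `n` of samples. -/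
lemma stepCount_le {d m₀ m T n : ℕ} (hd : 0 < d) (hT : 0 < T) (hm : 0 < m) (hm₀ : m₀ ≤ m)
    (hn : n = m₀ + T * m) :
    ((T * (m₀ * (8 * d + 13) + m * (18 * d + (Nat.log2 m + 1) * 58 + 76) + 23 * d + 73) +
      4 * (m₀ + m + T) + 23 : ℕ) : ℝ) ≤ 10 ^ 9 * (n * d + n * Real.log n) := by
  set N := Nat.log2 m + 1 with hN
  have hmn : m ≤ n := by nlinarith
  have hlog := log2_succ_le hm hmn
  rw [← hN] at hlog
  have hTm : T * m ≤ n := by omega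
  have h1 : T * (m₀ * (8 * d + 13) + m * (18 * d + N * 58 + 76) + 23 * d + 73) +
      4 * (m₀ + m + T) + 23 ≤ T * m * (246 * d + 58 * N) := by
    have a1 : m₀ * (8 * d + 13) ≤ m * (8 * d + 13) := Nat.mul_le_mul_right _ hm₀
    have a2 : 23 * d + 73 ≤ m * (23 * d + 73) := Nat.le_mul_of_pos_left _ hm
    have a3 : m ≤ T * m := Nat.le_mul_of_pos_left _ hT
    have a4 : T ≤ T * m := Nat.le_mul_of_pos_right _ hm
    have a5 : T * m ≤ T * m * d := Nat.le_mul_of_pos_right _ hd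
    have a6 : T * (m₀ * (8 * d + 13) + m * (18 * d + N * 58 + 76) + 23 * d + 73) ≤
        T * (m * (8 * d + 13) + m * (18 * d + N * 58 + 76) + m * (23 * d + 73)) :=
      Nat.mul_le_mul_left _ (by omega)
    have a7 : T * (m * (8 * d + 13) + m * (18 * d + N * 58 + 76) + m * (23 * d + 73)) =
        49 * (T * m * d) + 162 * (T * m) + 58 * (T * m * N) := by ring
    have a8 : T * m * (246 * d + 58 * N) = 246 * (T * m * d) + 58 * (T * m * N) := by ring
    omega
  have h2 : T * m * (246 * d + 58 * N) ≤ n * (246 * d + 58 * N) := Nat.mul_le_mul_right _ hTm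
  have h3 : ((n * (246 * d + 58 * N) : ℕ) : ℝ) ≤ 10 ^ 9 * (n * d + n * Real.log n) := by
    push_cast
    have hd1 : (1 : ℝ) ≤ d := by exact_mod_cast hd
    have hl : 0 ≤ Real.log n := Real.log_natCast_nonneg n
    calc (n : ℝ) * (246 * d + 58 * N) ≤ n * (10 ^ 9 * d + 10 ^ 9 * Real.log n) := by
          refine mul_le_mul_of_nonneg_left ?_ (Nat.cast_nonneg n)
          linarith
      _ = 10 ^ 9 * (n * d + n * Real.log n) := by ring
  exact (Nat.cast_le.2 (h1.trans h2)).trans h3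

end MassartHalfspace

theorem mainTheorem5 :
    ∃ (c₀ c₁ C : ℝ) (P : Prog), 0 < c₀ ∧ 0 < c₁ ∧ 0 < C ∧
      ∀ ε η δ γ : ℝ, 0 < ε → ε ≤ 1 → 0 ≤ η → η + ε / 6 ≤ 1 / 2 → 0 < δ → δ < 1 →
        0 < γ → γ ≤ 1 →
      ∀ (lam : ℝ) (T m₀ m n : ℕ), lam = η + ε / 6 → T = rounds ε γ →
        m₀ = testSize c₀ ε δ T → m = oracleSize c₁ (ε / 6) (δ / (2 * T)) γ →
        n = m₀ + T * m →
      -- the total number of samples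
      (n : ℝ) ≤ C * (Real.log (2 / (δ * γ * ε)) / (γ ^ 4 * ε ^ 5)) ∧
      -- the error guarantee, whatever the starting point and the implementation of the oracle
      (∀ (d : ℕ) (Dx : Measure (Vec d)) (flip : Vec d → ℝ) (wstar : Vec d),
        IsMassartHalfspace η γ Dx flip wstar →
        ∀ w₁ : Vec d, ‖w₁‖ ≤ 1 →
        ∀ F : (Fin m → Example d) → Vec d → Vec d, IsFindDescentDirection (ε / 6) lam F →
          sampleLaw (massartLaw Dx flip wstar) m₀ m T
            {s | ¬ ∃ w, filterTron ε η F w₁ s.1 s.2 = some w ∧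
              err (massartLaw Dx flip wstar) w ≤ η + ε} ≤ ENNReal.ofReal δ) ∧
      -- the running time of one fixed program
      (∀ d : ℕ, 0 < d →
        ∃ F : (Fin m → Example d) → Vec d → Vec d, IsFindDescentDirection (ε / 6) lam F ∧
          ∀ (w₁ : Vec d) (test : Fin m₀ → Example d) (train : Fin T → Fin m → Example d),
            ‖w₁‖ ≤ 1 →
            ∃ (k : ℕ) (σ : State), Exec P (inputState ε η lam w₁ test train) k σ ∧
              (k : ℝ) ≤ C * (n * d + n * Real.log n) ∧
              Represents σ (filterTron ε η F w₁ test train)) := by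
  refine ⟨1152, 512, 10 ^ 9, filterTronProg, by norm_num, by norm_num, by norm_num, ?_⟩
  intro ε η δ γ hε hε1 hη0 hηε hδ hδ1 hγ hγ1 lam T m₀ m n hlam hT hm₀ hm hn
  have hmpos : 0 < m := by
    rw [hm, hT]
    exact oracleSize_pos hε hε1 hδ hδ1 hγ hγ1
  have hm₀m : m₀ ≤ m := by
    rw [hm₀, hm, hT]
    exact testSize_le_oracleSize hε hε1 hδ hδ1 hγ hγ1
  have hTpos : 0 < T := by
    have := rounds_ge hε hε1 hγ hγ1
    rw [← hT] at this
    exact_mod_cast (by linarith : (0 : ℝ) < T)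
  refine ⟨?_, ?_, ?_⟩
  · rw [hn, hm₀, hm, hT]
    exact sampleSize_le hε hε1 hδ hδ1 hγ hγ1
  · intro d Dx flip wstar h w₁ hw₁ F hF
    rw [hlam] at hF
    exact (sampleLaw_filterTron_fails_le h hε hε1 hη0 (by linarith) hγ hγ1 hmpos
      (hT ▸ le_rounds ε γ) hF hw₁).trans
        (ENNReal.ofReal_le_ofReal (failure_le hε hε1 hδ hδ1 hγ hγ1 hT hm₀ hm))
  · intro d hd
    refine ⟨oracle (ε / 6) lam, isFindDescentDirection_oracle hmpos (by positivity) (by linarith)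
      (hlam ▸ hηε), fun w₁ test train _ => ?_⟩
    obtain ⟨k, hk, σ, hσ, hrep⟩ := runs_filterTronProg (ε := ε) (η := η) (lam := lam) hmpos hε hε1
      (Nat.lt_log2_self (n := m)) w₁ test train
    exact ⟨k, σ, hσ, (Nat.cast_le.2 hk).trans (stepCount_le hd hTpos hmpos hm₀m hn), hrep⟩
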